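/- **Setting.** Let $\mathcal X,\mathcal Y$ be finite alphabets, $m\ge 1$, and let $P_{Y_iX_i}$, $i\in[1:m]$, be distributions on $\mathcal Y\times\mathcal X$. Let $(Q_{Y_j^n})_n$, $j\in[1:k]$, and $(Q_{X_t^n})_n$, $t\in[1:r]$, be processes on $\mathcal Y$ and $\mathcal X$. Let $P_{\mathcal X,1},\dots,P_{\mathcal X,S}$ be the distinct $\mathcal X$-marginals of the $P_{Y_iX_i}$, and let $\mathfrak F_s$ be the set of $i$ whose $\mathcal X$-marginal is $P_{\mathcal X,s}$. All logarithms are natural. Assume one of the following. (a) All $Q_{Y_j^n}=Q_{Y_j}^{\otimes n}$ and $Q_{X_t^n}=Q_{X_t}^{\otimes n}$ are memoryless; put $A_Y^{(ij)}=D(P_{Y_i}\|Q_{Y_j})$ and $A_X^{(st)}=D(P_{\mathcal X,s}\|Q_{X_t})$. (b) All the processes are Markov of finite order with time-independent transition probabilities, and $P_{Y_i}^{\otimes n}\ll Q_{Y_j^n}$, $P_{\mathcal X,s}^{\otimes n}\ll Q_{X_t^n}$ for all $i,j,s,t,n$; put $A_Y^{(ij)}=\lim_{n\to\infty}[D(P_{Y_i}^{\otimes(n+1)}\|Q_{Y_j^{n+1}})-D(P_{Y_i}^{\otimes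 n}\|Q_{Y_j^n})]$ and $A_X^{(st)}=\lim_{n\to\infty}[D(P_{\mathcal X,s}^{\otimes(n+1)}\|Q_{X_t^{n+1}})-D(P_{\mathcal X,s}^{\otimes n}\|Q_{X_t^n})]$. In both cases assume that $d_i^\star=\min_jA_Y^{(ij)}$ and $d_s^\star=\min_tA_X^{(st)}$ are finite for all $i$ and $s$, and let $j_i^\star$, $t_s^\star$ be the first indices that attain these minima. **Testing.** A testing scheme for blocklength $n$ is a pair $(\phi_n,\psi_n)$ with $\phi_n:\mathcal X^n\to\mathcal M$, $|\phi_n|=|\mathcal M|<\infty$, and a (deterministic or randomized) decision map $\psi_n$ on $\mathcal Y^n\times\mathcal M$; write $\psi_n(y^n,u)$ for the probability of deciding for $H_0$. For classes $\mathcal H_{0,n},\mathcal H_{1,n}$ of finite measures on $\mathcal Y^n\times\mathcal X^n$ let $$\alpha_n=\sup_{P\in\mathcal H_{0,n}}\sum_{y^n,u}P_{Y^n\phi_n(X^n)}(y^n,u)\,(1-\psi_n(y^n,u)),\qquad \beta_n=\sup_{Q\in\mathcal H_{1,n}}\sum_{y^n,u}Q_{Y^n\phi_n(X^n)}(y^n,u)\,\psi_n(y^n,u).$$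 A real number $E$ is an $\epsilon$-achievable exponent at rate $R_c$ if some sequence of schemes satisfies $\limsup\alpha_n\le\epsilon$, $\liminf\frac1n\log\frac1{\beta_n}\ge E$ and $\limsup\frac1n\log|\phi_n|\le R_c$. Let $E^\star_{\mathrm{comp},\epsilon}(R_c)$ be the supremum of the $\epsilon$-achievable exponents for the compound problem $\mathcal H_{0,n}=\{P_{Y_iX_i}^{\otimes n}\}_i$, $\mathcal H_{1,n}=\{Q_{Y_j^n}\times Q_{X_t^n}\}_{j,t}$. Let $0<\gamma_p,\gamma_q<1$ with $m\gamma_p\le1$, and let $\Gamma_q(n)\ge1$ with $\frac1n\log\Gamma_q(n)\to0$. Let $E^\star_{\mathrm{mix},\epsilon}(R_c)$ be the corresponding supremum for $\mathcal H_{0,n}=\mathfrak P_n$, $\mathcal H_{1,n}=\mathfrak Q_n$, where $$\mathfrak P_n=\Big\{\sum_i\nu_iP_{Y_iX_i}^{\otimes n}:\ \sum_i\nu_i=1,\ \nu_i\ge\gamma_p\ \forall i\Big\},$$ $$\mathfrak Q_n=\Big\{\sum_{j,t}\tau_{jt}\,Q_{Y_j^n}\times Q_{X_t^n}:\ 0\le\tau_{jt}\le\Gamma_q(n)\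 \forall j,t,\ \ \tau_{j_i^\star t_s^\star}\ge\gamma_q\ \forall s,\ \forall i\in\mathfrak F_s\Big\}.$$ **Theorem.** For every $R_c\ge0$, $$E^\star_{\mathrm{mix},0}(R_c)=E^\star_{\mathrm{comp},0}(R_c)=\min_{s\in[1:S]}\theta_s(R_c),\qquad \theta_s(R_c)=\max_{P_{U|\bar X_s}:\,I(\bar X_s;U)\le R_c}\ \min_{i\in\mathfrak F_s}\big[I(\bar Y_i;U)+d_i^\star+d_s^\star\big],$$ where $P_{\bar X_s}=P_{\mathcal X,s}$, $P_{\bar Y_i|\bar X_s}=P_{Y_i|X_i}$, $\bar Y_i-\bar X_s-U$ is a Markov chain, and the maximum is over all kernels to finite alphabets and is attained. -/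

import Mathlib

open Filter Topology

noncomputable section

namespace GenIndep

/-! Distributions on a finite alphabet `V` are real vectors in `stdSimplex ℝ V`; all logarithms
are natural. -/

/-- The product law `p^{⊗n}`. -/
def prodLaw {V : Type*} (p : V → ℝ) (n : ℕ) (x : Fin n → V) : ℝ := ∏ l, p (x l)

/-- Marginal of a law on `A × B` on the first coordinate. -/
def fstMarg {A B : Type*} [Fintype B] (p : A × B → ℝ) (a : A) : ℝ := ∑ b, p (a, b)

/-- Marginal of a law on `A × B` on the second coordinate. -/
def sndMarg {A B : Type*} [Fintype A] (p : A × B → ℝ) (b : B) : ℝ := ∑ a, p (a, b)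

/-- Absolute continuity `p ≪ q` on a finite alphabet. -/
def AbsCont {V : Type*} (p q : V → ℝ) : Prop := ∀ a, q a = 0 → p a = 0

open Classical in
/-- Relative entropy `D(p‖q)`, equal to `+∞` unless `p ≪ q`. -/
def relEntropy {V : Type*} [Fintype V] (p q : V → ℝ) : EReal :=
  if AbsCont p q then ((∑ a, p a * Real.log (p a / q a) : ℝ) : EReal) else ⊤

/-- Mutual information of a joint law on `A × B`. -/
def mutualInfo {A B : Type*} [Fintype A] [Fintype B] (p : A × B → ℝ) : ℝ :=
  ∑ a, ∑ b, p (a, b) * Real.log (p (a, b) / (fstMarg p a * sndMarg p b))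

/-! ### Processes of the alternative hypothesis -/

/-- A process, given by the law of its first `n` letters for each `n`. -/
abbrev SourceLaw (V : Type*) := (n : ℕ) → (Fin n → V) → ℝ

/-- Law of the first letter. -/
def SourceLaw.oneLetter {V : Type*} (q : SourceLaw V) (a : V) : ℝ := q 1 (fun _ => a)

/-- Stationary memoryless process. -/
def IsIID {V : Type*} [Fintype V] (q : SourceLaw V) : Prop :=
  q.oneLetter ∈ stdSimplex ℝ V ∧ ∀ n, q n = prodLaw q.oneLetter n

/-- Markov process of some finite order `ℓ` with time-independent transition kernel `W`, the
law of the first `ℓ` letters being arbitrary. -/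
def IsFiniteOrderMarkov {V : Type*} [Fintype V] (q : SourceLaw V) : Prop :=
  (∀ n, q n ∈ stdSimplex ℝ (Fin n → V)) ∧
  (∀ n (x : Fin n → V), ∑ a, q (n + 1) (Fin.snoc (α := fun _ => V) x a) = q n x) ∧
  ∃ (ℓ : ℕ) (W : (Fin ℓ → V) → V → ℝ), (∀ ctx, W ctx ∈ stdSimplex ℝ V) ∧
    ∀ (n : ℕ) (x : Fin (n + ℓ) → V) (a : V),
      q (n + ℓ + 1) (Fin.snoc (α := fun _ => V) x a) =
        q (n + ℓ) x * W (fun l => x (Fin.natAdd n l)) a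

/-- The two categories of alternatives. -/
inductive Category
  | iid
  | markov

/-- Membership of a process in a category. -/
def Category.Holds (c : Category) {V : Type*} [Fintype V] (q : SourceLaw V) : Prop :=
  match c with
  | .iid => IsIID q
  | .markov => IsFiniteOrderMarkov q

/-- The divergence between the memoryless source `p` and the process `q`: the single-letter
relative entropy for memoryless `q`, the limit of
`D(p^{⊗(n+1)}‖q_{n+1}) - D(p^{⊗n}‖q_n)` for Markov `q`. -/
def Category.div (c : Category) {V : Type*} [Fintype V] (p : V → ℝ) (q : SourceLaw V) : EReal :=
  match c with
  | .iid => relEntropy p q.oneLetter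
  | .markov => limUnder atTop fun n : ℕ =>
      relEntropy (prodLaw p (n + 1)) (q (n + 1)) - relEntropy (prodLaw p n) (q n)

/-- `d⋆ = min_j div(p, q_j)`. -/
def Category.minDiv (c : Category) {V : Type*} [Fintype V] {k : ℕ} (p : V → ℝ)
    (q : Fin k → SourceLaw V) : EReal :=
  ⨅ j, c.div p (q j)

/-- `j` is the first index minimizing `div(p, q_j)`. -/
def Category.IsStar (c : Category) {V : Type*} [Fintype V] {k : ℕ} (p : V → ℝ)
    (q : Fin k → SourceLaw V) (j : Fin k) : Prop :=
  (∀ j', c.div p (q j) ≤ c.div p (q j')) ∧ ∀ j' < j, c.div p (q j) < c.div p (q j')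

/-- Standing assumption on sources `p i` and alternatives `q j` over one alphabet. -/
structure Category.Admissible (c : Category) {V : Type*} [Fintype V] {m k : ℕ}
    (p : Fin m → V → ℝ) (q : Fin k → SourceLaw V) : Prop where
  holds : ∀ j, c.Holds (q j)
  absCont : c = .markov → ∀ i j n, AbsCont (prodLaw (p i) n) (q j n)
  finite : ∀ i, c.minDiv (p i) q < ⊤

/-! ### Testing schemes with one-sided compression -/

/-- Deterministic or randomized decision maps. -/
inductive DecisionKind
  | deterministic
  | randomized

/-- Possible values of the probability of deciding for the null hypothesis. -/
def DecisionKind.values : DecisionKind → Set ℝ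
  | .deterministic => {0, 1}
  | .randomized => Set.Icc 0 1

/-- A testing scheme for blocklength `n`: `enc` compresses `x^n` to one of `M` messages, and
`dec y u` is the probability of deciding for the null hypothesis on observing `y^n = y` and the
message `u`. -/
structure Scheme (κ : DecisionKind) (Y X : Type*) (n : ℕ) where
  M : ℕ
  enc : (Fin n → X) → Fin M
  dec : (Fin n → Y) → Fin M → ℝ
  dec_mem : ∀ y u, dec y u ∈ κ.values

/-- Measures on `Y^n × X^n`, as vectors. -/
abbrev JointLaw (Y X : Type*) (n : ℕ) := (Fin n → Y) × (Fin n → X) → ℝ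

variable {Y X : Type*} [Fintype Y] [Fintype X] {κ : DecisionKind} {n : ℕ}

/-- The measure of `(y^n, φ_n(x^n))`. -/
def Scheme.compress (T : Scheme κ Y X n) (p : JointLaw Y X n) (y : Fin n → Y) (u : Fin T.M) : ℝ :=
  ∑ x, if T.enc x = u then p (y, x) else 0

/-- Error of the first type under `p`. -/
def Scheme.typeI (T : Scheme κ Y X n) (p : JointLaw Y X n) : ℝ :=
  ∑ y, ∑ u, T.compress p y u * (1 - T.dec y u)

/-- Error of the second type under `q`. -/
def Scheme.typeII (T : Scheme κ Y X n) (q : JointLaw Y X n) : ℝ :=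
  ∑ y, ∑ u, T.compress q y u * T.dec y u

/-- Worst error of the first type over a class. -/
def Scheme.alpha (T : Scheme κ Y X n) (H₀ : Set (JointLaw Y X n)) : ENNReal :=
  ⨆ p ∈ H₀, ENNReal.ofReal (T.typeI p)

/-- Worst error of the second type over a class. -/
def Scheme.beta (T : Scheme κ Y X n) (H₁ : Set (JointLaw Y X n)) : ENNReal :=
  ⨆ q ∈ H₁, ENNReal.ofReal (T.typeII q)

/-- `E` is an `ε`-achievable error exponent at compression rate `R`. -/
def Achievable (κ : DecisionKind) (H₀ H₁ : (n : ℕ) → Set (JointLaw Y X n)) (ε R E : ℝ) : Prop :=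
  ∃ T : (n : ℕ) → Scheme κ Y X n,
    limsup (fun n => (T n).alpha (H₀ n)) atTop ≤ ENNReal.ofReal ε ∧
    (E : EReal) ≤ liminf (fun n : ℕ => ENNReal.log (1 / (T n).beta (H₁ n)) / (n : EReal)) atTop ∧
    limsup (fun n : ℕ => ((Real.log ((T n).M : ℝ) / (n : ℝ) : ℝ) : EReal)) atTop ≤ (R : EReal)

/-- Supremum of the `ε`-achievable error exponents at compression rate `R`. -/
def maxExponent (κ : DecisionKind) (H₀ H₁ : (n : ℕ) → Set (JointLaw Y X n)) (ε R : ℝ) : EReal :=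
  sSup {E : EReal | ∃ E' : ℝ, Achievable κ H₀ H₁ ε R E' ∧ E = (E' : EReal)}

/-! ### The two testing problems -/

/-- The law `P^{⊗n}` of `n` independent pairs. -/
def pairLaw (p : Y × X → ℝ) (n : ℕ) : JointLaw Y X n :=
  fun z => prodLaw p n (fun l => (z.1 l, z.2 l))

/-- The law `Q_{Y^n} × Q_{X^n}`. -/
def indepLaw (qY : SourceLaw Y) (qX : SourceLaw X) (n : ℕ) : JointLaw Y X n :=
  fun z => qY n z.1 * qX n z.2

variable {m k r : ℕ}

/-- Null hypothesis of the compound problem. -/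
def compNull (P : Fin m → Y × X → ℝ) (n : ℕ) : Set (JointLaw Y X n) :=
  {p | ∃ i, p = pairLaw (P i) n}

/-- Alternative hypothesis of the compound problem. -/
def compAlt (QY : Fin k → SourceLaw Y) (QX : Fin r → SourceLaw X) (n : ℕ) : Set (JointLaw Y X n) :=
  {q | ∃ j t, q = indepLaw (QY j) (QX t) n}

/-- Mixture weights under the null hypothesis. -/
def nullWeights (m : ℕ) (γp : ℝ) : Set (Fin m → ℝ) :=
  {ν | ∑ i, ν i = 1 ∧ ∀ i, γp ≤ ν i}

/-- Mixture weights under the alternative hypothesis. -/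
def altWeights (c : Category) (P : Fin m → Y × X → ℝ) (QY : Fin k → SourceLaw Y)
    (QX : Fin r → SourceLaw X) (γq Γq : ℝ) : Set (Fin k → Fin r → ℝ) :=
  {τ | (∀ j t, 0 ≤ τ j t ∧ τ j t ≤ Γq) ∧
    ∀ i j t, c.IsStar (fstMarg (P i)) QY j → c.IsStar (sndMarg (P i)) QX t → γq ≤ τ j t}

/-- The class of mixtures `∑ ν_i P_i^{⊗n}`. -/
def mixNull (P : Fin m → Y × X → ℝ) (γp : ℝ) (n : ℕ) : Set (JointLaw Y X n) :=
  {p | ∃ ν ∈ nullWeights m γp, p = fun z => ∑ i, ν i * pairLaw (P i) n z}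

/-- The class of measures `∑ τ_{jt} Q_{Y_j^n} × Q_{X_t^n}`. -/
def mixAlt (c : Category) (P : Fin m → Y × X → ℝ) (QY : Fin k → SourceLaw Y)
    (QX : Fin r → SourceLaw X) (γq : ℝ) (Γq : ℕ → ℝ) (n : ℕ) : Set (JointLaw Y X n) :=
  {q | ∃ τ ∈ altWeights c P QY QX γq (Γq n),
    q = fun z => ∑ j, ∑ t, τ j t * indepLaw (QY j) (QX t) n z}

/-! ### The single-letter quantities -/

/-- Joint law of `(X, U)` when `X ∼ pX` and `U` is drawn from the kernel `W`. -/
def inputLaw {u : ℕ} (pX : X → ℝ) (W : X → Fin u → ℝ) : X × Fin u → ℝ :=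
  fun z => pX z.1 * W z.1 z.2

/-- Joint law of `(Y, U)` when `(Y, X) ∼ p` and `U` is drawn from `W` given `X`, so that
`Y - X - U` is a Markov chain. -/
def outputLaw {u : ℕ} (p : Y × X → ℝ) (W : X → Fin u → ℝ) : Y × Fin u → ℝ :=
  fun z => ∑ x, p (z.1, x) * W x z.2

/-- For a marginal `s` on `X`: the values of `min_i [I(Y_i;U) + d⋆_i + d⋆_s]`, the minimum being
over the `i` with `X`-marginal `s`, as the kernel of `U` given `X` ranges over those with a
finite alphabet and `I(X;U) ≤ R`. -/
def thetaValues (c : Category) (P : Fin m → Y × X → ℝ) (QY : Fin k → SourceLaw Y)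
    (QX : Fin r → SourceLaw X) (R : ℝ) (s : X → ℝ) : Set EReal :=
  {v | ∃ (u : ℕ) (W : X → Fin u → ℝ), (∀ x, W x ∈ stdSimplex ℝ (Fin u)) ∧
    mutualInfo (inputLaw s W) ≤ R ∧
    v = ⨅ i : {i : Fin m // sndMarg (P i) = s},
      ((mutualInfo (outputLaw (P i) W) : ℝ) : EReal) +
        (c.minDiv (fstMarg (P i)) QY + c.minDiv s QX)}

/-- `θ_s(R)`. -/
def theta (c : Category) (P : Fin m → Y × X → ℝ) (QY : Fin k → SourceLaw Y)
    (QX : Fin r → SourceLaw X) (R : ℝ) (s : X → ℝ) : EReal :=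
  sSup (thetaValues c P QY QX R s)

end GenIndep

end

namespace GenIndep

/-! ### Product laws and masses of events -/

/-! Mixing is harmless when `ε = 0`. Both errors are linear in the law, uniform null weights and
unit alternative weights are admissible, and passing between the two problems costs only a factor
`m` in the first error and `k * r * Γq n` in the second (`achievable_mix_iff`).

Converse for the compound problem: if the type I error vanishes, the exponent is at most the
normalized relative entropy between the laws of `(y^n, φ(x^n))` (`test_exponent_le`). Against a
product alternative this splits into `I(Y^n; φ(X^n))` and two marginal divergences (`relEnt_prod`),
which for the minimizing indices are at most `n d⋆ + O(1)` (`Category.div_spec`). The encoder does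
not know `i`, so one auxiliary variable `U` must serve a whole class of equal `X`-marginals. This is
encoded by the convex hull `entRegion` of the points `(w, H(w), (H(V_i w))_i)`: its points over `s`
are exactly `(s, H(X|U), (H(Y_i|U))_i)`. The chain rule assigns such a point to every block code
(`exists_point_of_code`). Compactness of the region gives both the limit in the converse and the
attainment of the maximum.

Achievability: empirical frequencies of `x^n` reveal the `X`-marginal, so each class can use its own
code; the worst class gives the minimum over `s`. Within a class, a random code book covers the
typical `x^n` at rate `I(X;U)` (`exists_code`), and since `Y - X - U` is Markov the chosen word is
typically jointly typical with `y^n` (`mass_conditional_le`). Acceptance regions are restricted to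
blocks where every alternative is smaller than the source by the factor `exp(-n d⋆)`; joint
typicality contributes the remaining factor `exp(-n I(Y_i;U))`.

Both halves rest on an asymptotic equipartition property of memoryless sources relative to Markov
processes (`aep_markov`): after a bounded correction the log-likelihood ratio minus its drift is a
martingale with bounded increments. -/

theorem sum_snoc {V : Type*} [Fintype V] {n : ℕ} (F : (Fin (n + 1) → V) → ℝ) :
    ∑ x, F x = ∑ x : Fin n → V, ∑ a, F (Fin.snoc (α := fun _ => V) x a) := by
  rw [← (Fin.snocEquiv (fun _ : Fin (n + 1) => V)).sum_comp, Fintype.sum_prod_type_right]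
  rfl

theorem prodLaw_snoc {V : Type*} (p : V → ℝ) {n : ℕ} (x : Fin n → V) (a : V) :
    prodLaw p (n + 1) (Fin.snoc (α := fun _ => V) x a) = prodLaw p n x * p a := by
  simp [prodLaw, Fin.prod_univ_castSucc]

theorem prodLaw_nonneg {V : Type*} {p : V → ℝ} (hp : ∀ a, 0 ≤ p a) {n : ℕ} (x : Fin n → V) :
    0 ≤ prodLaw p n x :=
  Finset.prod_nonneg fun _ _ => hp _

theorem sum_prodLaw {V : Type*} [Fintype V] (p : V → ℝ) (hp : ∑ a, p a = 1) (n : ℕ) :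
    ∑ x, prodLaw p n x = 1 := by
  induction n with
  | zero => simp [prodLaw]
  | succ n ih => simp only [sum_snoc, prodLaw_snoc, ← Finset.mul_sum, hp, mul_one, ih]

theorem prodLaw_mem {V : Type*} [Fintype V] {p : V → ℝ} (hp : p ∈ stdSimplex ℝ V) (n : ℕ) :
    prodLaw p n ∈ stdSimplex ℝ (Fin n → V) :=
  ⟨fun x => prodLaw_nonneg hp.1 x, sum_prodLaw p hp.2 n⟩

open Classical in
/-- The mass that the weights `w` give to the event `A`. -/
noncomputable def mass {V : Type*} [Fintype V] (w : V → ℝ) (A : Set V) : ℝ := ∑ a, if a ∈ A then w a else 0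

section mass

variable {V : Type*} [Fintype V] {w : V → ℝ}

theorem mass_nonneg (hw : ∀ a, 0 ≤ w a) (A : Set V) : 0 ≤ mass w A :=
  Finset.sum_nonneg fun a _ => by split_ifs <;> simp [hw a]

theorem mass_mono (hw : ∀ a, 0 ≤ w a) {A B : Set V} (h : ∀ a, w a ≠ 0 → a ∈ A → a ∈ B) :
    mass w A ≤ mass w B :=
  Finset.sum_le_sum fun a _ => by
    by_cases h0 : w a = 0
    · simp [h0]
    · have := h a h0
      have := hw a
      split_ifs <;> simp_all

theorem mass_union_le (hw : ∀ a, 0 ≤ w a) (A B : Set V) :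
    mass w (A ∪ B) ≤ mass w A + mass w B := by
  rw [mass, mass, mass, ← Finset.sum_add_distrib]
  refine Finset.sum_le_sum fun a _ => ?_
  have := hw a
  by_cases h1 : a ∈ A <;> by_cases h2 : a ∈ B <;> simp [h1, h2, this]

theorem mass_iUnion_le {ι : Type*} [Fintype ι] (hw : ∀ a, 0 ≤ w a) (A : ι → Set V) :
    mass w (⋃ i, A i) ≤ ∑ i, mass w (A i) := by
  classical
  simp only [mass]
  rw [Finset.sum_comm]
  refine Finset.sum_le_sum fun a _ => ?_
  by_cases h : a ∈ ⋃ i, A i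
  · obtain ⟨i, hi⟩ := Set.mem_iUnion.1 h
    rw [if_pos h]
    calc w a = if a ∈ A i then w a else 0 := by rw [if_pos hi]
      _ ≤ _ := Finset.single_le_sum (f := fun i => if a ∈ A i then w a else 0)
        (fun j _ => by split_ifs <;> simp [hw a]) (Finset.mem_univ i)
  · rw [if_neg h]
    exact Finset.sum_nonneg fun j _ => by split_ifs <;> simp [hw a]

theorem mass_compl (A : Set V) : mass w Aᶜ = ∑ a, w a - mass w A := by
  rw [mass, mass, eq_sub_iff_add_eq, ← Finset.sum_add_distrib]
  refine Finset.sum_congr rfl fun a _ => ?_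
  by_cases h : a ∈ A <;> simp [h]

/-- Chebyshev's inequality. -/
theorem mass_le_of_sq (hw : ∀ a, 0 ≤ w a) (f : V → ℝ) {t : ℝ} (ht : 0 < t) :
    mass w {a | t ≤ |f a|} ≤ (∑ a, w a * f a ^ 2) / t ^ 2 := by
  rw [le_div_iff₀ (by positivity), mass, Finset.sum_mul]
  refine Finset.sum_le_sum fun a _ => ?_
  by_cases h : t ≤ |f a|
  · rw [if_pos (by exact h)]
    refine mul_le_mul_of_nonneg_left ?_ (hw a)
    rw [← sq_abs (f a)]
    gcongr
  · rw [if_neg (by exact h), zero_mul]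
    exact mul_nonneg (hw a) (sq_nonneg _)

end mass

/-! ### A weak law of large numbers for martingales of a memoryless source -/

section Martingale

variable {V : Type*} [Fintype V] {p : V → ℝ}

theorem sum_prodLaw_succ (p : V → ℝ) {n : ℕ} (F : (Fin (n + 1) → V) → ℝ) :
    ∑ x, prodLaw p (n + 1) x * F x =
      ∑ x, prodLaw p n x * ∑ a, p a * F (Fin.snoc (α := fun _ => V) x a) := by
  simp only [sum_snoc, prodLaw_snoc, Finset.mul_sum, mul_assoc]

/-- Martingale increments are orthogonal, so each new letter adds at most `K ^ 2`. The hypotheses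
are asked only on the support of `p` and from `n₀` on, because log-likelihood ratios are well
behaved only there. -/
theorem second_moment_le (hp : p ∈ stdSimplex ℝ V) (N : (n : ℕ) → (Fin n → V) → ℝ) (K : ℝ)
    (n₀ : ℕ)
    (hmart : ∀ n, n₀ ≤ n → ∀ x, prodLaw p n x ≠ 0 →
      ∑ a, p a * N (n + 1) (Fin.snoc (α := fun _ => V) x a) = N n x)
    (hinc : ∀ n, n₀ ≤ n → ∀ x, prodLaw p n x ≠ 0 → ∀ a, p a ≠ 0 →
      |N (n + 1) (Fin.snoc (α := fun _ => V) x a) - N n x| ≤ K) (j : ℕ) :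
    ∑ x, prodLaw p (n₀ + j) x * N (n₀ + j) x ^ 2 ≤
      ∑ x, prodLaw p n₀ x * N n₀ x ^ 2 + j * K ^ 2 := by
  induction j with
  | zero => simp
  | succ j ih =>
    have key : ∑ x, prodLaw p (n₀ + j + 1) x * N (n₀ + j + 1) x ^ 2 ≤
        ∑ x, prodLaw p (n₀ + j) x * (N (n₀ + j) x ^ 2 + K ^ 2) := by
      rw [sum_prodLaw_succ]
      refine Finset.sum_le_sum fun x _ => ?_
      by_cases h0 : prodLaw p (n₀ + j) x = 0
      · simp [h0]
      refine mul_le_mul_of_nonneg_left ?_ (prodLaw_nonneg hp.1 x)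
      have hm := hmart (n₀ + j) (by omega) x h0
      have hi := hinc (n₀ + j) (by omega) x h0
      set v := N (n₀ + j) x
      -- Pythagoras: the cross term vanishes because `v` is the conditional mean.
      have e1 : ∑ a, p a * N (n₀ + j + 1) (Fin.snoc (α := fun _ => V) x a) ^ 2 =
          ∑ a, p a * (N (n₀ + j + 1) (Fin.snoc (α := fun _ => V) x a) - v) ^ 2 + v ^ 2 := by
        have : ∀ a, p a * (N (n₀ + j + 1) (Fin.snoc (α := fun _ => V) x a) - v) ^ 2 =
            p a * N (n₀ + j + 1) (Fin.snoc (α := fun _ => V) x a) ^ 2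
            - 2 * v * (p a * N (n₀ + j + 1) (Fin.snoc (α := fun _ => V) x a)) + v ^ 2 * p a :=
          fun a => by ring
        simp only [this, Finset.sum_add_distrib, Finset.sum_sub_distrib, ← Finset.mul_sum, hm, hp.2]
        ring
      have e2 : ∑ a, p a * (N (n₀ + j + 1) (Fin.snoc (α := fun _ => V) x a) - v) ^ 2 ≤
          ∑ a, p a * K ^ 2 := by
        refine Finset.sum_le_sum fun a _ => ?_
        by_cases ha : p a = 0
        · simp [ha]
        refine mul_le_mul_of_nonneg_left ?_ (hp.1 a)
        rw [← sq_abs (_ - v)]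
        have := hi a ha
        gcongr
      rw [← Finset.sum_mul, hp.2, one_mul] at e2
      rw [e1]; linarith
    have e3 : ∑ x, prodLaw p (n₀ + j) x * (N (n₀ + j) x ^ 2 + K ^ 2) =
        ∑ x, prodLaw p (n₀ + j) x * N (n₀ + j) x ^ 2 + K ^ 2 := by
      simp only [mul_add, Finset.sum_add_distrib, ← Finset.sum_mul, sum_prodLaw p hp.2, one_mul]
    rw [e3] at key
    have : n₀ + (j + 1) = n₀ + j + 1 := rfl
    rw [this]
    push_cast
    linarith

/-- Chebyshev's inequality: a second moment of order `n` against the squared threshold `(n δ) ^ 2`.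
-/
theorem tendsto_mass_martingale (hp : p ∈ stdSimplex ℝ V) (N : (n : ℕ) → (Fin n → V) → ℝ) (K : ℝ)
    (n₀ : ℕ)
    (hmart : ∀ n, n₀ ≤ n → ∀ x, prodLaw p n x ≠ 0 →
      ∑ a, p a * N (n + 1) (Fin.snoc (α := fun _ => V) x a) = N n x)
    (hinc : ∀ n, n₀ ≤ n → ∀ x, prodLaw p n x ≠ 0 → ∀ a, p a ≠ 0 →
      |N (n + 1) (Fin.snoc (α := fun _ => V) x a) - N n x| ≤ K) {δ : ℝ} (hδ : 0 < δ) :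
    Tendsto (fun n : ℕ => mass (prodLaw p n) {x | n * δ ≤ |N n x|}) atTop (𝓝 0) := by
  set B := ∑ x, prodLaw p n₀ x * N n₀ x ^ 2
  have hB : 0 ≤ B := Finset.sum_nonneg fun x _ =>
    mul_nonneg (prodLaw_nonneg hp.1 x) (sq_nonneg _)
  have hlim : Tendsto (fun n : ℕ => ((B + K ^ 2) / δ ^ 2) / (n : ℝ)) atTop (𝓝 0) :=
    tendsto_const_div_atTop_nhds_zero_nat _
  refine squeeze_zero' (Eventually.of_forall fun n => mass_nonneg (fun x => prodLaw_nonneg hp.1 x) _)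
    ?_ hlim
  filter_upwards [eventually_ge_atTop (n₀ + 1)] with n hn
  have hn0 : (0 : ℝ) < n := by exact_mod_cast (by omega : 0 < n)
  have hn1 : (1 : ℝ) ≤ n := by exact_mod_cast (by omega : 1 ≤ n)
  refine (mass_le_of_sq (fun x => prodLaw_nonneg hp.1 x) (N n) (by positivity)).trans ?_
  obtain ⟨j, rfl⟩ := Nat.exists_eq_add_of_le (by omega : n₀ ≤ n)
  have h := second_moment_le hp N K n₀ hmart hinc j
  have hj : (j : ℝ) ≤ ((n₀ + j : ℕ) : ℝ) := by push_cast; linarith [Nat.cast_nonneg (α := ℝ) n₀]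
  set n := n₀ + j
  rw [div_div, div_le_div_iff₀ (by positivity) (by positivity)]
  have h2 : ∑ x, prodLaw p n x * N n x ^ 2 ≤ n * (B + K ^ 2) := by
    calc _ ≤ B + j * K ^ 2 := h
      _ ≤ n * B + n * K ^ 2 := by
        refine add_le_add (le_mul_of_one_le_left hB hn1) (by gcongr)
      _ = _ := by ring
  calc _ ≤ n * (B + K ^ 2) * (δ ^ 2 * n) := by gcongr
    _ = _ := by ring

end Martingale

/-! ### Asymptotic equipartition for Markov processes -/

section Markov

variable {V : Type*} [Fintype V] {p : V → ℝ}

/-- A function of the last `j` letters. -/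
noncomputable def windowFn {V : Type*} {j : ℕ} (c : (Fin j → V) → ℝ) (n : ℕ) (x : Fin n → V) : ℝ :=
  if h : j ≤ n then c (fun l => x ⟨n - j + l, by omega⟩) else 0

theorem windowFn_add {V : Type*} {j : ℕ} (c : (Fin j → V) → ℝ) (n : ℕ) (x : Fin (n + j) → V) :
    windowFn c (n + j) x = c (fun l => x (Fin.natAdd n l)) := by
  rw [windowFn, dif_pos (by omega)]
  congr 1
  funext l
  congr 1
  ext
  simp

theorem abs_windowFn_le {j : ℕ} (c : (Fin j → V) → ℝ) (n : ℕ) (x : Fin n → V) :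
    |windowFn c n x| ≤ ∑ z, |c z| := by
  rw [windowFn]
  split_ifs with h
  · exact Finset.single_le_sum (f := fun z => |c z|) (fun z _ => abs_nonneg _) (Finset.mem_univ _)
  · simpa using Finset.sum_nonneg fun z _ => abs_nonneg (c z)

theorem sum_windowFn_snoc {j : ℕ} (c : (Fin (j + 1) → V) → ℝ) {n : ℕ} (hn : j ≤ n)
    (x : Fin n → V) :
    ∑ a, p a * windowFn c (n + 1) (Fin.snoc (α := fun _ => V) x a) =
      windowFn (fun z => ∑ a, p a * c (Fin.snoc (α := fun _ => V) z a)) n x := by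
  obtain ⟨n, rfl⟩ := Nat.exists_eq_add_of_le' hn
  rw [windowFn_add]
  refine Finset.sum_congr rfl fun a _ => ?_
  have : windowFn c (n + j + 1) (Fin.snoc (α := fun _ => V) x a) =
      c (fun l => Fin.snoc (α := fun _ => V) x a (Fin.natAdd n l)) :=
    windowFn_add c n (Fin.snoc (α := fun _ => V) x a)
  rw [this]
  congr 2
  funext l
  induction l using Fin.lastCases with
  | last =>
    have : Fin.natAdd n (Fin.last j) = Fin.last (n + j) := by ext; simp
    rw [this, Fin.snoc_last, Fin.snoc_last]
  | cast l =>
    have : Fin.natAdd n (Fin.castSucc l) = Fin.castSucc (Fin.natAdd n l) := by ext; simp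
    rw [this, Fin.snoc_castSucc, Fin.snoc_castSucc]

/-- The Poisson equation for functions of the last `j` letters of a memoryless source. -/
theorem exists_poisson (hp : p ∈ stdSimplex ℝ V) {j : ℕ} (c : (Fin j → V) → ℝ) :
    ∃ (h : (n : ℕ) → (Fin n → V) → ℝ) (B A : ℝ), (∀ n x, |h n x| ≤ B) ∧
      (∀ n, j ≤ n → ∀ x, h n x - ∑ a, p a * h (n + 1) (Fin.snoc (α := fun _ => V) x a) =
        windowFn c n x - A) ∧
      ∀ n, j ≤ n → ∑ x, prodLaw p n x * windowFn c n x = A := by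
  induction j with
  | zero =>
    have hc : ∀ n (x : Fin n → V), windowFn c n x = c default := fun n x => by
      rw [windowFn, dif_pos (Nat.zero_le _)]
      exact congrArg c (Subsingleton.elim _ _)
    exact ⟨fun _ _ => 0, 0, c default, by simp, by simp [hc], fun n _ => by
      simp only [hc, ← Finset.sum_mul, sum_prodLaw p hp.2, one_mul]⟩
  | succ j ih =>
    -- Averaging out the newest letter shortens the window by one. The solution `h` is the sum of
    -- these successive averages, and the constant `A` is what remains when the window is empty.
    obtain ⟨h, B, A, hB, hP, hE⟩ := ih (fun z => ∑ a, p a * c (Fin.snoc (α := fun _ => V) z a))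
    refine ⟨fun n x => windowFn c n x + h n x, ∑ z, |c z| + B, A, fun n x => ?_,
      fun n hn x => ?_, fun n hn => ?_⟩
    · exact (abs_add_le _ _).trans (add_le_add (abs_windowFn_le c n x) (hB n x))
    · have := hP n (by omega) x
      rw [← sum_windowFn_snoc c (by omega)] at this
      simp only [mul_add, Finset.sum_add_distrib]
      linarith
    · obtain ⟨n, rfl⟩ := Nat.exists_eq_add_of_le' (by omega : 1 ≤ n)
      rw [sum_prodLaw_succ]
      simp only [sum_windowFn_snoc c (by omega : j ≤ n)]
      exact hE n (by omega)

/-- Relative entropy of absolutely continuous laws, as a real number. -/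
noncomputable def relEnt (p q : V → ℝ) : ℝ := ∑ a, p a * Real.log (p a / q a)

theorem relEntropy_of_absCont {p q : V → ℝ} (h : AbsCont p q) :
    relEntropy p q = ((relEnt p q : ℝ) : EReal) := by
  rw [relEntropy, if_pos h, relEnt]

/-- The two-sided asymptotic equipartition event at divergence rate `A` and tolerance `δ`. -/
def aepSet (p : V → ℝ) (q : SourceLaw V) (A δ : ℝ) (n : ℕ) : Set (Fin n → V) :=
  {x | Real.exp (n * (A - δ)) * q n x ≤ prodLaw p n x ∧
    prodLaw p n x ≤ Real.exp (n * (A + δ)) * q n x}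

/-- The conditional drift of the log-likelihood ratio depends only on the last `ℓ` letters. The
Poisson equation replaces this drift by the constant `A` at the price of a bounded correction. -/
theorem aep_markov (hp : p ∈ stdSimplex ℝ V) (q : SourceLaw V) (hq : ∀ n x, 0 ≤ q n x)
    (ℓ : ℕ) (W : (Fin ℓ → V) → V → ℝ)
    (hrec : ∀ (n : ℕ) (x : Fin (n + ℓ) → V) (a : V),
      q (n + ℓ + 1) (Fin.snoc (α := fun _ => V) x a) =
        q (n + ℓ) x * W (fun l => x (Fin.natAdd n l)) a)
    (hac : ∀ n, AbsCont (prodLaw p n) (q n)) :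
    ∃ A : ℝ, (∀ n, ℓ ≤ n → relEnt (prodLaw p (n + 1)) (q (n + 1)) =
        relEnt (prodLaw p n) (q n) + A) ∧
      ∀ δ, 0 < δ → Tendsto (fun n => mass (prodLaw p n) (aepSet p q A δ n)ᶜ) atTop (𝓝 0) := by
  classical
  set L : (n : ℕ) → (Fin n → V) → ℝ := fun n x => Real.log (prodLaw p n x / q n x) with hL
  -- Mean increment of `L` given the last `ℓ` letters.
  set g : (Fin ℓ → V) → ℝ := fun z => ∑ a, p a * Real.log (p a / W z a) with hg
  obtain ⟨h, B, A, hB, hP, hE⟩ := exists_poisson hp g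
  have hLrec : ∀ n (x : Fin (n + ℓ) → V), prodLaw p (n + ℓ) x ≠ 0 → ∀ a, p a ≠ 0 →
      L (n + ℓ + 1) (Fin.snoc (α := fun _ => V) x a) =
        L (n + ℓ) x + Real.log (p a / W (fun l => x (Fin.natAdd n l)) a) := by
    intro n x hx a ha
    have h1 : prodLaw p (n + ℓ + 1) (Fin.snoc (α := fun _ => V) x a) ≠ 0 := by
      rw [prodLaw_snoc]; exact mul_ne_zero hx ha
    have h2 : q (n + ℓ + 1) (Fin.snoc (α := fun _ => V) x a) ≠ 0 := fun h => h1 (hac _ _ h)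
    rw [hrec] at h2
    have h3 := left_ne_zero_of_mul h2
    have h4 := right_ne_zero_of_mul h2
    simp only [hL]
    rw [prodLaw_snoc, hrec, mul_div_mul_comm, Real.log_mul (div_ne_zero hx h3) (div_ne_zero ha h4)]
  have hLavg : ∀ n, ℓ ≤ n → ∀ x, prodLaw p n x ≠ 0 →
      ∑ a, p a * L (n + 1) (Fin.snoc (α := fun _ => V) x a) = L n x + windowFn g n x := by
    intro n hn x hx
    obtain ⟨n, rfl⟩ := Nat.exists_eq_add_of_le' hn
    have : ∀ a, p a * L (n + ℓ + 1) (Fin.snoc (α := fun _ => V) x a) =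
        p a * L (n + ℓ) x + p a * Real.log (p a / W (fun l => x (Fin.natAdd n l)) a) := by
      intro a
      by_cases ha : p a = 0
      · simp [ha]
      · rw [hLrec n x hx a ha, mul_add]
    rw [Finset.sum_congr rfl fun a _ => this a, Finset.sum_add_distrib, ← Finset.sum_mul, hp.2,
      one_mul, windowFn_add]
  refine ⟨A, fun n hn => ?_, fun δ hδ => ?_⟩
  · have : ∀ x, prodLaw p n x * ∑ a, p a * L (n + 1) (Fin.snoc (α := fun _ => V) x a) =
        prodLaw p n x * L n x + prodLaw p n x * windowFn g n x := by
      intro x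
      by_cases hx : prodLaw p n x = 0
      · simp [hx]
      · rw [hLavg n hn x hx, mul_add]
    have e := sum_prodLaw_succ p (L (n + 1))
    rw [Finset.sum_congr rfl fun x _ => this x, Finset.sum_add_distrib, hE n hn] at e
    exact e
  -- The correction `h` turns the centred log-likelihood ratio into a martingale.
  · set N : (n : ℕ) → (Fin n → V) → ℝ := fun n x => L n x + h n x - n * A with hN
    set C : ℝ := ∑ z, ∑ a, |Real.log (p a / W z a)|
    have hC : ∀ z a, |Real.log (p a / W z a)| ≤ C := fun z a =>
      (Finset.single_le_sum (f := fun a => |Real.log (p a / W z a)|) (fun a _ => abs_nonneg _)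
        (Finset.mem_univ a)).trans
      (Finset.single_le_sum (f := fun z => ∑ a, |Real.log (p a / W z a)|)
        (fun z _ => Finset.sum_nonneg fun a _ => abs_nonneg _) (Finset.mem_univ z))
    have hT := tendsto_mass_martingale hp N (C + (B + B) + |A|) ℓ
      (by
        intro n hn x hx
        have e1 := hP n hn x
        have e2 := hLavg n hn x hx
        have : ∀ a, p a * N (n + 1) (Fin.snoc (α := fun _ => V) x a) =
            p a * L (n + 1) (Fin.snoc (α := fun _ => V) x a) +
            p a * h (n + 1) (Fin.snoc (α := fun _ => V) x a) - p a * ((n + 1) * A) := by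
          intro a; simp only [hN]; push_cast; ring
        rw [Finset.sum_congr rfl fun a _ => this a, Finset.sum_sub_distrib,
          Finset.sum_add_distrib, ← Finset.sum_mul, hp.2, e2]
        simp only [hN]
        linarith)
      (by
        intro n hn x hx a ha
        obtain ⟨n, rfl⟩ := Nat.exists_eq_add_of_le' hn
        have e := hLrec n x hx a ha
        have : N (n + ℓ + 1) (Fin.snoc (α := fun _ => V) x a) - N (n + ℓ) x =
            Real.log (p a / W (fun l => x (Fin.natAdd n l)) a) +
            (h (n + ℓ + 1) (Fin.snoc (α := fun _ => V) x a) - h (n + ℓ) x) - A := by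
          simp only [hN, e]; push_cast; ring
        rw [this]
        refine (abs_sub _ _).trans (add_le_add ((abs_add_le _ _).trans (add_le_add (hC _ _)
          ((abs_sub _ _).trans (add_le_add (hB _ _) (hB _ _))))) le_rfl))
      (half_pos hδ)
    refine squeeze_zero' (Eventually.of_forall fun n =>
      mass_nonneg (fun x => prodLaw_nonneg hp.1 x) _) ?_ hT
    -- Half of the tolerance is spent on the martingale, the other half absorbs the correction `h`.
    have hev : ∀ᶠ n : ℕ in atTop, B < n * (δ / 2) :=
      (tendsto_natCast_atTop_atTop.atTop_mul_const (half_pos hδ)).eventually_gt_atTop B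
    filter_upwards [hev] with n hn
    refine mass_mono (fun x => prodLaw_nonneg hp.1 x) fun x hx hxA => ?_
    by_contra hlt
    apply hxA
    simp only [Set.mem_ofPred_eq, not_le] at hlt
    have hp0 : 0 < prodLaw p n x := lt_of_le_of_ne (prodLaw_nonneg hp.1 x) hx.symm
    have hq0 : 0 < q n x := lt_of_le_of_ne (hq n x) fun h => hx (hac n x h.symm)
    have h1 := abs_lt.1 hlt
    have h2 := abs_le.1 (hB n x)
    simp only [hN, hL] at h1
    have hlog : Real.log (prodLaw p n x / q n x) = Real.log (prodLaw p n x) - Real.log (q n x) :=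
      Real.log_div hp0.ne' hq0.ne'
    rw [hlog] at h1
    constructor
    · rw [← Real.log_le_log_iff (by positivity) hp0, Real.log_mul (Real.exp_pos _).ne' hq0.ne',
        Real.log_exp]
      linarith
    · rw [← Real.log_le_log_iff hp0 (by positivity), Real.log_mul (Real.exp_pos _).ne' hq0.ne',
        Real.log_exp]
      linarith

theorem relEnt_affine {D : ℕ → ℝ} {A : ℝ} {ℓ : ℕ} (h : ∀ n, ℓ ≤ n → D (n + 1) = D n + A) :
    ∃ C, ∀ n, ℓ ≤ n → D n = n * A + C := by
  refine ⟨D ℓ - ℓ * A, fun n hn => ?_⟩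
  induction n, hn using Nat.le_induction with
  | base => ring
  | succ n hn ih => rw [h n hn, ih]; push_cast; ring

theorem absCont_prodLaw {V : Type*} {p q : V → ℝ} (h : AbsCont p q) (n : ℕ) :
    AbsCont (prodLaw p n) (prodLaw q n) := by
  intro x hx
  obtain ⟨l, -, hl⟩ := Finset.prod_eq_zero_iff.1 hx
  exact Finset.prod_eq_zero (Finset.mem_univ l) (h _ hl)

/-- Asymptotic equipartition for a pair of memoryless laws. -/
theorem aep_iid (hp : p ∈ stdSimplex ℝ V) {q : V → ℝ} (hq : ∀ a, 0 ≤ q a) (hac : AbsCont p q) :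
    (∀ n, relEnt (prodLaw p n) (prodLaw q n) = n * relEnt p q) ∧
      ∀ δ, 0 < δ → Tendsto (fun n => mass (prodLaw p n)
        (aepSet p (fun n => prodLaw q n) (relEnt p q) δ n)ᶜ) atTop (𝓝 0) := by
  -- A memoryless law is Markov of order zero; blocks of lengths 0 and 1 identify the constant `A`.
  obtain ⟨A, hA, hT⟩ := aep_markov hp (fun n => prodLaw q n) (fun n x => prodLaw_nonneg hq x) 0
    (fun _ => q) (fun n x a => prodLaw_snoc q x a) (absCont_prodLaw hac)
  have h0 : relEnt (prodLaw p 0) (prodLaw q 0) = 0 := by simp [relEnt, prodLaw]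
  have h1 : relEnt (prodLaw p 1) (prodLaw q 1) = relEnt p q := by
    rw [relEnt, relEnt, ← (Equiv.funUnique (Fin 1) V).symm.sum_comp]
    simp [prodLaw]
  have hAe : A = relEnt p q := by
    have := hA 0 le_rfl
    rw [h0, h1] at this
    linarith
  subst hAe
  refine ⟨fun n => ?_, hT⟩
  induction n with
  | zero => simp [h0]
  | succ n ih => rw [hA n (Nat.zero_le _), ih]; push_cast; ring

/-- Weak law of large numbers for a bounded function of the letters. -/
theorem tendsto_mass_empirical (hp : p ∈ stdSimplex ℝ V) (f : V → ℝ) {δ : ℝ} (hδ : 0 < δ) :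
    Tendsto (fun n : ℕ => mass (prodLaw p n)
      {x | n * δ ≤ |∑ l, f (x l) - n * ∑ a, p a * f a|}) atTop (𝓝 0) := by
  set μ := ∑ a, p a * f a
  refine tendsto_mass_martingale hp (fun n x => ∑ l, f (x l) - n * μ) (∑ a, |f a| + |μ|) 0
    (fun n _ x _ => ?_) (fun n _ x _ a _ => ?_) hδ
  · simp only [Fin.sum_univ_castSucc, Fin.snoc_castSucc, Fin.snoc_last]
    have : ∀ a, p a * (∑ l, f (x l) + f a - ((n + 1 : ℕ) : ℝ) * μ) =
        p a * (∑ l, f (x l) - ((n + 1 : ℕ) : ℝ) * μ) + p a * f a := fun a => by ring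
    simp only [this, Finset.sum_add_distrib, ← Finset.sum_mul, hp.2]
    push_cast
    ring
  · simp only [Fin.sum_univ_castSucc, Fin.snoc_castSucc, Fin.snoc_last]
    have : ∑ l, f (x l) + f a - ((n + 1 : ℕ) : ℝ) * μ - (∑ l, f (x l) - n * μ) = f a - μ := by
      push_cast; ring
    rw [this]
    exact (abs_sub _ _).trans (add_le_add (Finset.single_le_sum (f := fun a => |f a|)
      (fun a _ => abs_nonneg _) (Finset.mem_univ a)) le_rfl)

end Markov

/-! ### Divergence rates in the two categories of alternatives -/

section Category

variable {V : Type*} [Fintype V] {p : V → ℝ} {q : SourceLaw V} {c : Category}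

theorem Category.Holds.mem (h : c.Holds q) (n : ℕ) : q n ∈ stdSimplex ℝ (Fin n → V) := by
  cases c with
  | iid => rw [h.2 n]; exact prodLaw_mem h.1 n
  | markov => exact h.1 n

/-- The divergence rate of an absolutely continuous pair is finite and governs both the relative
entropies of blocks and the likelihood ratio. -/
theorem Category.div_spec (hp : p ∈ stdSimplex ℝ V) (h : c.Holds q)
    (hac : ∀ n, AbsCont (prodLaw p n) (q n)) :
    ∃ A C : ℝ, c.div p q = A ∧
      (∀ᶠ n : ℕ in atTop, relEnt (prodLaw p n) (q n) = n * A + C) ∧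
      ∀ δ, 0 < δ → Tendsto (fun n => mass (prodLaw p n) (aepSet p q A δ n)ᶜ) atTop (𝓝 0) := by
  cases c with
  | iid =>
    have hac1 : AbsCont p q.oneLetter := by
      intro a ha
      have := hac 1 (fun _ => a) ha
      simpa [prodLaw] using this
    have hq : q = fun n => prodLaw q.oneLetter n := funext h.2
    obtain ⟨h1, h2⟩ := aep_iid hp h.1.1 hac1
    refine ⟨relEnt p q.oneLetter, 0, relEntropy_of_absCont hac1,
      Eventually.of_forall fun n => ?_, ?_⟩
    · rw [h.2 n, h1 n, add_zero]
    · intro δ hδ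
      have := h2 δ hδ
      rwa [← hq] at this
  | markov =>
    obtain ⟨hmem, -, ℓ, W, -, hrec⟩ := h
    obtain ⟨A, hA, hT⟩ := aep_markov hp q (fun n => (hmem n).1) ℓ W hrec hac
    obtain ⟨C, hC⟩ := relEnt_affine (D := fun n => relEnt (prodLaw p n) (q n)) hA
    refine ⟨A, C, ?_, eventually_atTop.2 ⟨ℓ, hC⟩, hT⟩
    -- The differences of block divergences are constant from the order `ℓ` on, so their limit
    -- exists.
    refine Tendsto.limUnder_eq (tendsto_const_nhds.congr' ?_)
    filter_upwards [eventually_ge_atTop ℓ] with n hn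
    rw [relEntropy_of_absCont (hac _), relEntropy_of_absCont (hac _), hA n hn, ← EReal.coe_sub]
    congr 1
    ring

theorem Category.absCont_of_div_lt_top (h : c.Holds q)
    (hac : c = .markov → ∀ n, AbsCont (prodLaw p n) (q n)) (hd : c.div p q < ⊤) (n : ℕ) :
    AbsCont (prodLaw p n) (q n) := by
  cases c with
  | iid =>
    rw [h.2 n]
    refine absCont_prodLaw ?_ n
    by_contra hn
    simp only [Category.div, relEntropy, if_neg hn, lt_self_iff_false] at hd
  | markov => exact hac rfl n

/-- Below the divergence rate the likelihood ratio exceeds the exponential with high probability. -/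
theorem Category.tendsto_mass_lt_div (hp : p ∈ stdSimplex ℝ V) (h : c.Holds q)
    (hac : c = .markov → ∀ n, AbsCont (prodLaw p n) (q n)) {a : ℝ} (ha : (a : EReal) < c.div p q) :
    Tendsto (fun n : ℕ => mass (prodLaw p n) {x | q n x ≤ Real.exp (-(n * a)) * prodLaw p n x}ᶜ)
      atTop (𝓝 0) := by
  have hp0 : ∀ n (x : Fin n → V), 0 ≤ prodLaw p n x := fun n x => prodLaw_nonneg hp.1 x
  by_cases hd : c.div p q < ⊤
  · obtain ⟨A, C, hA, -, hT⟩ := Category.div_spec hp h (Category.absCont_of_div_lt_top h hac hd)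
    rw [hA, EReal.coe_lt_coe_iff] at ha
    refine squeeze_zero (fun n => mass_nonneg (hp0 n) _) (fun n => ?_)
      (hT (A - a) (sub_pos.2 ha))
    refine mass_mono (hp0 n) fun x _ hx hx' => hx ?_
    have h1 := hx'.1
    rw [sub_sub_cancel] at h1
    change q n x ≤ _
    calc q n x = Real.exp (-(n * a)) * (Real.exp (n * a) * q n x) := by
          rw [← mul_assoc, ← Real.exp_add]; simp
      _ ≤ _ := mul_le_mul_of_nonneg_left h1 (Real.exp_pos _).le
  · cases c with
    | markov =>
      obtain ⟨A, C, hA, -⟩ := Category.div_spec hp h (hac rfl)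
      exact absurd (hA ▸ EReal.coe_lt_top A) hd
    | iid =>
      classical
      -- Infinite divergence of memoryless laws comes from a letter `b` with `p b > 0` and
      -- `q`-probability zero. A typical block contains `b`, so its `q`-probability vanishes and any
      -- exponential bound holds.
      have hnac : ¬ AbsCont p q.oneLetter := fun hac1 =>
        hd (by simp only [Category.div, relEntropy_of_absCont hac1, EReal.coe_lt_top])
      simp only [AbsCont, not_forall] at hnac
      obtain ⟨b, hqb, hpb⟩ := hnac
      have hpb' : 0 < p b := lt_of_le_of_ne (hp.1 b) (Ne.symm hpb)
      have hT := tendsto_mass_empirical hp (fun x => if x = b then 1 else 0) hpb'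
      refine squeeze_zero (fun n => mass_nonneg (hp0 n) _) (fun n => ?_) hT
      refine mass_mono (hp0 n) fun x _ hx => ?_
      have hb : ∀ l, x l ≠ b := by
        intro l hl
        apply hx
        change q n x ≤ _
        rw [h.2 n, prodLaw, Finset.prod_eq_zero (Finset.mem_univ l) (by rw [hl, hqb])]
        exact mul_nonneg (Real.exp_pos _).le (hp0 n x)
      simp [hb, abs_of_pos hpb']

end Category

open Real

/-! ### Entropy of unnormalized laws -/

section Entropy

variable {A B : Type*} [Fintype A] [Fintype B]

/-- The log-sum inequality. -/
theorem log_sum_le {w q : A → ℝ} (hw : ∀ a, 0 ≤ w a) (hq : ∀ a, 0 ≤ q a) (h : AbsCont w q) :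
    (∑ a, w a) * log ((∑ a, w a) / ∑ a, q a) ≤ ∑ a, w a * log (w a / q a) := by
  set S := ∑ a, w a with hS
  set Q := ∑ a, q a with hQ
  rcases (Finset.sum_nonneg fun a _ => hw a : 0 ≤ S).eq_or_lt with h0 | hS0
  · have : ∀ a, w a = 0 := fun a =>
      (Finset.sum_eq_zero_iff_of_nonneg fun a _ => hw a).1 h0.symm a (Finset.mem_univ a)
    simp [hS, this]
  have hQ0 : 0 < Q := by
    rcases (Finset.sum_nonneg fun a _ => hq a : 0 ≤ Q).eq_or_lt with h0 | h0
    · exfalso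
      have hz : ∀ a, w a = 0 := fun a =>
        h a ((Finset.sum_eq_zero_iff_of_nonneg fun a _ => hq a).1 h0.symm a (Finset.mem_univ a))
      exact hS0.ne' (Finset.sum_eq_zero fun a _ => hz a)
    · exact h0
  -- This is `log t ≥ 1 - 1/t` at `t = (w a / q a) / (S / Q)`; the linear corrections cancel on
  -- summation.
  have key : ∀ a, w a * log (S / Q) + (w a - q a * (S / Q)) ≤ w a * log (w a / q a) := by
    intro a
    rcases (hw a).eq_or_lt with h1 | h1
    · rw [← h1]
      have := mul_nonneg (hq a) (div_pos hS0 hQ0).le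
      simp only [zero_mul, zero_sub, zero_add]
      linarith
    have h2 : 0 < q a := lt_of_le_of_ne (hq a) fun h' => h1.ne' (h a h'.symm)
    have h3 := one_sub_inv_le_log_of_pos (x := (w a / q a) / (S / Q)) (by positivity)
    rw [log_div (by positivity) (by positivity)] at h3
    have h4 := mul_le_mul_of_nonneg_left h3 h1.le
    have h5 : w a * (1 - (w a / q a / (S / Q))⁻¹) = w a - q a * (S / Q) := by
      field_simp
    rw [h5] at h4
    linarith
  have := Finset.sum_le_sum fun a (_ : a ∈ Finset.univ) => key a
  rw [Finset.sum_add_distrib, Finset.sum_sub_distrib, ← Finset.sum_mul, ← Finset.sum_mul, ← hS,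
    ← hQ, mul_div_cancel₀ _ hQ0.ne'] at this
  linarith

/-- Shannon entropy. -/
noncomputable def ent (w : A → ℝ) : ℝ := ∑ a, negMulLog (w a)

/-- The homogeneous extension of the Shannon entropy to vectors of arbitrary mass. -/
noncomputable def homEnt (w : A → ℝ) : ℝ := ent w - negMulLog (∑ a, w a)

theorem continuous_homEnt : Continuous (homEnt : (A → ℝ) → ℝ) := by
  unfold homEnt ent
  fun_prop

theorem homEnt_of_sum_eq_one {w : A → ℝ} (h : ∑ a, w a = 1) : homEnt w = ent w := by
  simp [homEnt, h]

theorem homEnt_smul (t : ℝ) (w : A → ℝ) : homEnt (t • w) = t * homEnt w := by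
  simp only [homEnt, ent, Pi.smul_apply, smul_eq_mul, ← Finset.mul_sum, negMulLog_mul,
    Finset.sum_add_distrib, ← Finset.sum_mul]
  ring

/-- Gibbs' inequality against the normalized `q`, with equality when `q = w`. -/
theorem homEnt_le_cross {w q : A → ℝ} (hw : ∀ a, 0 ≤ w a) (hq : ∀ a, 0 ≤ q a)
    (h : AbsCont w q) : homEnt w ≤ ∑ a, w a * (log (∑ b, q b) - log (q a)) := by
  have h1 := log_sum_le hw hq h
  have h2 : ∀ a, w a * log (w a / q a) = -negMulLog (w a) - w a * log (q a) := by
    intro a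
    by_cases h0 : w a = 0
    · simp [h0]
    · rw [log_div h0 fun hq0 => h0 (h a hq0), negMulLog]; ring
  have h3 : (∑ a, w a) * log ((∑ a, w a) / ∑ a, q a) =
      -negMulLog (∑ a, w a) - (∑ a, w a) * log (∑ a, q a) := by
    by_cases h0 : ∑ a, w a = 0
    · simp [h0]
    · have hq0 : ∑ a, q a ≠ 0 := by
        intro hq0
        apply h0
        refine Finset.sum_eq_zero fun a _ => h a ?_
        exact (Finset.sum_eq_zero_iff_of_nonneg fun a _ => hq a).1 hq0 a (Finset.mem_univ a)
      rw [log_div h0 hq0, negMulLog]; ring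
  rw [Finset.sum_congr rfl fun a _ => h2 a, h3, Finset.sum_sub_distrib,
    Finset.sum_neg_distrib] at h1
  simp only [homEnt, ent, mul_sub, Finset.sum_sub_distrib, ← Finset.sum_mul]
  linarith

/-- The homogeneous entropy is superadditive. -/
theorem sum_homEnt_le (w : B → A → ℝ) (hw : ∀ b a, 0 ≤ w b a) :
    ∑ b, homEnt (w b) ≤ homEnt (fun a => ∑ b, w b a) := by
  set z : A → ℝ := fun a => ∑ b, w b a with hz
  have hz0 : ∀ a, 0 ≤ z a := fun a => Finset.sum_nonneg fun b _ => hw b a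
  -- All pieces are compared with the same total `z`, so the bounds are linear in the pieces and add
  -- up to exactly `homEnt z`.
  have h1 : ∀ b, homEnt (w b) ≤ ∑ a, w b a * (log (∑ a, z a) - log (z a)) := fun b =>
    homEnt_le_cross (hw b) hz0 fun a ha =>
      (Finset.sum_eq_zero_iff_of_nonneg fun b _ => hw b a).1 ha b (Finset.mem_univ b)
  calc _ ≤ ∑ b, ∑ a, w b a * (log (∑ a, z a) - log (z a)) := Finset.sum_le_sum fun b _ => h1 b
    _ = ∑ a, z a * (log (∑ a, z a) - log (z a)) := by
      rw [Finset.sum_comm]; simp only [hz, Finset.sum_mul]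
    _ = homEnt z := by
      simp only [homEnt, ent, mul_sub, Finset.sum_sub_distrib, ← Finset.sum_mul, negMulLog,
        neg_mul, Finset.sum_neg_distrib]
      ring

/-- This is `I(A;B) = H(A) - H(A|B)`: the homogeneous entropy of a column is its mass times the
entropy of the conditional law, so no division by zero masses is needed. -/
theorem mutualInfo_eq {p : A × B → ℝ} (hp : ∀ z, 0 ≤ p z) :
    mutualInfo p = ent (fstMarg p) - ∑ b, homEnt (fun a => p (a, b)) := by
  have h1 : ∀ a b, p (a, b) * log (p (a, b) / (fstMarg p a * sndMarg p b)) =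
      -negMulLog (p (a, b)) - p (a, b) * log (fstMarg p a) - p (a, b) * log (sndMarg p b) := by
    intro a b
    by_cases h0 : p (a, b) = 0
    · simp [h0]
    have hpos : 0 < p (a, b) := lt_of_le_of_ne (hp _) (Ne.symm h0)
    have hf : fstMarg p a ≠ 0 := (hpos.trans_le (Finset.single_le_sum (f := fun b => p (a, b))
      (fun b _ => hp _) (Finset.mem_univ b))).ne'
    have hs : sndMarg p b ≠ 0 := (hpos.trans_le (Finset.single_le_sum (f := fun a => p (a, b))
      (fun a _ => hp _) (Finset.mem_univ a))).ne'
    rw [log_div h0 (mul_ne_zero hf hs), log_mul hf hs, negMulLog]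
    ring
  have h2 : ∑ a, ∑ b, p (a, b) * log (fstMarg p a) = -ent (fstMarg p) := by
    simp only [ent, negMulLog, ← Finset.sum_mul, neg_mul, Finset.sum_neg_distrib, neg_neg]
    rfl
  have h3 : ∑ a, ∑ b, p (a, b) * log (sndMarg p b) = -∑ b, negMulLog (sndMarg p b) := by
    rw [Finset.sum_comm]
    simp only [negMulLog, ← Finset.sum_mul, neg_mul, Finset.sum_neg_distrib, neg_neg]
    rfl
  simp only [mutualInfo, h1, Finset.sum_sub_distrib, h2, h3, homEnt, Finset.sum_neg_distrib, ent]
  rw [Finset.sum_comm]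
  simp only [sndMarg]
  ring

/-- Chain rule: entropy of the prefix plus conditional entropy of the last letter. -/
theorem homEnt_snoc {V : Type*} [Fintype V] {n : ℕ} (F : (Fin (n + 1) → V) → ℝ) :
    homEnt F = homEnt (fun x : Fin n → V => ∑ a, F (Fin.snoc (α := fun _ => V) x a)) +
      ∑ x : Fin n → V, homEnt (fun a => F (Fin.snoc (α := fun _ => V) x a)) := by
  simp only [homEnt, ent, sum_snoc, Finset.sum_sub_distrib]
  ring

end Entropy

/-! ### The region of conditional entropies -/

/-- The convex hull of a compact set in a finite-dimensional space is compact. -/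
theorem isCompact_convexHull_of_finiteDimensional {E : Type*} [NormedAddCommGroup E]
    [NormedSpace ℝ E] [FiniteDimensional ℝ E] {s : Set E} (hs : IsCompact s) :
    IsCompact (convexHull ℝ s) := by
  classical
  rcases s.eq_empty_or_nonempty with rfl | ⟨e, he⟩
  · simp
  -- Carathéodory's theorem needs at most `d` points; shorter combinations are padded with weight
  -- zero at `e`. The hull is thus a continuous image of a compact set.
  set d := Module.finrank ℝ E + 1
  have hc : IsCompact ((fun z : (Fin d → ℝ) × (Fin d → E) => ∑ i, z.1 i • z.2 i) ''
      (stdSimplex ℝ (Fin d) ×ˢ Set.univ.pi fun _ => s)) := by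
    refine ((isCompact_stdSimplex ℝ (Fin d)).prod (isCompact_univ_pi fun _ => hs)).image ?_
    fun_prop
  convert hc
  ext x
  constructor
  · intro hx
    obtain ⟨ι, _, z, w, hz, hind, hw, hw1, hx⟩ := eq_pos_convex_span_of_mem_convexHull hx
    have hcard : Fintype.card ι ≤ d :=
      hind.card_le_finrank_succ.trans (Nat.succ_le_succ (Submodule.finrank_le _))
    obtain ⟨f⟩ : Nonempty (ι ↪ Fin d) := Function.Embedding.nonempty_of_card_le (by simpa using hcard)
    have hsum : ∀ (g : ι → E), ∑ i, Function.extend f w 0 i • Function.extend f g (fun _ => e) i =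
        ∑ i, w i • g i := by
      intro g
      symm
      refine Finset.sum_of_injOn f f.injective.injOn (by simp) (fun i _ hi => ?_) fun i _ => ?_
      · rw [Function.extend_apply' _ _ _ (by simpa using hi)]; simp
      · rw [f.injective.extend_apply, f.injective.extend_apply]
    have hsum' : ∑ i, Function.extend f w 0 i = ∑ i, w i := by
      symm
      refine Finset.sum_of_injOn f f.injective.injOn (by simp) (fun i _ hi => ?_) fun i _ => ?_
      · rw [Function.extend_apply' _ _ _ (by simpa using hi)]; simp
      · rw [f.injective.extend_apply]
    refine ⟨(Function.extend f w 0, Function.extend f z fun _ => e), ⟨⟨fun i => ?_, ?_⟩, ?_⟩, ?_⟩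
    · by_cases h : ∃ k, f k = i
      · obtain ⟨k, rfl⟩ := h
        simp only [f.injective.extend_apply]; exact (hw k).le
      · simp only [Function.extend_apply' _ _ _ h]; simp
    · rw [hsum', hw1]
    · intro i _
      by_cases h : ∃ k, f k = i
      · obtain ⟨k, rfl⟩ := h
        simp only [f.injective.extend_apply]; exact hz ⟨k, rfl⟩
      · simp only [Function.extend_apply' _ _ _ h]; exact he
    · simp only [hsum, hx]
  · rintro ⟨⟨w, z⟩, ⟨hw, hz⟩, rfl⟩
    exact mem_convexHull_of_exists_fintype w z hw.1 hw.2 (fun i => hz i (Set.mem_univ i)) rfl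

section Region

variable {X Y ι : Type*} [Fintype X] [Fintype Y]

/-- The output of the channel `V` for the input vector `w`. -/
def push {Y : Type*} (V : X → Y → ℝ) (w : X → ℝ) (y : Y) : ℝ := ∑ x, w x * V x y

/-- An input vector together with its entropy and its output entropies through channels `V i`. -/
noncomputable def entPoint (V : ι → X → Y → ℝ) (w : X → ℝ) : (X → ℝ) × ℝ × (ι → ℝ) :=
  (w, homEnt w, fun i => homEnt (push (V i) w))

/-- Convex hull of the points of all input laws. -/
noncomputable def entRegion (V : ι → X → Y → ℝ) : Set ((X → ℝ) × ℝ × (ι → ℝ)) :=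
  convexHull ℝ (entPoint V '' stdSimplex ℝ X)

variable {V : ι → X → Y → ℝ}

theorem push_smul {Y : Type*} (U : X → Y → ℝ) (t : ℝ) (w : X → ℝ) : push U (t • w) = t • push U w := by
  funext y
  simp [push, Finset.mul_sum, mul_assoc]

theorem entPoint_smul (t : ℝ) (w : X → ℝ) : entPoint V (t • w) = t • entPoint V w := by
  simp only [entPoint, push_smul, homEnt_smul, Prod.smul_mk, smul_eq_mul]
  rfl

theorem isCompact_entRegion [Fintype ι] : IsCompact (entRegion V) := by
  refine isCompact_convexHull_of_finiteDimensional ((isCompact_stdSimplex ℝ X).image ?_)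
  refine continuous_id.prodMk (continuous_homEnt.prodMk (continuous_pi fun i =>
    continuous_homEnt.comp (continuous_pi fun y => ?_)))
  unfold push
  fun_prop

/-- The cone over the region. -/
def entCone (V : ι → X → Y → ℝ) : Set ((X → ℝ) × ℝ × (ι → ℝ)) :=
  {z | ∃ t : ℝ, 0 ≤ t ∧ ∃ h ∈ entRegion V, z = t • h}

theorem sum_fst_of_mem_entRegion {z} (hz : z ∈ entRegion V) : z.1 ∈ stdSimplex ℝ X := by
  have : entRegion V ⊆ Prod.fst ⁻¹' stdSimplex ℝ X := by
    refine convexHull_min ?_ ((convex_stdSimplex ℝ X).is_linear_preimage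
      (LinearMap.fst ℝ (X → ℝ) (ℝ × (ι → ℝ))).isLinear)
    rintro _ ⟨w, hw, rfl⟩
    exact hw
  exact this hz

/-- The cone lets unnormalized pieces be summed freely; normalization is restored at the end by
`mem_entRegion_of_mem_entCone`. -/
theorem add_mem_entCone {z₁ z₂} (h₁ : z₁ ∈ entCone V) (h₂ : z₂ ∈ entCone V) :
    z₁ + z₂ ∈ entCone V := by
  obtain ⟨t₁, ht₁, h₁, hh₁, rfl⟩ := h₁
  obtain ⟨t₂, ht₂, h₂, hh₂, rfl⟩ := h₂
  rcases (add_nonneg ht₁ ht₂).eq_or_lt with h0 | h0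
  · have e1 : t₁ = 0 := by linarith
    have e2 : t₂ = 0 := by linarith
    exact ⟨0, le_rfl, h₁, hh₁, by simp [e1, e2]⟩
  refine ⟨t₁ + t₂, h0.le, (t₁ / (t₁ + t₂)) • h₁ + (t₂ / (t₁ + t₂)) • h₂,
    convex_convexHull ℝ _ hh₁ hh₂ (by positivity) (by positivity) (by field_simp), ?_⟩
  rw [smul_add, smul_smul, smul_smul, mul_div_cancel₀ _ h0.ne', mul_div_cancel₀ _ h0.ne']

theorem zero_mem_entCone [Nonempty X] : (0 : (X → ℝ) × ℝ × (ι → ℝ)) ∈ entCone V := by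
  classical
  obtain ⟨x⟩ := ‹Nonempty X›
  exact ⟨0, le_rfl, _, subset_convexHull ℝ _ ⟨_, single_mem_stdSimplex ℝ x, rfl⟩, by simp⟩

theorem sum_mem_entCone [Nonempty X] {K : Type*} (s : Finset K) {z : K → (X → ℝ) × ℝ × (ι → ℝ)}
    (h : ∀ i, z i ∈ entCone V) : ∑ i ∈ s, z i ∈ entCone V :=
  Finset.sum_induction z (· ∈ entCone V) (fun _ _ => add_mem_entCone) zero_mem_entCone fun i _ => h i

theorem entPoint_mem_entCone [Nonempty X] {w : X → ℝ} (hw : ∀ x, 0 ≤ w x) :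
    entPoint V w ∈ entCone V := by
  have hS : 0 ≤ ∑ x, w x := Finset.sum_nonneg fun x _ => hw x
  rcases hS.eq_or_lt with h0 | h0
  · have : w = 0 := funext fun x =>
      (Finset.sum_eq_zero_iff_of_nonneg fun x _ => hw x).1 h0.symm x (Finset.mem_univ x)
    have e := entPoint_smul (V := V) 0 (0 : X → ℝ)
    rw [zero_smul, zero_smul] at e
    rw [this, e]
    exact zero_mem_entCone
  refine ⟨∑ x, w x, hS, entPoint V ((∑ x, w x)⁻¹ • w), subset_convexHull ℝ _ ⟨_, ⟨fun x => ?_, ?_⟩, rfl⟩, ?_⟩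
  · exact mul_nonneg (inv_nonneg.2 hS) (hw x)
  · simp [← Finset.mul_sum, h0.ne']
  · rw [entPoint_smul, smul_smul, mul_inv_cancel₀ h0.ne', one_smul]

theorem mem_entRegion_of_mem_entCone {z} (hz : z ∈ entCone V) (h1 : ∑ x, z.1 x = 1) :
    z ∈ entRegion V := by
  obtain ⟨t, ht, h, hh, rfl⟩ := hz
  have := (sum_fst_of_mem_entRegion hh).2
  simp only [Prod.smul_fst, Pi.smul_apply, smul_eq_mul, ← Finset.mul_sum, this, mul_one] at h1
  rwa [h1, one_smul]

theorem smul_mem_entCone {z} (hz : z ∈ entCone V) {t : ℝ} (ht : 0 ≤ t) : t • z ∈ entCone V := by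
  obtain ⟨t', ht', h, hh, rfl⟩ := hz
  exact ⟨t * t', mul_nonneg ht ht', h, hh, smul_smul _ _ _⟩

/-! ### Single-letterization -/

/-- The output of `n` uses of the channel. -/
def pushN {n : ℕ} (U : X → Y → ℝ) (F : (Fin n → X) → ℝ) (y : Fin n → Y) : ℝ :=
  ∑ x, F x * ∏ l, U (x l) (y l)

open Classical in
/-- The expected number of occurrences of each letter. -/
noncomputable def letterCount {n : ℕ} (F : (Fin n → X) → ℝ) (a : X) : ℝ :=
  ∑ x, F x * ∑ l, if x l = a then 1 else 0

/-- In probabilistic terms `H(Y_{n+1} | Y^n) ≥ H(Y_{n+1} | Y^n, X^n) = H(Y_{n+1} | X^n)`, the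
channel being memoryless. -/
theorem homEnt_pushN_succ_ge {n : ℕ} {U : X → Y → ℝ} (hU : ∀ x, U x ∈ stdSimplex ℝ Y)
    {F : (Fin (n + 1) → X) → ℝ} (hF : ∀ x, 0 ≤ F x) :
    homEnt (pushN U fun x : Fin n → X => ∑ a, F (Fin.snoc (α := fun _ => X) x a)) +
      ∑ x : Fin n → X, homEnt (push U fun a => F (Fin.snoc (α := fun _ => X) x a)) ≤
      homEnt (pushN U F) := by
  have hprod : ∀ (x : Fin n → X) (y : Fin n → Y), 0 ≤ ∏ l, U (x l) (y l) := fun x y =>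
    Finset.prod_nonneg fun l _ => (hU _).1 _
  have hone : ∀ x : Fin n → X, ∑ y : Fin n → Y, ∏ l, U (x l) (y l) = 1 := by
    intro x
    rw [← Fintype.prod_sum]
    exact Finset.prod_eq_one fun l _ => (hU _).2
  have hsnoc : ∀ (y : Fin n → Y) (b : Y), pushN U F (Fin.snoc (α := fun _ => Y) y b) =
      ∑ x : Fin n → X, (∏ l, U (x l) (y l)) *
        push U (fun a => F (Fin.snoc (α := fun _ => X) x a)) b := by
    intro y b
    simp only [pushN, sum_snoc, Fin.prod_univ_castSucc, Fin.snoc_castSucc, Fin.snoc_last, push,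
      Finset.mul_sum]
    refine Finset.sum_congr rfl fun x _ => Finset.sum_congr rfl fun a _ => by ring
  have hpush : ∀ w : X → ℝ, ∑ b, push U w b = ∑ a, w a := by
    intro w
    simp only [push]
    rw [Finset.sum_comm]
    simp only [← Finset.mul_sum, (hU _).2, mul_one]
  rw [homEnt_snoc (pushN U F)]
  refine add_le_add (le_of_eq ?_) ?_
  · congr 1
    funext y
    simp only [hsnoc]
    rw [Finset.sum_comm]
    simp only [← Finset.mul_sum, hpush, pushN]
    exact Finset.sum_congr rfl fun x _ => mul_comm _ _
  -- Given `x`, the prefix `y` enters only through a scalar factor. Homogeneity inserts it, and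
  -- superadditivity over `x` then gives the bound.
  · calc _ = ∑ y : Fin n → Y, ∑ x : Fin n → X, homEnt ((∏ l, U (x l) (y l)) •
          push U fun a => F (Fin.snoc (α := fun _ => X) x a)) := by
          rw [Finset.sum_comm]
          simp only [homEnt_smul, ← Finset.sum_mul, hone, one_mul]
      _ ≤ _ := by
        refine Finset.sum_le_sum fun y _ => ?_
        refine (sum_homEnt_le _ fun x b => ?_).trans (le_of_eq ?_)
        · exact mul_nonneg (hprod x y) (Finset.sum_nonneg fun a _ => mul_nonneg (hF _) ((hU _).1 _))
        · congr 1
          funext b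
          rw [hsnoc]
          rfl

theorem letterCount_succ {n : ℕ} (F : (Fin (n + 1) → X) → ℝ) :
    letterCount F = letterCount (fun x : Fin n → X => ∑ a, F (Fin.snoc (α := fun _ => X) x a)) +
      ∑ x : Fin n → X, fun a => F (Fin.snoc (α := fun _ => X) x a) := by
  classical
  funext a
  simp only [letterCount, sum_snoc, Fin.sum_univ_castSucc, Fin.snoc_castSucc, Fin.snoc_last,
    mul_add, Finset.sum_add_distrib, Pi.add_apply, Finset.sum_apply, Finset.sum_mul]
  congr 1
  refine Finset.sum_congr rfl fun x _ => ?_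
  simp

/-- Chain rule: the entropy of a block and, up to inequality, its output entropies are
sums of single-letter ones. -/
theorem exists_mem_entCone_block [Nonempty X] (hV : ∀ i x, V i x ∈ stdSimplex ℝ Y) {n : ℕ}
    (F : (Fin n → X) → ℝ) (hF : ∀ x, 0 ≤ F x) :
    ∃ b : ι → ℝ, (letterCount F, homEnt F, b) ∈ entCone V ∧
      ∀ i, b i ≤ homEnt (pushN (V i) F) := by
  induction n with
  | zero =>
    refine ⟨0, ?_, fun i => le_of_eq ?_⟩
    · have e : (letterCount F, homEnt F, (0 : ι → ℝ)) = 0 := by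
        refine Prod.ext (funext fun a => ?_) (Prod.ext ?_ rfl)
        · simp [letterCount]
        · simp [homEnt, ent]
      rw [e]
      exact zero_mem_entCone
    · simp [homEnt, ent]
  | succ n ih =>
    obtain ⟨b, hb, hle⟩ := ih (fun x => ∑ a, F (Fin.snoc (α := fun _ => X) x a))
      (fun x => Finset.sum_nonneg fun a _ => hF _)
    refine ⟨b + fun i => ∑ x : Fin n → X, homEnt (push (V i) fun a =>
      F (Fin.snoc (α := fun _ => X) x a)), ?_, fun i => ?_⟩
    · have h2 := add_mem_entCone hb (sum_mem_entCone Finset.univ fun x : Fin n → X =>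
        entPoint_mem_entCone (V := V) (w := fun a => F (Fin.snoc (α := fun _ => X) x a))
          fun a => hF _)
      rw [letterCount_succ, homEnt_snoc]
      refine (congrArg (· ∈ entCone V) (Prod.ext ?_ (Prod.ext ?_ (funext fun i => ?_)))).mpr h2
      · simp [Prod.fst_sum, entPoint]
      · simp [Prod.fst_sum, Prod.snd_sum, entPoint]
      · simp [Prod.snd_sum, entPoint]
    · exact (add_le_add (hle i) le_rfl).trans (homEnt_pushN_succ_ge (hV i) hF)

end Region

/-! ### Finite-blocklength characterization of achievability -/

section Achievable

variable {Y X : Type*} [Fintype Y] [Fintype X] {κ : DecisionKind}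

theorem DecisionKind.zero_mem (κ : DecisionKind) : (0 : ℝ) ∈ κ.values := by
  cases κ <;> simp [DecisionKind.values]

theorem DecisionKind.one_mem (κ : DecisionKind) : (1 : ℝ) ∈ κ.values := by
  cases κ <;> simp [DecisionKind.values]

theorem DecisionKind.values_subset (κ : DecisionKind) : κ.values ⊆ Set.Icc 0 1 := by
  cases κ
  · rintro x (rfl | rfl) <;> simp
  · exact subset_rfl

/-- The scheme `T` has type I error at most `η`, exponent at least `E - η` and rate at most
`R + η`. -/
def Scheme.Good {n : ℕ} (T : Scheme κ Y X n) (H₀ H₁ : Set (JointLaw Y X n)) (R E η : ℝ) : Prop :=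
  (∀ p ∈ H₀, T.typeI p ≤ η) ∧ (∀ q ∈ H₁, T.typeII q ≤ exp (-(n * (E - η)))) ∧
    log (T.M : ℝ) ≤ n * (R + η)

theorem Scheme.Good.mono {n : ℕ} {T : Scheme κ Y X n} {H₀ H₁ : Set (JointLaw Y X n)}
    {R E η η' : ℝ} (h : T.Good H₀ H₁ R E η) (hη : η ≤ η') : T.Good H₀ H₁ R E η' := by
  refine ⟨fun p hp => (h.1 p hp).trans hη, fun q hq => (h.2.1 q hq).trans ?_, h.2.2.trans ?_⟩
  · gcongr
  · gcongr

theorem eventually_good_of_achievable {H₀ H₁ : (n : ℕ) → Set (JointLaw Y X n)} {R E : ℝ}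
    (h : Achievable κ H₀ H₁ 0 R E) {η : ℝ} (hη : 0 < η) :
    ∀ᶠ n in atTop, ∃ T : Scheme κ Y X n, T.Good (H₀ n) (H₁ n) R E η := by
  obtain ⟨T, hα, hβ, hM⟩ := h
  have h1 : ∀ᶠ n in atTop, (T n).alpha (H₀ n) < ENNReal.ofReal η :=
    eventually_lt_of_limsup_lt (hα.trans_lt (by simpa using hη))
  have h2 : ∀ᶠ n : ℕ in atTop, ((E - η : ℝ) : EReal) <
      ENNReal.log (1 / (T n).beta (H₁ n)) / (n : EReal) :=
    eventually_lt_of_lt_liminf (lt_of_lt_of_le (EReal.coe_lt_coe_iff.2 (by linarith)) hβ)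
  have h3 : ∀ᶠ n : ℕ in atTop, ((log ((T n).M : ℝ) / (n : ℝ) : ℝ) : EReal) < ((R + η : ℝ) : EReal) :=
    eventually_lt_of_limsup_lt (hM.trans_lt (EReal.coe_lt_coe_iff.2 (by linarith)))
  filter_upwards [h1, h2, h3, eventually_gt_atTop 0] with n h1 h2 h3 hn
  have hn0 : (0 : ℝ) < n := by exact_mod_cast hn
  refine ⟨T n, fun p hp => ?_, fun q hq => ?_, ?_⟩
  · have : ENNReal.ofReal ((T n).typeI p) < ENNReal.ofReal η :=
      (le_iSup₂ (f := fun p (_ : p ∈ H₀ n) => ENNReal.ofReal ((T n).typeI p)) p hp).trans_lt h1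
    exact ((ENNReal.ofReal_lt_ofReal_iff hη).1 this).le
  · rw [EReal.lt_div_iff (by exact_mod_cast hn0) (EReal.natCast_ne_top n)] at h2
    have h4 : ENNReal.log (ENNReal.ofReal (exp (n * (E - η)))) <
        ENNReal.log (1 / (T n).beta (H₁ n)) := by
      rw [ENNReal.log_ofReal_of_pos (exp_pos _), log_exp]
      refine lt_of_eq_of_lt ?_ h2
      rw [mul_comm, EReal.coe_mul]
      rfl
    have h5 := ENNReal.log_lt_log_iff.1 h4
    rw [one_div, ENNReal.lt_inv_iff_lt_inv, ← ENNReal.ofReal_inv_of_pos (exp_pos _), ← exp_neg] at h5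
    have h6 : ENNReal.ofReal ((T n).typeII q) < _ :=
      (le_iSup₂ (f := fun p (_ : p ∈ H₁ n) => ENNReal.ofReal ((T n).typeII p)) q hq).trans_lt h5
    exact ((ENNReal.ofReal_lt_ofReal_iff (exp_pos _)).1 h6).le
  · have := EReal.coe_lt_coe_iff.1 h3
    rw [div_lt_iff₀ hn0] at this
    linarith

theorem achievable_of_forall_good {H₀ H₁ : (n : ℕ) → Set (JointLaw Y X n)} {R E : ℝ}
    (T : (n : ℕ) → Scheme κ Y X n)
    (h : ∀ η, 0 < η → ∀ᶠ n in atTop, (T n).Good (H₀ n) (H₁ n) R E η) :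
    Achievable κ H₀ H₁ 0 R E := by
  refine ⟨T, ?_, ?_, ?_⟩
  · have : ∀ η : ℝ, 0 < η → limsup (fun n => (T n).alpha (H₀ n)) atTop ≤ ENNReal.ofReal η := by
      intro η hη
      refine limsup_le_of_le (h := ?_)
      filter_upwards [h η hη] with n hn
      exact iSup₂_le fun p hp => ENNReal.ofReal_le_ofReal (hn.1 p hp)
    refine ENNReal.le_of_forall_pos_le_add fun ε hε _ => ?_
    simpa using this ε hε
  · refine EReal.ge_of_forall_gt_iff_ge.1 fun z hz => ?_
    have hz' := EReal.coe_lt_coe_iff.1 hz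
    refine le_liminf_of_le (h := ?_)
    filter_upwards [h (E - z) (by linarith), eventually_gt_atTop 0] with n hn hn0
    have hn0' : (0 : ℝ) < n := by exact_mod_cast hn0
    rw [EReal.le_div_iff_mul_le (by exact_mod_cast hn0') (EReal.natCast_ne_top n)]
    have h4 : ENNReal.log (ENNReal.ofReal (exp (n * z))) ≤
        ENNReal.log (1 / (T n).beta (H₁ n)) := by
      refine ENNReal.log_le_log_iff.2 ?_
      rw [one_div, ENNReal.le_inv_iff_le_inv, ← ENNReal.ofReal_inv_of_pos (exp_pos _), ← exp_neg]
      refine iSup₂_le fun q hq => ENNReal.ofReal_le_ofReal ?_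
      simpa using hn.2.1 q hq
    rw [ENNReal.log_ofReal_of_pos (exp_pos _), log_exp] at h4
    refine le_of_eq_of_le ?_ h4
    rw [mul_comm (n : ℝ), EReal.coe_mul]
    rfl
  · refine EReal.le_of_forall_lt_iff_le.1 fun z hz => ?_
    have hz' := EReal.coe_lt_coe_iff.1 hz
    refine limsup_le_of_le (h := ?_)
    filter_upwards [h (z - R) (by linarith), eventually_gt_atTop 0] with n hn hn0
    have hn0' : (0 : ℝ) < n := by exact_mod_cast hn0
    rw [EReal.coe_le_coe_iff, div_le_iff₀ hn0']
    have := hn.2.2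
    rw [add_sub_cancel] at this
    linarith

/-- Removes all limits and suprema from the definition. The reverse direction is a diagonal choice:
at blocklength `n`, a scheme with tolerance `1 / (k + 1)` for the largest possible `k ≤ n`, or an
arbitrary scheme if there is none. -/
theorem achievable_iff {H₀ H₁ : (n : ℕ) → Set (JointLaw Y X n)} {R E : ℝ} :
    Achievable κ H₀ H₁ 0 R E ↔ ∀ η, 0 < η →
      ∀ᶠ n in atTop, ∃ T : Scheme κ Y X n, T.Good (H₀ n) (H₁ n) R E η := by
  classical
  refine ⟨fun h η hη => eventually_good_of_achievable h hη, fun h => ?_⟩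
  set Q : ℕ → ℕ → Prop := fun n k => ∃ T : Scheme κ Y X n, T.Good (H₀ n) (H₁ n) R E (1 / (k + 1))
  have hQ : ∀ k, ∀ᶠ n in atTop, Q n k := fun k => h _ (by positivity)
  have hT : ∀ n, ∃ T : Scheme κ Y X n, (∃ k ≤ n, Q n k) →
      T.Good (H₀ n) (H₁ n) R E (1 / ((Nat.findGreatest (Q n) n : ℕ) + 1)) := by
    intro n
    by_cases hk : ∃ k ≤ n, Q n k
    · obtain ⟨k, hk, hq⟩ := hk
      obtain ⟨T, hT⟩ := Nat.findGreatest_spec hk hq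
      exact ⟨T, fun _ => hT⟩
    · exact ⟨⟨1, fun _ => 0, fun _ _ => 0, fun _ _ => κ.zero_mem⟩, fun h => absurd h hk⟩
  choose T hT using hT
  refine achievable_of_forall_good T fun η hη => ?_
  obtain ⟨k, hk⟩ := exists_nat_one_div_lt hη
  filter_upwards [hQ k, eventually_ge_atTop k] with n hn hkn
  refine (hT n ⟨k, hkn, hn⟩).mono (le_trans ?_ hk.le)
  have : k ≤ Nat.findGreatest (Q n) n := Nat.le_findGreatest hkn hn
  gcongr

theorem Scheme.typeI_eq {n : ℕ} (T : Scheme κ Y X n) (p : JointLaw Y X n) :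
    T.typeI p = ∑ y, ∑ x, p (y, x) * (1 - T.dec y (T.enc x)) := by
  refine Finset.sum_congr rfl fun y _ => ?_
  simp only [Scheme.compress, Finset.sum_mul]
  rw [Finset.sum_comm]
  refine Finset.sum_congr rfl fun x _ => ?_
  simp only [ite_mul, zero_mul, Finset.sum_ite_eq, Finset.mem_univ, if_true]

theorem Scheme.typeII_eq {n : ℕ} (T : Scheme κ Y X n) (q : JointLaw Y X n) :
    T.typeII q = ∑ y, ∑ x, q (y, x) * T.dec y (T.enc x) := by
  refine Finset.sum_congr rfl fun y _ => ?_
  simp only [Scheme.compress, Finset.sum_mul]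
  rw [Finset.sum_comm]
  refine Finset.sum_congr rfl fun x _ => ?_
  simp only [ite_mul, zero_mul, Finset.sum_ite_eq, Finset.mem_univ, if_true]

theorem Scheme.typeI_nonneg {n : ℕ} (T : Scheme κ Y X n) {p : JointLaw Y X n} (hp : ∀ z, 0 ≤ p z) :
    0 ≤ T.typeI p := by
  rw [T.typeI_eq]
  exact Finset.sum_nonneg fun y _ => Finset.sum_nonneg fun x _ =>
    mul_nonneg (hp _) (sub_nonneg.2 (κ.values_subset (T.dec_mem _ _)).2)

theorem Scheme.typeII_nonneg {n : ℕ} (T : Scheme κ Y X n) {p : JointLaw Y X n}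
    (hp : ∀ z, 0 ≤ p z) : 0 ≤ T.typeII p := by
  rw [T.typeII_eq]
  exact Finset.sum_nonneg fun y _ => Finset.sum_nonneg fun x _ =>
    mul_nonneg (hp _) (κ.values_subset (T.dec_mem _ _)).1

theorem Scheme.typeI_sum {n : ℕ} (T : Scheme κ Y X n) {ι : Type*} [Fintype ι] (ν : ι → ℝ)
    (p : ι → JointLaw Y X n) :
    T.typeI (fun z => ∑ i, ν i * p i z) = ∑ i, ν i * T.typeI (p i) := by
  simp only [T.typeI_eq, Finset.sum_mul, Finset.mul_sum, mul_assoc]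
  symm
  rw [Finset.sum_comm]
  exact Finset.sum_congr rfl fun y _ => Finset.sum_comm

theorem Scheme.typeII_sum {n : ℕ} (T : Scheme κ Y X n) {ι : Type*} [Fintype ι] (ν : ι → ℝ)
    (p : ι → JointLaw Y X n) :
    T.typeII (fun z => ∑ i, ν i * p i z) = ∑ i, ν i * T.typeII (p i) := by
  simp only [T.typeII_eq, Finset.sum_mul, Finset.mul_sum, mul_assoc]
  symm
  rw [Finset.sum_comm]
  exact Finset.sum_congr rfl fun y _ => Finset.sum_comm

end Achievable

/-! ### Equivalence of the mixture problem and the compound problem -/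

section Mixture

variable {Y X : Type*} [Fintype Y] [Fintype X] {κ : DecisionKind} {m k r : ℕ} {c : Category}
  {P : Fin m → Y × X → ℝ} {QY : Fin k → SourceLaw Y} {QX : Fin r → SourceLaw X}

/-- The same schemes serve both problems: the errors are linear and nonnegative, so a well-chosen
mixture controls each component, while all components control every mixture. -/
theorem achievable_mix_iff (hm : 0 < m) (hP : ∀ i z, 0 ≤ P i z) (hQY : ∀ j n y, 0 ≤ QY j n y)
    (hQX : ∀ t n x, 0 ≤ QX t n x) {γp γq : ℝ} (hγp : 0 < γp) (hγpm : (m : ℝ) * γp ≤ 1)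
    (hγq1 : γq < 1) {Γq : ℕ → ℝ} (hΓq : ∀ n, 1 ≤ Γq n)
    (hΓq_lim : Tendsto (fun n : ℕ => log (Γq n) / (n : ℝ)) atTop (𝓝 0)) {R E : ℝ} :
    Achievable κ (mixNull P γp) (mixAlt c P QY QX γq Γq) 0 R E ↔
      Achievable κ (compNull P) (compAlt QY QX) 0 R E := by
  have hm0 : (0 : ℝ) < m := by exact_mod_cast hm
  have hm1 : (1 : ℝ) ≤ m := by exact_mod_cast hm
  have hpair : ∀ i n (z : (Fin n → Y) × (Fin n → X)), 0 ≤ pairLaw (P i) n z := fun i n z =>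
    prodLaw_nonneg (hP i) _
  have hind : ∀ j t n (z : (Fin n → Y) × (Fin n → X)), 0 ≤ indepLaw (QY j) (QX t) n z :=
    fun j t n z => mul_nonneg (hQY j n _) (hQX t n _)
  have hII : ∀ {n} (T : Scheme κ Y X n) (τ : Fin k → Fin r → ℝ),
      T.typeII (fun z => ∑ j, ∑ t, τ j t * indepLaw (QY j) (QX t) n z) =
        ∑ z : Fin k × Fin r, τ z.1 z.2 * T.typeII (indepLaw (QY z.1) (QX z.2) n) := by
    intro n T τ
    rw [← T.typeII_sum (fun z : Fin k × Fin r => τ z.1 z.2)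
      fun z => indepLaw (QY z.1) (QX z.2) n]
    simp only [Fintype.sum_prod_type]
  rw [achievable_iff, achievable_iff]
  constructor
  · intro h η hη
    -- Under uniform weights each component's type I error is at most `m` times that of the mixture.
    -- The loss is harmless only because the target level is zero.
    filter_upwards [h (η / m) (by positivity)] with n ⟨T, hT⟩
    have hle : η / m ≤ η := div_le_self hη.le hm1
    refine ⟨T, ?_, ?_, (hT.mono hle).2.2⟩
    · rintro _ ⟨i, rfl⟩
      have h1 := hT.1 (fun z => ∑ i, (1 / m : ℝ) * pairLaw (P i) n z)
        ⟨fun _ => 1 / m, ⟨by simp [hm0.ne'], fun i => by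
          rw [le_div_iff₀ hm0]; linarith⟩, rfl⟩
      rw [T.typeI_sum (fun _ => (1 / m : ℝ)), ← Finset.mul_sum, one_div, div_eq_inv_mul] at h1
      have h2 := le_of_mul_le_mul_left h1 (by positivity)
      exact (Finset.single_le_sum (f := fun i => T.typeI (pairLaw (P i) n))
        (fun i _ => T.typeI_nonneg (hpair i n)) (Finset.mem_univ i)).trans h2
    · rintro _ ⟨j, t, rfl⟩
      have h1 := (hT.mono hle).2.1 (fun z => ∑ j, ∑ t, (1 : ℝ) * indepLaw (QY j) (QX t) n z)
        ⟨fun _ _ => 1, ⟨fun _ _ => ⟨zero_le_one, hΓq n⟩, fun _ _ _ _ _ => hγq1.le⟩, rfl⟩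
      rw [hII T fun _ _ => 1] at h1
      simp only [one_mul] at h1
      exact (Finset.single_le_sum
        (f := fun z : Fin k × Fin r => T.typeII (indepLaw (QY z.1) (QX z.2) n))
        (fun z _ => T.typeII_nonneg (hind z.1 z.2 n)) (Finset.mem_univ (j, t))).trans h1
  · intro h η hη
    have e1 : ∀ᶠ n : ℕ in atTop, log (Γq n) / n < η / 4 :=
      (tendsto_order.1 hΓq_lim).2 _ (by positivity)
    have e2 : ∀ᶠ n : ℕ in atTop, (k * r : ℝ) < exp (n * (η / 4)) :=
      (tendsto_exp_atTop.comp (tendsto_natCast_atTop_atTop.atTop_mul_const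
        (by positivity : (0 : ℝ) < η / 4))).eventually_gt_atTop _
    filter_upwards [h (η / 2) (by positivity), e1, e2, eventually_gt_atTop 0] with n ⟨T, hT⟩ e1 e2 hn
    have hn0 : (0 : ℝ) < n := by exact_mod_cast hn
    have hle : η / 2 ≤ η := by linarith
    refine ⟨T, ?_, ?_, (hT.mono hle).2.2⟩
    · rintro _ ⟨ν, ⟨hν1, hν⟩, rfl⟩
      rw [T.typeI_sum]
      calc _ ≤ ∑ i, ν i * η := Finset.sum_le_sum fun i _ =>
            mul_le_mul_of_nonneg_left ((hT.mono hle).1 _ ⟨i, rfl⟩) (hγp.le.trans (hν i))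
        _ = η := by rw [← Finset.sum_mul, hν1, one_mul]
    · rintro _ ⟨τ, ⟨hτ, -⟩, rfl⟩
      rw [hII]
      have hΓ : Γq n ≤ exp (n * (η / 4)) := by
        rw [← log_le_iff_le_exp (by linarith [hΓq n])]
        rw [div_lt_iff₀ hn0] at e1
        linarith
      calc _ ≤ ∑ z : Fin k × Fin r, exp (n * (η / 4)) * exp (-(n * (E - η / 2))) :=
            Finset.sum_le_sum fun z _ => mul_le_mul ((hτ _ _).2.trans hΓ)
              (hT.2.1 _ ⟨z.1, z.2, rfl⟩) (T.typeII_nonneg (hind _ _ n)) (exp_pos _).le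
        _ = (k * r) * (exp (n * (η / 4)) * exp (-(n * (E - η / 2)))) := by simp
        _ ≤ exp (n * (η / 4)) * (exp (n * (η / 4)) * exp (-(n * (E - η / 2)))) := by gcongr
        _ = _ := by rw [← exp_add, ← exp_add]; congr 1; ring

end Mixture

/-! ### Kernels and points of the entropy region -/

section Kernel

variable {X Y ι : Type*} [Fintype X] [Fintype Y]

theorem fstMarg_mem {p : Y × X → ℝ} (hp : p ∈ stdSimplex ℝ (Y × X)) :
    fstMarg p ∈ stdSimplex ℝ Y :=
  ⟨fun _ => Finset.sum_nonneg fun _ _ => hp.1 _, by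
    rw [← hp.2, Fintype.sum_prod_type]; rfl⟩

theorem sndMarg_mem {p : Y × X → ℝ} (hp : p ∈ stdSimplex ℝ (Y × X)) :
    sndMarg p ∈ stdSimplex ℝ X :=
  ⟨fun _ => Finset.sum_nonneg fun _ _ => hp.1 _, by
    rw [← hp.2, Fintype.sum_prod_type_right]; rfl⟩

/-- Disintegration along the second coordinate. -/
theorem exists_channel {p : Y × X → ℝ} (hp : p ∈ stdSimplex ℝ (Y × X)) :
    ∃ V : X → Y → ℝ, (∀ x, V x ∈ stdSimplex ℝ Y) ∧ ∀ y x, p (y, x) = sndMarg p x * V x y := by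
  classical
  -- On letters of probability zero any law on `Y` will do; `fstMarg p` is one at hand.
  refine ⟨fun x => if sndMarg p x = 0 then fstMarg p else fun y => p (y, x) / sndMarg p x,
    fun x => ?_, fun y x => ?_⟩
  · dsimp only
    split_ifs with h
    · exact fstMarg_mem hp
    · refine ⟨fun y => div_nonneg (hp.1 _) ((sndMarg_mem hp).1 x), ?_⟩
      rw [← Finset.sum_div]
      exact div_self h
  · by_cases h : sndMarg p x = 0
    · rw [h, zero_mul]
      exact (Finset.sum_eq_zero_iff_of_nonneg fun y _ => hp.1 _).1 h y (Finset.mem_univ y)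
    · simp only [if_neg h]
      field_simp

theorem fstMarg_eq_push {Y : Type*} {p : Y × X → ℝ} {s : X → ℝ} {V : X → Y → ℝ}
    (hV : ∀ y x, p (y, x) = s x * V x y) : fstMarg p = push V s :=
  funext fun y => Finset.sum_congr rfl fun x _ => hV y x

theorem mutualInfo_inputLaw {u : ℕ} {s : X → ℝ} (hs : ∀ x, 0 ≤ s x) {W : X → Fin u → ℝ}
    (hW : ∀ x, W x ∈ stdSimplex ℝ (Fin u)) :
    mutualInfo (inputLaw s W) = ent s - ∑ k, homEnt (fun x => s x * W x k) := by
  rw [mutualInfo_eq (p := inputLaw s W) fun z => mul_nonneg (hs _) ((hW _).1 _)]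
  have : fstMarg (inputLaw s W) = s := by
    funext x
    simp only [fstMarg, inputLaw, ← Finset.mul_sum, (hW x).2, mul_one]
  rw [this]
  rfl

theorem mutualInfo_outputLaw {u : ℕ} {p : Y × X → ℝ} (hp : ∀ z, 0 ≤ p z) {s : X → ℝ}
    {V : X → Y → ℝ} (hV : ∀ y x, p (y, x) = s x * V x y) {W : X → Fin u → ℝ}
    (hW : ∀ x, W x ∈ stdSimplex ℝ (Fin u)) :
    mutualInfo (outputLaw p W) =
      ent (push V s) - ∑ k, homEnt (push V fun x => s x * W x k) := by
  rw [mutualInfo_eq (p := outputLaw p W) fun z => Finset.sum_nonneg fun x _ => mul_nonneg (hp _) ((hW _).1 _)]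
  have : fstMarg (outputLaw p W) = fstMarg p := by
    funext y
    simp only [fstMarg, outputLaw]
    rw [Finset.sum_comm]
    simp only [← Finset.mul_sum, (hW _).2, mul_one]
  rw [this, fstMarg_eq_push hV]
  congr 1
  refine Finset.sum_congr rfl fun k _ => congrArg homEnt (funext fun y => ?_)
  simp only [outputLaw, push, hV]
  exact Finset.sum_congr rfl fun x _ => by ring

/-- Points of the region over `s` are the entropies of kernels. -/
theorem exists_point_of_kernel [Nonempty X] {V : ι → X → Y → ℝ} {s : X → ℝ}
    (hs : s ∈ stdSimplex ℝ X) {u : ℕ} {W : X → Fin u → ℝ} (hW : ∀ x, W x ∈ stdSimplex ℝ (Fin u)) :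
    ∃ z ∈ entRegion V, z.1 = s ∧ mutualInfo (inputLaw s W) = ent s - z.2.1 ∧
      ∀ i (p : Y × X → ℝ), (∀ z, 0 ≤ p z) → (∀ y x, p (y, x) = s x * V i x y) →
        mutualInfo (outputLaw p W) = ent (push (V i) s) - z.2.2 i := by
  -- The coordinates of `z` are `s`, `H(X|U)` and the `H(Y_i|U)`.
  set z := ∑ k, entPoint V fun x => s x * W x k with hz
  have h1 : z.1 = s := by
    funext x
    simp only [hz, Prod.fst_sum, entPoint, Finset.sum_apply, ← Finset.mul_sum, (hW x).2, mul_one]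
  refine ⟨z, mem_entRegion_of_mem_entCone (sum_mem_entCone _ fun k =>
    entPoint_mem_entCone fun x => mul_nonneg (hs.1 x) ((hW x).1 k)) (by rw [h1, hs.2]), h1, ?_, ?_⟩
  · rw [mutualInfo_inputLaw hs.1 hW]
    simp only [hz, Prod.fst_sum, Prod.snd_sum, entPoint]
  · intro i p hp hpV
    rw [mutualInfo_outputLaw hp hpV hW]
    simp only [hz, Prod.snd_sum, entPoint, Finset.sum_apply]

theorem exists_kernel_of_point {V : ι → X → Y → ℝ} {s : X → ℝ} {z : (X → ℝ) × ℝ × (ι → ℝ)}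
    (hz : z ∈ entRegion V) (hzs : z.1 = s) :
    ∃ (u : ℕ) (W : X → Fin u → ℝ), (∀ x, W x ∈ stdSimplex ℝ (Fin u)) ∧
      mutualInfo (inputLaw s W) = ent s - z.2.1 ∧
      ∀ i (p : Y × X → ℝ), (∀ z, 0 ≤ p z) → (∀ y x, p (y, x) = s x * V i x y) →
        mutualInfo (outputLaw p W) = ent (push (V i) s) - z.2.2 i := by
  classical
  have hs : s ∈ stdSimplex ℝ X := hzs ▸ sum_fst_of_mem_entRegion hz
  obtain ⟨K, _, c', f', hc0', hc1', hf', hsum'⟩ := mem_convexHull_iff_exists_fintype.1 hz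
  set e := (Fintype.equivFin K).symm
  set c := c' ∘ e with hc
  have hc0 : ∀ k, 0 ≤ c k := fun k => hc0' _
  have hc1 : ∑ k, c k = 1 := by rw [← hc1', ← e.sum_comp]; rfl
  choose v' hv' hve' using hf'
  set v := v' ∘ e with hv
  have hsum : ∑ k, c k • entPoint V (v k) = z := by
    rw [← hsum', ← e.sum_comp]
    simp only [hc, hv, Function.comp_apply, hve']
  have hvs : ∀ k, v k ∈ stdSimplex ℝ X := fun k => hv' _
  have hsx : ∀ x, ∑ k, c k * v k x = s x := by
    intro x
    rw [← hzs, ← hsum]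
    simp [Prod.fst_sum, entPoint]
  have hcv : ∀ x k, 0 ≤ c k * v k x := fun x k => mul_nonneg (hc0 k) ((hvs k).1 x)
  -- Bayes' rule: `U = k` has probability `c k`, and `X` given `U = k` has law `v k`.
  set W : X → Fin (Fintype.card K) → ℝ := fun x k => if s x = 0 then c k else c k * v k x / s x
    with hWdef
  have hW : ∀ x, W x ∈ stdSimplex ℝ (Fin (Fintype.card K)) := by
    intro x
    by_cases h : s x = 0
    · simp only [hWdef, h, if_true]; exact ⟨hc0, hc1⟩
    · simp only [hWdef, h, if_false]
      refine ⟨fun k => div_nonneg (hcv x k) (hs.1 x), ?_⟩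
      rw [← Finset.sum_div, hsx, div_self h]
  have hsW : ∀ k, (fun x => s x * W x k) = c k • v k := by
    intro k
    funext x
    by_cases h : s x = 0
    · have := (Finset.sum_eq_zero_iff_of_nonneg fun k _ => hcv x k).1 ((hsx x).trans h) k
        (Finset.mem_univ k)
      simp [h, this]
    · simp only [hWdef, h, if_false, Pi.smul_apply, smul_eq_mul]
      field_simp
  refine ⟨_, W, hW, ?_, fun i p hp hpV => ?_⟩
  · rw [mutualInfo_inputLaw hs.1 hW, ← hsum]
    simp [hsW, homEnt_smul, Prod.fst_sum, Prod.snd_sum, entPoint]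
  · rw [mutualInfo_outputLaw hp hpV hW, ← hsum]
    simp [hsW, push_smul, homEnt_smul, Prod.snd_sum, entPoint]

end Kernel

/-! ### The minimal divergence and the single-letter maximum -/

section Theta

variable {Y X : Type*} [Fintype Y] [Fintype X] {m k r : ℕ} {c : Category}

theorem Category.Admissible.minDiv_spec {V : Type*} [Fintype V] {p : Fin m → V → ℝ}
    {q : Fin k → SourceLaw V} (h : c.Admissible p q) {i : Fin m} (hp : p i ∈ stdSimplex ℝ V) :
    ∃ (d C : ℝ) (j : Fin k), c.minDiv (p i) q = d ∧ (∀ n, AbsCont (prodLaw (p i) n) (q j n)) ∧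
      ∀ᶠ n : ℕ in atTop, relEnt (prodLaw (p i) n) (q j n) = n * d + C := by
  have hfin := h.finite i
  -- Over an empty family the infimum is `⊤`, contradicting finiteness.
  have hne : Nonempty (Fin k) := by
    by_contra hk
    rw [not_nonempty_iff] at hk
    simp [Category.minDiv, iInf_of_empty] at hfin
  obtain ⟨j, hj⟩ := exists_eq_ciInf_of_finite (f := fun j => c.div (p i) (q j))
  have hac := Category.absCont_of_div_lt_top (h.holds j) (fun hc n => h.absCont hc i j n)
    (by rw [hj]; exact hfin)
  obtain ⟨A, C, hA, hC, -⟩ := Category.div_spec hp (h.holds j) hac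
  exact ⟨A, C, j, by rw [← hA, hj]; rfl, hac, hC⟩

theorem iInf_coe_eq {I : Type*} [Fintype I] [Nonempty I] (f : I → ℝ) :
    (⨅ i, ((f i : ℝ) : EReal)) = ((Finset.univ.inf' Finset.univ_nonempty f : ℝ) : EReal) := by
  refine le_antisymm ?_ (le_iInf fun i =>
    EReal.coe_le_coe_iff.2 (Finset.inf'_le f (Finset.mem_univ i)))
  obtain ⟨i, -, hi⟩ := Finset.exists_mem_eq_inf' Finset.univ_nonempty f
  rw [hi]
  exact iInf_le _ i

variable {P : Fin m → Y × X → ℝ} {QY : Fin k → SourceLaw Y} {QX : Fin r → SourceLaw X} {R : ℝ}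
  {s : X → ℝ}

/-- Values of the single-letter problem in terms of the entropy region. -/
theorem mem_thetaValues_iff [Nonempty X] (hP : ∀ i, P i ∈ stdSimplex ℝ (Y × X))
    (hs : s ∈ stdSimplex ℝ X) {V : {i : Fin m // sndMarg (P i) = s} → X → Y → ℝ}
    (hV : ∀ (i : {i : Fin m // sndMarg (P i) = s}) y x, P i (y, x) = s x * V i x y)
    {D : {i : Fin m // sndMarg (P i) = s} → ℝ}
    (hD : ∀ i : {i : Fin m // sndMarg (P i) = s},
      c.minDiv (fstMarg (P i)) QY + c.minDiv s QX = D i) {v : EReal} :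
    v ∈ thetaValues c P QY QX R s ↔ ∃ z ∈ entRegion V, z.1 = s ∧ ent s - z.2.1 ≤ R ∧
      v = ⨅ i, ((ent (push (V i) s) - z.2.2 i + D i : ℝ) : EReal) := by
  constructor
  · rintro ⟨u, W, hW, hR, rfl⟩
    obtain ⟨z, hz, hzs, h1, h2⟩ := exists_point_of_kernel (V := V) hs hW
    refine ⟨z, hz, hzs, h1 ▸ hR, iInf_congr fun i => ?_⟩
    rw [hD, h2 i (P i) (hP i).1 (hV i), ← EReal.coe_add]
  · rintro ⟨z, hz, hzs, hR, rfl⟩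
    obtain ⟨u, W, hW, h1, h2⟩ := exists_kernel_of_point hz hzs
    refine ⟨u, W, hW, h1 ▸ hR, iInf_congr fun i => ?_⟩
    rw [hD, h2 i (P i) (hP i).1 (hV i), ← EReal.coe_add]

/-- A minimum of finitely many continuous functions is maximized over a compact slice of the region.
Compactness replaces a cardinality bound on `U`. -/
theorem exists_isGreatest_thetaValues [Nonempty X] (hP : ∀ i, P i ∈ stdSimplex ℝ (Y × X))
    {i₀ : Fin m} (hs : sndMarg (P i₀) = s) {V : {i : Fin m // sndMarg (P i) = s} → X → Y → ℝ}
    (hV : ∀ (i : {i : Fin m // sndMarg (P i) = s}) y x, P i (y, x) = s x * V i x y)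
    {D : {i : Fin m // sndMarg (P i) = s} → ℝ}
    (hD : ∀ i : {i : Fin m // sndMarg (P i) = s},
      c.minDiv (fstMarg (P i)) QY + c.minDiv s QX = D i) (hR : 0 ≤ R) :
    ∃ v : ℝ, IsGreatest (thetaValues c P QY QX R s) v := by
  classical
  have hss : s ∈ stdSimplex ℝ X := hs ▸ sndMarg_mem (hP i₀)
  have : Nonempty {i : Fin m // sndMarg (P i) = s} := ⟨⟨i₀, hs⟩⟩
  set K : Set ((X → ℝ) × ℝ × ({i : Fin m // sndMarg (P i) = s} → ℝ)) :=
    entRegion V ∩ {z | z.1 = s ∧ ent s - z.2.1 ≤ R} with hK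
  have hKc : IsCompact K := isCompact_entRegion.inter_right
    ((isClosed_eq continuous_fst continuous_const).inter
      (isClosed_le (continuous_const.sub (continuous_fst.comp continuous_snd)) continuous_const))
  have hKn : K.Nonempty := by
    -- A constant auxiliary variable has rate zero, whence `hR`.
    refine ⟨entPoint V s, subset_convexHull ℝ _ ⟨s, hss, rfl⟩, rfl, ?_⟩
    change ent s - homEnt s ≤ R
    rw [homEnt_of_sum_eq_one hss.2, sub_self]
    exact hR
  obtain ⟨z, hz, hmax⟩ := hKc.exists_isMaxOn hKn (f := fun z =>
    Finset.univ.inf' Finset.univ_nonempty fun i => ent (push (V i) s) - z.2.2 i + D i)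
    (Continuous.continuousOn (Continuous.finset_inf'_apply _ fun i _ => by fun_prop))
  refine ⟨_, (mem_thetaValues_iff hP hss hV hD).2 ⟨z, hz.1, hz.2.1, hz.2.2, (iInf_coe_eq _).symm⟩,
    fun v hv => ?_⟩
  obtain ⟨z', hz', h1, h2, rfl⟩ := (mem_thetaValues_iff hP hss hV hD).1 hv
  rw [iInf_coe_eq]
  exact EReal.coe_le_coe_iff.2 (hmax ⟨hz', h1, h2⟩)

end Theta

/-! ### The converse -/

section Divergence

variable {A B : Type*} [Fintype A] [Fintype B]

theorem relEnt_prod {p : A × B → ℝ} (hp : ∀ z, 0 ≤ p z) {a : A → ℝ} {b : B → ℝ}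
    (ha : AbsCont (fstMarg p) a) (hb : AbsCont (sndMarg p) b) :
    relEnt p (fun z => a z.1 * b z.2) =
      mutualInfo p + relEnt (fstMarg p) a + relEnt (sndMarg p) b := by
  have e1 : relEnt (fstMarg p) a = ∑ x, ∑ y, p (x, y) * log (fstMarg p x / a x) := by
    simp only [relEnt, ← Finset.sum_mul]; rfl
  have e2 : relEnt (sndMarg p) b = ∑ x, ∑ y, p (x, y) * log (sndMarg p y / b y) := by
    rw [Finset.sum_comm]
    simp only [relEnt, ← Finset.sum_mul]; rfl
  rw [e1, e2, mutualInfo, relEnt, Fintype.sum_prod_type]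
  simp only [← Finset.sum_add_distrib]
  refine Finset.sum_congr rfl fun x _ => Finset.sum_congr rfl fun y _ => ?_
  by_cases h0 : p (x, y) = 0
  · simp [h0]
  have hpos : 0 < p (x, y) := lt_of_le_of_ne (hp _) (Ne.symm h0)
  have hf : fstMarg p x ≠ 0 := (hpos.trans_le (Finset.single_le_sum (f := fun b => p (x, b))
    (fun b _ => hp _) (Finset.mem_univ y))).ne'
  have hs : sndMarg p y ≠ 0 := (hpos.trans_le (Finset.single_le_sum (f := fun a => p (a, y))
    (fun a _ => hp _) (Finset.mem_univ x))).ne'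
  have hax : a x ≠ 0 := fun h => hf (ha x h)
  have hby : b y ≠ 0 := fun h => hs (hb y h)
  rw [log_div h0 (mul_ne_zero hax hby), log_mul hax hby, log_div h0 (mul_ne_zero hf hs),
    log_mul hf hs, log_div hf hax, log_div hs hby]
  ring

/-- Relative entropy bounds the exponent of any test. -/
theorem test_exponent_le {p q d : A → ℝ} (hp : p ∈ stdSimplex ℝ A) (hq : q ∈ stdSimplex ℝ A)
    (h : AbsCont p q) (hd : ∀ a, d a ∈ Set.Icc (0 : ℝ) 1) (hpd : 0 < ∑ a, p a * d a) :
    0 < ∑ a, q a * d a ∧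
      -((∑ a, p a * d a) * log (∑ a, q a * d a)) ≤ relEnt p q + 2 := by
  set S := ∑ a, p a * d a with hS
  set Q := ∑ a, q a * d a with hQ
  have hac : AbsCont (fun a => p a * d a) (fun a => q a * d a) := by
    intro a ha
    rcases mul_eq_zero.1 ha with h0 | h0
    · simp [h a h0]
    · simp [h0]
  have hQ0 : 0 < Q := by
    refine lt_of_le_of_ne (Finset.sum_nonneg fun a _ => mul_nonneg (hq.1 a) (hd a).1) fun h0 => ?_
    refine hpd.ne' (Finset.sum_eq_zero fun a _ => hac a ?_)
    exact (Finset.sum_eq_zero_iff_of_nonneg fun a _ => mul_nonneg (hq.1 a) (hd a).1).1 h0.symm a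
      (Finset.mem_univ a)
  refine ⟨hQ0, ?_⟩
  have h1 := log_sum_le (fun a => mul_nonneg (hp.1 a) (hd a).1)
    (fun a => mul_nonneg (hq.1 a) (hd a).1) hac
  have h2 : ∀ a, p a * d a * log (p a * d a / (q a * d a)) = p a * d a * log (p a / q a) := by
    intro a
    by_cases h0 : d a = 0
    · simp [h0]
    · rw [mul_div_mul_right _ _ h0]
  -- The rejected part contributes `p (1 - d) log (p / q) ≥ (1 - d) (p - q) ≥ -q`. Summing over `a`
  -- loses at most 1; the other unit comes from `S log S ≥ S - 1 ≥ -1`.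
  have h3 : ∀ a, p a * d a * log (p a / q a) - q a ≤ p a * log (p a / q a) := by
    intro a
    rcases (hp.1 a).eq_or_lt with h0 | h0
    · simp [← h0, hq.1 a]
    have hq0 : 0 < q a := lt_of_le_of_ne (hq.1 a) fun h' => h0.ne' (h a h'.symm)
    have h4 := one_sub_inv_le_log_of_pos (x := p a / q a) (by positivity)
    have h5 := mul_le_mul_of_nonneg_left h4 (mul_nonneg h0.le (sub_nonneg.2 (hd a).2))
    have h6 : p a * (1 - d a) * (1 - (p a / q a)⁻¹) = (1 - d a) * (p a - q a) := by
      field_simp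
    rw [h6] at h5
    nlinarith [(hd a).1, (hd a).2, mul_nonneg (sub_nonneg.2 (hd a).2) h0.le,
      mul_nonneg (hd a).1 hq0.le]
  have h4 := Finset.sum_le_sum fun a (_ : a ∈ Finset.univ) => h3 a
  rw [Finset.sum_sub_distrib, hq.2] at h4
  simp only [h2] at h1
  rw [← hS, ← hQ, log_div hpd.ne' hQ0.ne'] at h1
  have h5 := one_sub_inv_le_log_of_pos hpd
  have h6 := mul_le_mul_of_nonneg_left h5 hpd.le
  have h7 : S * (1 - S⁻¹) = S - 1 := by field_simp
  rw [h7] at h6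
  rw [relEnt]
  linarith

open Classical in
/-- The image of a vector under a map. -/
noncomputable def mapLaw {A B : Type*} [Fintype A] (f : A → B) (p : A → ℝ) (b : B) : ℝ := ∑ a, if f a = b then p a else 0

theorem absCont_mapLaw {A B : Type*} [Fintype A] {f : A → B} {p q : A → ℝ} (hq : ∀ a, 0 ≤ q a) (h : AbsCont p q) :
    AbsCont (mapLaw f p) (mapLaw f q) := by
  classical
  intro b hb
  refine Finset.sum_eq_zero fun a _ => ?_
  have := (Finset.sum_eq_zero_iff_of_nonneg fun a _ => by split_ifs <;> simp [hq a]).1 hb a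
    (Finset.mem_univ a)
  by_cases hf : f a = b
  · simp only [hf, if_true] at this ⊢
    exact h a this
  · simp [hf]

theorem sum_mapLaw (f : A → B) (p : A → ℝ) : ∑ b, mapLaw f p b = ∑ a, p a := by
  classical
  simp only [mapLaw]
  rw [Finset.sum_comm]
  simp

theorem mapLaw_nonneg {A B : Type*} [Fintype A] (f : A → B) {p : A → ℝ} (hp : ∀ a, 0 ≤ p a) (b : B) : 0 ≤ mapLaw f p b :=
  Finset.sum_nonneg fun a _ => by split_ifs <;> simp [hp a]

/-- Data processing. -/
theorem relEnt_mapLaw_le (f : A → B) {p q : A → ℝ} (hp : ∀ a, 0 ≤ p a) (hq : ∀ a, 0 ≤ q a)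
    (h : AbsCont p q) : relEnt (mapLaw f p) (mapLaw f q) ≤ relEnt p q := by
  classical
  calc relEnt (mapLaw f p) (mapLaw f q)
      ≤ ∑ b, ∑ a, (if f a = b then p a else 0) *
          log ((if f a = b then p a else 0) / (if f a = b then q a else 0)) := by
        refine Finset.sum_le_sum fun b _ => ?_
        have hac : AbsCont (fun a => if f a = b then p a else 0)
            (fun a => if f a = b then q a else 0) := by
          intro a
          by_cases hf : f a = b
          · simpa [hf] using h a
          · simp [hf]
        exact log_sum_le (fun a => by split_ifs <;> simp [hp a])
          (fun a => by split_ifs <;> simp [hq a]) hac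
    _ = relEnt p q := by
      rw [Finset.sum_comm]
      refine Finset.sum_congr rfl fun a _ => ?_
      rw [Finset.sum_eq_single (f a)]
      · simp
      · intro b _ hb
        simp [Ne.symm hb]
      · simp

end Divergence

/-! ### Single-letter bounds for block codes -/

section Block

variable {X Y ι : Type*} [Fintype X] [Fintype Y]

theorem ent_prodLaw {s : X → ℝ} (hs : s ∈ stdSimplex ℝ X) (n : ℕ) :
    ent (prodLaw s n) = n * ent s := by
  have h1 : ∀ n, homEnt (prodLaw s n) = ent (prodLaw s n) := fun n =>
    homEnt_of_sum_eq_one (sum_prodLaw s hs.2 n)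
  induction n with
  | zero => simp [ent, prodLaw]
  | succ n ih =>
    rw [← h1, homEnt_snoc]
    have : ∀ x : Fin n → X, (fun a => prodLaw s (n + 1) (Fin.snoc (α := fun _ => X) x a)) =
        prodLaw s n x • s := fun x => funext fun a => prodLaw_snoc s x a
    simp_rw [this, homEnt_smul, ← Finset.sum_mul, sum_prodLaw s hs.2, homEnt_of_sum_eq_one hs.2,
      Pi.smul_apply, smul_eq_mul, ← Finset.mul_sum, hs.2, mul_one]
    rw [h1, ih]
    push_cast
    ring

theorem letterCount_prodLaw {s : X → ℝ} (hs : s ∈ stdSimplex ℝ X) (n : ℕ) :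
    letterCount (prodLaw s n) = (n : ℝ) • s := by
  induction n with
  | zero => funext a; simp [letterCount]
  | succ n ih =>
    rw [letterCount_succ]
    simp only [prodLaw_snoc, ← Finset.mul_sum, hs.2, mul_one]
    rw [ih]
    funext a
    simp only [Pi.add_apply, Finset.sum_apply, ← Finset.sum_mul, sum_prodLaw s hs.2, Pi.smul_apply,
      smul_eq_mul]
    push_cast
    ring

theorem sum_pairLaw_right {Y : Type*} (p : Y × X → ℝ) (n : ℕ) (y : Fin n → Y) :
    ∑ x, pairLaw p n (y, x) = prodLaw (fstMarg p) n y := by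
  simp only [pairLaw, prodLaw, fstMarg]
  rw [Fintype.prod_sum]

theorem sum_pairLaw_left {X : Type*} (p : Y × X → ℝ) (n : ℕ) (x : Fin n → X) :
    ∑ y, pairLaw p n (y, x) = prodLaw (sndMarg p) n x := by
  simp only [pairLaw, prodLaw, sndMarg]
  rw [Fintype.prod_sum]

theorem pairLaw_mem {p : Y × X → ℝ} (hp : p ∈ stdSimplex ℝ (Y × X)) (n : ℕ) :
    pairLaw p n ∈ stdSimplex ℝ ((Fin n → Y) × (Fin n → X)) := by
  refine ⟨fun z => prodLaw_nonneg hp.1 _, ?_⟩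
  rw [Fintype.sum_prod_type]
  simp only [sum_pairLaw_right]
  exact sum_prodLaw _ (fstMarg_mem hp).2 n

open Classical in
/-- The joint vector of the output block and a function of the input block. -/
noncomputable def codedLaw {Y : Type*} {n : ℕ} {B : Type*} (p : Y × X → ℝ) (φ : (Fin n → X) → B) :
    (Fin n → Y) × B → ℝ :=
  fun z => ∑ x, if φ x = z.2 then pairLaw p n (z.1, x) else 0

theorem codedLaw_nonneg {Y : Type*} {n : ℕ} {B : Type*} {p : Y × X → ℝ} (hp : ∀ z, 0 ≤ p z)
    (φ : (Fin n → X) → B) (z) : 0 ≤ codedLaw p φ z :=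
  Finset.sum_nonneg fun x _ => by
    split_ifs
    · exact prodLaw_nonneg hp _
    · exact le_rfl

theorem fstMarg_codedLaw {Y : Type*} {n : ℕ} {B : Type*} [Fintype B] (p : Y × X → ℝ) (φ : (Fin n → X) → B) :
    fstMarg (codedLaw p φ) = prodLaw (fstMarg p) n := by
  classical
  funext y
  rw [← sum_pairLaw_right]
  simp only [fstMarg, codedLaw]
  rw [Finset.sum_comm]
  simp

theorem sndMarg_codedLaw {n : ℕ} {B : Type*} [Fintype B] (p : Y × X → ℝ) (φ : (Fin n → X) → B) :
    sndMarg (codedLaw p φ) = mapLaw φ (prodLaw (sndMarg p) n) := by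
  classical
  funext b
  simp only [sndMarg, codedLaw, mapLaw]
  rw [Finset.sum_comm]
  refine Finset.sum_congr rfl fun x _ => ?_
  split_ifs
  · exact sum_pairLaw_left p n x
  · simp

/-- Single-letter bound on the information rates of a compressed block, simultaneously for all
channels. -/
theorem exists_point_of_code [Nonempty X] {V : ι → X → Y → ℝ} (hV : ∀ i x, V i x ∈ stdSimplex ℝ Y)
    {s : X → ℝ} (hs : s ∈ stdSimplex ℝ X) {P : ι → Y × X → ℝ}
    (hP : ∀ i, P i ∈ stdSimplex ℝ (Y × X)) (hPV : ∀ i y x, P i (y, x) = s x * V i x y)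
    {n M : ℕ} (hn : 0 < n) (φ : (Fin n → X) → Fin M) :
    ∃ z ∈ entRegion V, z.1 = s ∧ ent s - z.2.1 ≤ log M / n ∧
      ∀ i, mutualInfo (codedLaw (P i) φ) ≤ n * (ent (push (V i) s) - z.2.2 i) := by
  classical
  have hn0 : (0 : ℝ) < n := by exact_mod_cast hn
  -- The source law is cut along the cells of the encoder; the chain rule applies to each piece and
  -- the resulting points of the cone are added and divided by `n`.
  set F : Fin M → (Fin n → X) → ℝ := fun u x => if φ x = u then prodLaw s n x else 0 with hF
  have hF0 : ∀ u x, 0 ≤ F u x := fun u x => by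
    simp only [hF]
    split_ifs
    · exact prodLaw_nonneg hs.1 x
    · exact le_rfl
  choose b hb hble using fun u => exists_mem_entCone_block hV (F u) (hF0 u)
  have hsum := sum_mem_entCone Finset.univ hb
  have hz := smul_mem_entCone hsum (inv_nonneg.2 hn0.le)
  set z := (n : ℝ)⁻¹ • ∑ u, (letterCount (F u), homEnt (F u), b u) with hzdef
  have hFsum : ∀ x, ∑ u, F u x = prodLaw s n x := fun x => by simp [hF]
  have h1 : z.1 = s := by
    have : ∑ u, letterCount (F u) = (n : ℝ) • s := by
      rw [← letterCount_prodLaw hs]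
      funext a
      simp only [letterCount, Finset.sum_apply]
      rw [Finset.sum_comm]
      simp only [← Finset.sum_mul, hFsum]
    simp only [hzdef, Prod.smul_fst, Prod.fst_sum, this, smul_smul]
    rw [inv_mul_cancel₀ hn0.ne', one_smul]
  have h2 : z.2.1 = (n : ℝ)⁻¹ * ∑ u, homEnt (F u) := by
    simp [hzdef, Prod.fst_sum, Prod.snd_sum]
  have h3 : ∀ i, z.2.2 i = (n : ℝ)⁻¹ * ∑ u, b u i := fun i => by
    simp [hzdef, Prod.snd_sum]
  refine ⟨z, mem_entRegion_of_mem_entCone hz (by rw [h1, hs.2]), h1, ?_, fun i => ?_⟩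
  -- The pieces have disjoint supports, so `H(X^n | φ) = n H(s) - H(φ)`, and `H(φ) ≤ log M`.
  · have e1 : ∑ u, ent (F u) = n * ent s := by
      rw [← ent_prodLaw hs]
      simp only [ent]
      rw [Finset.sum_comm]
      refine Finset.sum_congr rfl fun x _ => ?_
      rw [Finset.sum_eq_single (φ x)]
      · simp [hF]
      · intro u _ hu
        simp [hF, Ne.symm hu]
      · simp
    have e2 : ∑ u, (∑ x, F u x) = 1 := by
      rw [Finset.sum_comm]
      simp only [hFsum]
      exact sum_prodLaw s hs.2 n
    have e3 : ∑ u, negMulLog (∑ x, F u x) ≤ log M := by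
      have := homEnt_le_cross (w := fun u => ∑ x, F u x) (q := fun _ => 1)
        (fun u => Finset.sum_nonneg fun x _ => hF0 u x) (fun _ => zero_le_one)
        (fun u h => absurd h one_ne_zero)
      rw [homEnt_of_sum_eq_one e2] at this
      simpa [ent, ← Finset.sum_mul, e2] using this
    have e4 : ∑ u, homEnt (F u) = n * ent s - ∑ u, negMulLog (∑ x, F u x) := by
      simp only [homEnt, Finset.sum_sub_distrib, e1]
    rw [h2, e4, le_div_iff₀ hn0]
    have : (ent s - (n : ℝ)⁻¹ * (n * ent s - ∑ u, negMulLog (∑ x, F u x))) * n =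
        ∑ u, negMulLog (∑ x, F u x) := by field_simp; ring
    rw [this]
    exact e3
  · have hpush : ∀ u, (fun y => codedLaw (P i) φ (y, u)) = pushN (V i) (F u) := by
      intro u
      funext y
      simp only [codedLaw, pushN, hF]
      refine Finset.sum_congr rfl fun x _ => ?_
      split_ifs
      · simp only [pairLaw, prodLaw, hPV, Finset.prod_mul_distrib]
      · simp
    rw [mutualInfo_eq (codedLaw_nonneg (hP i).1 φ), fstMarg_codedLaw, ent_prodLaw (fstMarg_mem (hP i)),
      fstMarg_eq_push (hPV i), h3]
    have : ∑ u, b u i ≤ ∑ u, homEnt (fun y => codedLaw (P i) φ (y, u)) :=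
      Finset.sum_le_sum fun u _ => by rw [hpush]; exact hble u i
    have e : (n : ℝ) * (ent (push (V i) s) - (n : ℝ)⁻¹ * ∑ u, b u i) =
        n * ent (push (V i) s) - ∑ u, b u i := by field_simp
    rw [e]
    linarith

/-- Bound on the exponent of a scheme by relative entropies of blocks. -/
theorem scheme_exponent_le {κ : DecisionKind} {n : ℕ} (T : Scheme κ Y X n) {p : Y × X → ℝ}
    (hp : p ∈ stdSimplex ℝ (Y × X)) {qY : SourceLaw Y} {qX : SourceLaw X}
    (hqY : qY n ∈ stdSimplex ℝ (Fin n → Y)) (hqX : qX n ∈ stdSimplex ℝ (Fin n → X))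
    (hacY : AbsCont (prodLaw (fstMarg p) n) (qY n))
    (hacX : AbsCont (prodLaw (sndMarg p) n) (qX n)) (hα : T.typeI (pairLaw p n) < 1) :
    0 < T.typeII (indepLaw qY qX n) ∧
      -((1 - T.typeI (pairLaw p n)) * log (T.typeII (indepLaw qY qX n))) ≤
        mutualInfo (codedLaw p T.enc) + relEnt (prodLaw (fstMarg p) n) (qY n) +
          relEnt (prodLaw (sndMarg p) n) (qX n) + 2 := by
  classical
  set p' := codedLaw p T.enc with hp'
  set q' : (Fin n → Y) × Fin T.M → ℝ := fun z => qY n z.1 * mapLaw T.enc (qX n) z.2 with hq'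
  set d : (Fin n → Y) × Fin T.M → ℝ := fun z => T.dec z.1 z.2
  have hp'0 : ∀ z, 0 ≤ p' z := codedLaw_nonneg hp.1 _
  have hp'1 : ∑ z, p' z = 1 := by
    have : ∑ y, fstMarg p' y = 1 := by
      rw [hp', fstMarg_codedLaw, sum_prodLaw _ (fstMarg_mem hp).2]
    rw [Fintype.sum_prod_type]
    exact this
  have hq's : q' ∈ stdSimplex ℝ ((Fin n → Y) × Fin T.M) := by
    refine ⟨fun z => mul_nonneg (hqY.1 _) (mapLaw_nonneg _ hqX.1 _), ?_⟩
    rw [Fintype.sum_prod_type]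
    simp only [hq', ← Finset.mul_sum, sum_mapLaw, hqX.2, mul_one, hqY.2]
  have haY : AbsCont (fstMarg p') (qY n) := by rw [hp', fstMarg_codedLaw]; exact hacY
  have haX : AbsCont (sndMarg p') (mapLaw T.enc (qX n)) := by
    rw [hp', sndMarg_codedLaw]; exact absCont_mapLaw hqX.1 hacX
  have hac : AbsCont p' q' := by
    rintro ⟨y, u⟩ h
    rcases mul_eq_zero.1 h with h0 | h0
    · exact (Finset.sum_eq_zero_iff_of_nonneg fun u _ => hp'0 _).1 (haY y h0) u (Finset.mem_univ u)
    · exact (Finset.sum_eq_zero_iff_of_nonneg fun y _ => hp'0 _).1 (haX u h0) y (Finset.mem_univ y)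
  have eI : ∑ z, p' z * d z = 1 - T.typeI (pairLaw p n) := by
    have : T.typeI (pairLaw p n) = ∑ z, p' z * (1 - d z) := by
      rw [Fintype.sum_prod_type]
      simp only [Scheme.typeI, Scheme.compress, hp', codedLaw, d]
    rw [this]
    simp only [mul_sub, mul_one, Finset.sum_sub_distrib, hp'1]
    ring
  have eII : ∑ z, q' z * d z = T.typeII (indepLaw qY qX n) := by
    rw [Fintype.sum_prod_type]
    simp only [Scheme.typeII, Scheme.compress, hq', mapLaw, d, indepLaw, Finset.mul_sum]
    refine Finset.sum_congr rfl fun y _ => Finset.sum_congr rfl fun u _ => ?_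
    congr 1
    refine Finset.sum_congr rfl fun x _ => ?_
    by_cases h : T.enc x = u <;> simp [h]
  have key := test_exponent_le (p := p') (q := q') (d := d) ⟨hp'0, hp'1⟩ hq's hac
    (fun z => κ.values_subset (T.dec_mem _ _)) (by rw [eI]; linarith)
  rw [eI, eII] at key
  refine ⟨key.1, key.2.trans ?_⟩
  have e := relEnt_prod hp'0 haY haX
  rw [hp', fstMarg_codedLaw, sndMarg_codedLaw] at e
  have e2 : relEnt p' q' = _ := e
  rw [e2]
  have := relEnt_mapLaw_le T.enc (fun x => prodLaw_nonneg (sndMarg_mem hp).1 x) hqX.1 hacX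
  linarith

end Block

/-! ### Passage to the limit in the converse -/

section Converse

variable {Y X : Type*} [Fintype Y] [Fintype X] {m k r : ℕ} {c : Category} {κ : DecisionKind}
  {P : Fin m → Y × X → ℝ} {QY : Fin k → SourceLaw Y} {QX : Fin r → SourceLaw X} {R E : ℝ}
  {s : X → ℝ}

/-- One good scheme for each tolerance yields a point of the region that is optimal up to that
tolerance. A limit point meets the rate constraint and the bound on `E` exactly. -/
theorem exists_le_thetaValue_of_achievable [Nonempty X] (hP : ∀ i, P i ∈ stdSimplex ℝ (Y × X))
    (hQY : c.Admissible (fun i => fstMarg (P i)) QY)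
    (hQX : c.Admissible (fun i => sndMarg (P i)) QX)
    (h : Achievable κ (compNull P) (compAlt QY QX) 0 R E) {i₀ : Fin m}
    (hs : sndMarg (P i₀) = s) : ∃ v ∈ thetaValues c P QY QX R s, (E : EReal) ≤ v := by
  classical
  have hss : s ∈ stdSimplex ℝ X := hs ▸ sndMarg_mem (hP i₀)
  have hch : ∀ i : {i : Fin m // sndMarg (P i) = s}, ∃ V : X → Y → ℝ,
      (∀ x, V x ∈ stdSimplex ℝ Y) ∧ ∀ y x, P i (y, x) = s x * V x y := by
    rintro ⟨i, rfl⟩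
    exact exists_channel (hP i)
  choose V hV hPV using hch
  choose dY CY jY hdY hacY hCY using fun i => hQY.minDiv_spec (i := i) (fstMarg_mem (hP i))
  obtain ⟨dX, CX, t, hdX, hacX, hCX⟩ := hQX.minDiv_spec (i := i₀) (sndMarg_mem (hP i₀))
  simp only [hs] at hdX hacX hCX
  have hD : ∀ i : {i : Fin m // sndMarg (P i) = s},
      c.minDiv (fstMarg (P i)) QY + c.minDiv s QX = ((dY i + dX : ℝ) : EReal) := by
    intro i
    rw [hdX, hdY i, EReal.coe_add]
  -- The loss `η (3 + |E|)` collects `η` from the exponent of the scheme, `η` from the constants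
  -- divided by `n`, and `η (|E| + 1)` from the factor `1 - α`. The bound `η ≤ 1 / 2` keeps `α < 1`.
  have key : ∀ η : ℝ, 0 < η → η ≤ 1 / 2 → ∃ z ∈ entRegion V, z.1 = s ∧ ent s - z.2.1 ≤ R + η ∧
      ∀ i, E - η * (3 + |E|) ≤ ent (push (V i) s) - z.2.2 i + (dY i + dX) := by
    intro η hη hη1
    have e1 : ∀ᶠ n : ℕ in atTop, ∀ i, relEnt (prodLaw (fstMarg (P i)) n) (QY (jY i) n) =
        n * dY i + CY i := eventually_all.2 hCY
    have e2 : ∀ᶠ n : ℕ in atTop, ∀ i, CY i + CX + 2 < n * η := eventually_all.2 fun i =>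
      (tendsto_natCast_atTop_atTop.atTop_mul_const hη).eventually_gt_atTop _
    obtain ⟨n, ⟨T, hT⟩, e1, hCX, e2, hn⟩ := ((eventually_good_of_achievable h hη).and
      (e1.and (hCX.and (e2.and (eventually_gt_atTop 0))))).exists
    have hn0 : (0 : ℝ) < n := by exact_mod_cast hn
    obtain ⟨z, hz, hzs, hzR, hzI⟩ := exists_point_of_code hV hss
      (P := fun i : {i : Fin m // sndMarg (P i) = s} => P i) (fun i => hP i) hPV hn T.enc
    refine ⟨z, hz, hzs, hzR.trans ?_, fun i => ?_⟩
    · rw [div_le_iff₀ hn0]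
      linarith [hT.2.2]
    · set α := T.typeI (pairLaw (P i) n)
      have hα : α ≤ η := hT.1 _ ⟨i, rfl⟩
      have hα0 : 0 ≤ α := T.typeI_nonneg (pairLaw_mem (hP i) n).1
      have hβ := hT.2.1 _ ⟨jY i, t, rfl⟩
      have hx := scheme_exponent_le T (hP i) ((hQY.holds (jY i)).mem n) ((hQX.holds t).mem n)
        (hacY i n) (by rw [i.2]; exact hacX n) (by change α < 1; linarith)
      rw [i.2, hCX, e1 i] at hx
      set β := T.typeII (indepLaw (QY (jY i)) (QX t) n)
      have hlog : log β ≤ -(n * (E - η)) := by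
        rw [← log_exp (-(n * (E - η)))]
        exact log_le_log hx.1 hβ
      have hI := hzI i
      have h1 : (1 - α) * (n * (E - η)) ≤ -((1 - α) * log β) := by
        rw [← mul_neg]
        exact mul_le_mul_of_nonneg_left (by linarith) (by linarith)
      have h2 : α * (E - η) ≤ η * (|E| + 1) := by
        calc α * (E - η) ≤ α * (|E| + 1) :=
              mul_le_mul_of_nonneg_left (by linarith [le_abs_self E]) hα0
          _ ≤ _ := mul_le_mul_of_nonneg_right hα (by positivity)
      have h3 : n * (α * (E - η)) ≤ n * (η * (|E| + 1)) := mul_le_mul_of_nonneg_left h2 hn0.le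
      have h4 : n * (E - η * (3 + |E|)) ≤ n * (ent (push (V i) s) - z.2.2 i + (dY i + dX)) := by
        have := e2 i
        have := hx.2
        linarith
      exact le_of_mul_le_mul_left h4 hn0
  have hη : ∀ l : ℕ, (0 : ℝ) < 1 / ((l : ℝ) + 2) ∧ 1 / ((l : ℝ) + 2) ≤ 1 / 2 := fun l =>
    ⟨by positivity, one_div_le_one_div_of_le (by norm_num) (by linarith [Nat.cast_nonneg (α := ℝ) l])⟩
  choose z hz hzs hzR hzE using fun l => key _ (hη l).1 (hη l).2
  obtain ⟨w, hw, f, hf, hlim⟩ := isCompact_entRegion.tendsto_subseq hz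
  have hη0 : Tendsto (fun l : ℕ => 1 / (((f l : ℕ) : ℝ) + 2)) atTop (𝓝 0) := by
    have : Tendsto (fun l : ℕ => 1 / ((l : ℝ) + 2)) atTop (𝓝 0) :=
      tendsto_const_nhds.div_atTop (tendsto_natCast_atTop_atTop.atTop_add tendsto_const_nhds)
    exact this.comp hf.tendsto_atTop
  have hl1 : Tendsto (fun l => (z (f l)).1) atTop (𝓝 w.1) := (continuous_fst.tendsto w).comp hlim
  have hl2 : Tendsto (fun l => (z (f l)).2.1) atTop (𝓝 w.2.1) :=
    ((continuous_fst.comp continuous_snd).tendsto w).comp hlim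
  have hl3 : ∀ i, Tendsto (fun l => (z (f l)).2.2 i) atTop (𝓝 (w.2.2 i)) := fun i =>
    (((continuous_apply i).comp (continuous_snd.comp continuous_snd)).tendsto w).comp hlim
  refine ⟨_, (mem_thetaValues_iff hP hss hPV hD).2 ⟨w, hw, ?_, ?_, rfl⟩, le_iInf fun i =>
    EReal.coe_le_coe_iff.2 ?_⟩
  · simp only [hzs] at hl1
    exact tendsto_nhds_unique hl1 tendsto_const_nhds
  · refine le_of_tendsto_of_tendsto' (hl2.const_sub (ent s)) ?_ fun l => hzR (f l)
    simpa using hη0.const_add R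
  · refine le_of_tendsto_of_tendsto' ?_ (((hl3 i).const_sub _).add_const _) fun l => hzE (f l) i
    simpa using (hη0.mul_const (3 + |E|)).const_sub E

end Converse

/-! ### Covering by random codes -/

section Covering

variable {A B : Type*} [Fintype A] [Fintype B]

theorem exists_le_of_average {w f : A → ℝ} (hw : w ∈ stdSimplex ℝ A) {t : ℝ}
    (h : ∑ a, w a * f a ≤ t) : ∃ a, f a ≤ t := by
  by_contra! hlt
  have h1 : ∑ a, w a * (f a - t) ≤ 0 := by
    simp only [mul_sub, Finset.sum_sub_distrib, ← Finset.sum_mul, hw.2]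
    linarith
  have h2 : ∀ a, 0 ≤ w a * (f a - t) := fun a => mul_nonneg (hw.1 a) (sub_nonneg.2 (hlt a).le)
  have h3 := le_antisymm h1 (Finset.sum_nonneg fun a _ => h2 a)
  have h4 : ∀ a, w a = 0 := fun a => by
    have := (Finset.sum_eq_zero_iff_of_nonneg fun a _ => h2 a).1 h3 a (Finset.mem_univ a)
    exact (mul_eq_zero.1 this).resolve_right (sub_pos.2 (hlt a)).ne'
  have := hw.2
  simp [h4] at this

/-- Bounds the probability that `M` independent words all miss, when one word hits with probability
`g ≥ t / L`. The step from `exp (-(t M / L))` to a bound affine in `t` is convexity of `exp` between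
`0` and `-(M / L)`. -/
theorem one_sub_pow_le {g t L : ℝ} (M : ℕ) (hL : 0 < L) (hg : g ≤ 1) (ht0 : 0 ≤ t) (ht1 : t ≤ 1)
    (htg : t ≤ L * g) : (1 - g) ^ M ≤ 1 - t + exp (-(M / L)) := by
  have h1 : 1 - g ≤ exp (-(t / L)) := by
    have := add_one_le_exp (-(t / L))
    have h2 : t / L ≤ g := by rw [div_le_iff₀ hL]; linarith
    linarith
  have h2 : (1 - g) ^ M ≤ exp (t * (-(M / L))) := by
    calc (1 - g) ^ M ≤ exp (-(t / L)) ^ M := pow_le_pow_left₀ (by linarith) h1 M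
      _ = _ := by rw [← exp_nat_mul]; congr 1; ring
  have h3 := convexOn_exp.2 (Set.mem_univ 0) (Set.mem_univ (-(M / L))) (sub_nonneg.2 ht1) ht0
    (by ring)
  simp only [smul_eq_mul, mul_zero, zero_add, exp_zero, mul_one] at h3
  have h4 : t * exp (-(M / L)) ≤ exp (-(M / L)) := mul_le_of_le_one_left (exp_pos _).le ht1
  linarith

/-- One-shot covering lemma. -/
theorem exists_code {pA : A → ℝ} {pB : B → ℝ} (hA : pA ∈ stdSimplex ℝ A)
    (hB : pB ∈ stdSimplex ℝ B) {p : A × B → ℝ} (hp : ∀ z, 0 ≤ p z) (hpA : fstMarg p = pA)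
    (G : Set (A × B)) {L : ℝ} (hL : 0 < L)
    (hG : ∀ z ∈ G, p z ≤ L * (pA z.1 * pB z.2)) (M : ℕ) :
    ∃ code : Fin M → B, mass pA {a | ∀ k, (a, code k) ∉ G} ≤ mass p Gᶜ + exp (-(M / L)) := by
  classical
  set g : A → ℝ := fun a => mass pB {b | (a, b) ∈ G} with hg
  have hg1 : ∀ a, mass pB {b | (a, b) ∉ G} = 1 - g a := by
    intro a
    rw [← hB.2, hg, ← mass_compl]
    rfl
  have hg_le : ∀ a, g a ≤ 1 := fun a => by
    have := mass_nonneg hB.1 {b | (a, b) ∉ G}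
    rw [hg1] at this
    linarith
  -- The words are drawn independently from `pB`; some code book is no worse than the average.
  refine exists_le_of_average (prodLaw_mem hB M) ?_
  have havg : ∑ code, prodLaw pB M code * mass pA {a | ∀ k, (a, code k) ∉ G} =
      ∑ a, pA a * (1 - g a) ^ M := by
    simp only [mass, Finset.mul_sum]
    rw [Finset.sum_comm]
    refine Finset.sum_congr rfl fun a _ => ?_
    rw [← hg1, mass, ← Fin.prod_const, Fintype.prod_sum, Finset.mul_sum]
    refine Finset.sum_congr rfl fun code _ => ?_
    by_cases h : ∀ k, (a, code k) ∉ G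
    · rw [if_pos (by exact h), mul_comm]
      exact congrArg _ (Finset.prod_congr rfl fun k _ => (if_pos (h k)).symm)
    · have h' := h
      push Not at h'
      obtain ⟨k, hk⟩ := h'
      rw [if_neg (by exact h), Finset.prod_eq_zero (Finset.mem_univ k), mul_zero, mul_zero]
      exact if_neg (not_not.2 hk)
  rw [havg]
  have hpa : ∀ a b, pA a = 0 → p (a, b) = 0 := by
    intro a b h0
    rw [← hpA] at h0
    exact (Finset.sum_eq_zero_iff_of_nonneg fun b _ => hp _).1 h0 b (Finset.mem_univ b)
  -- `q a / pA a` is the conditional probability of `G` given `a`. The density bound on `G` makes it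
  -- at most `L` times the probability `g a` that an independent word hits.
  set q : A → ℝ := fun a => ∑ b, if (a, b) ∈ G then p (a, b) else 0 with hq
  have hq0 : ∀ a, 0 ≤ q a := fun a => Finset.sum_nonneg fun b _ => by
    split_ifs <;> simp [hp]
  have hqA : ∀ a, q a ≤ pA a := fun a => by
    rw [← hpA]
    exact Finset.sum_le_sum fun b _ => by split_ifs <;> simp [hp]
  have hqg : ∀ a, q a ≤ L * (pA a * g a) := by
    intro a
    simp only [hq, hg, mass, Finset.mul_sum]
    refine Finset.sum_le_sum fun b _ => ?_
    by_cases h : (a, b) ∈ G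
    · rw [if_pos h, if_pos (by exact h)]
      exact hG _ h
    · rw [if_neg h, if_neg (by exact h)]
      simp
  have hterm : ∀ a, pA a * (1 - g a) ^ M ≤ pA a - q a + pA a * exp (-(M / L)) := by
    intro a
    rcases (hA.1 a).eq_or_lt with h0 | h0
    · have : q a = 0 := le_antisymm ((hqA a).trans h0.symm.le) (hq0 a)
      simp [← h0, this]
    have h1 := one_sub_pow_le (g := g a) (t := q a / pA a) M hL (hg_le a)
      (div_nonneg (hq0 a) h0.le) ((div_le_one h0).2 (hqA a))
      (by rw [div_le_iff₀ h0]; linarith [hqg a])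
    have h2 := mul_le_mul_of_nonneg_left h1 h0.le
    have h3 : pA a * (1 - q a / pA a + exp (-(M / L))) = pA a - q a + pA a * exp (-(M / L)) := by
      field_simp
    rwa [h3] at h2
  refine (Finset.sum_le_sum fun a _ => hterm a).trans (le_of_eq ?_)
  have hpsum : ∑ z, p z = ∑ a, pA a := by
    rw [Fintype.sum_prod_type, ← hpA]
    rfl
  rw [Finset.sum_add_distrib, Finset.sum_sub_distrib, ← Finset.sum_mul, hA.2, one_mul, mass_compl,
    hpsum, hA.2, mass, Fintype.sum_prod_type]

end Covering

/-! ### Typical pairs of blocks -/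

section Pairs

variable {A B : Type*} [Fintype A] [Fintype B]

theorem mass_pairLaw (p : A × B → ℝ) (n : ℕ) (S : Set ((Fin n → A) × (Fin n → B))) :
    mass (pairLaw p n) S =
      mass (prodLaw p n) {w | ((fun l => (w l).1), fun l => (w l).2) ∈ S} := by
  classical
  rw [mass, mass, ← (Equiv.arrowProdEquivProdArrow (Fin n) (fun _ => A) (fun _ => B)).sum_comp]
  rfl

theorem mass_pairLaw_fst (p : A × B → ℝ) (n : ℕ) (S : Set (Fin n → A)) :
    mass (pairLaw p n) {z | z.1 ∈ S} = mass (prodLaw (fstMarg p) n) S := by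
  classical
  rw [mass, mass, Fintype.sum_prod_type]
  refine Finset.sum_congr rfl fun a _ => ?_
  rw [← sum_pairLaw_right]
  by_cases h : a ∈ S <;> simp [h]

/-- Equipartition of `p` relative to the product of its marginals, the divergence being the mutual
information. -/
theorem tendsto_mass_pairLaw_aep {p : A × B → ℝ} (hp : p ∈ stdSimplex ℝ (A × B)) {δ : ℝ}
    (hδ : 0 < δ) :
    Tendsto (fun n : ℕ => mass (pairLaw p n)
      {z | exp (n * (mutualInfo p - δ)) * (prodLaw (fstMarg p) n z.1 * prodLaw (sndMarg p) n z.2) ≤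
          pairLaw p n z ∧
        pairLaw p n z ≤ exp (n * (mutualInfo p + δ)) *
          (prodLaw (fstMarg p) n z.1 * prodLaw (sndMarg p) n z.2)}ᶜ) atTop (𝓝 0) := by
  have hac : AbsCont p (fun z => fstMarg p z.1 * sndMarg p z.2) := by
    rintro ⟨a, b⟩ h
    rcases mul_eq_zero.1 h with h0 | h0
    · exact (Finset.sum_eq_zero_iff_of_nonneg fun b _ => hp.1 _).1 h0 b (Finset.mem_univ b)
    · exact (Finset.sum_eq_zero_iff_of_nonneg fun a _ => hp.1 _).1 h0 a (Finset.mem_univ a)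
  have hI : relEnt p (fun z => fstMarg p z.1 * sndMarg p z.2) = mutualInfo p := by
    rw [relEnt, mutualInfo, Fintype.sum_prod_type]
  have h := (aep_iid hp (fun z => mul_nonneg ((fstMarg_mem hp).1 z.1) ((sndMarg_mem hp).1 z.2))
    hac).2 δ hδ
  rw [hI] at h
  refine h.congr fun n => ?_
  rw [mass_pairLaw]
  congr 1
  ext w
  simp only [aepSet, prodLaw, Finset.prod_mul_distrib, pairLaw]
  rfl

end Pairs

/-! ### Achievability -/

section OneClass

variable {Y X ι : Type*} [Fintype Y] [Fintype X] [Fintype ι]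

theorem inputLaw_mem {u : ℕ} {s : X → ℝ} (hs : s ∈ stdSimplex ℝ X) {W : X → Fin u → ℝ}
    (hW : ∀ x, W x ∈ stdSimplex ℝ (Fin u)) : inputLaw s W ∈ stdSimplex ℝ (X × Fin u) := by
  refine ⟨fun z => mul_nonneg (hs.1 _) ((hW _).1 _), ?_⟩
  rw [Fintype.sum_prod_type]
  simp only [inputLaw, ← Finset.mul_sum, (hW _).2, mul_one, hs.2]

theorem fstMarg_inputLaw {X : Type*} {u : ℕ} (s : X → ℝ) {W : X → Fin u → ℝ}
    (hW : ∀ x, W x ∈ stdSimplex ℝ (Fin u)) : fstMarg (inputLaw s W) = s := by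
  funext x
  simp only [fstMarg, inputLaw, ← Finset.mul_sum, (hW _).2, mul_one]

theorem fstMarg_outputLaw {Y : Type*} {u : ℕ} (p : Y × X → ℝ) {W : X → Fin u → ℝ}
    (hW : ∀ x, W x ∈ stdSimplex ℝ (Fin u)) : fstMarg (outputLaw p W) = fstMarg p := by
  funext y
  simp only [fstMarg, outputLaw]
  rw [Finset.sum_comm]
  simp only [← Finset.mul_sum, (hW _).2, mul_one]

theorem outputLaw_mem {u : ℕ} {p : Y × X → ℝ} (hp : p ∈ stdSimplex ℝ (Y × X)) {W : X → Fin u → ℝ}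
    (hW : ∀ x, W x ∈ stdSimplex ℝ (Fin u)) : outputLaw p W ∈ stdSimplex ℝ (Y × Fin u) := by
  refine ⟨fun z => Finset.sum_nonneg fun x _ => mul_nonneg (hp.1 _) ((hW _).1 _), ?_⟩
  rw [Fintype.sum_prod_type, ← (fstMarg_mem hp).2, ← fstMarg_outputLaw p hW]
  rfl

theorem sndMarg_outputLaw {u : ℕ} (p : Y × X → ℝ) (W : X → Fin u → ℝ) :
    sndMarg (outputLaw p W) = sndMarg (inputLaw (sndMarg p) W) := by
  funext b
  simp only [sndMarg, outputLaw, inputLaw, Finset.sum_mul]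
  exact Finset.sum_comm

/-- If the pair of the output block and the auxiliary block lies in `T` with high probability, then
for most pairs of an input block and an auxiliary block this holds conditionally. -/
theorem mass_conditional_le {u n : ℕ} {p : Y × X → ℝ} (hp : p ∈ stdSimplex ℝ (Y × X))
    {W : X → Fin u → ℝ} (hW : ∀ x, W x ∈ stdSimplex ℝ (Fin u))
    (T : Set ((Fin n → Y) × (Fin n → Fin u))) {ε : ℝ} (hε : 0 < ε) :
    mass (pairLaw (inputLaw (sndMarg p) W) n)
      {z | mass (fun y => pairLaw p n (y, z.1)) {y | (y, z.2) ∉ T} ≤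
        ε * prodLaw (sndMarg p) n z.1}ᶜ ≤ mass (pairLaw (outputLaw p W) n) Tᶜ / ε := by
  classical
  rw [le_div_iff₀ hε, mass, Finset.sum_mul]
  have hout : ∀ y v, pairLaw (outputLaw p W) n (y, v) =
      ∑ x, pairLaw p n (y, x) * ∏ l, W (x l) (v l) := by
    intro y v
    simp only [pairLaw, prodLaw, outputLaw]
    rw [Fintype.prod_sum]
    simp only [Finset.prod_mul_distrib]
  have hin : ∀ x v, pairLaw (inputLaw (sndMarg p) W) n (x, v) =
      prodLaw (sndMarg p) n x * ∏ l, W (x l) (v l) := by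
    intro x v
    simp only [pairLaw, prodLaw, inputLaw, Finset.prod_mul_distrib]
  have hWn : ∀ (x : Fin n → X) (v : Fin n → Fin u), 0 ≤ ∏ l, W (x l) (v l) := fun x v =>
    Finset.prod_nonneg fun l _ => (hW _).1 _
  -- Markov's inequality: each bad pair carries at least `ε` times its mass. The dominating sum
  -- equals the mass of `Tᶜ`, since `U` depends on `Y` only through `X`.
  refine le_trans (Finset.sum_le_sum (g := fun z =>
    mass (fun y => pairLaw p n (y, z.1)) {y | (y, z.2) ∉ T} * ∏ l, W (z.1 l) (z.2 l))
    fun z _ => ?_) (le_of_eq ?_)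
  · obtain ⟨x, v⟩ := z
    have hm : 0 ≤ mass (fun y => pairLaw p n (y, x)) {y | (y, v) ∉ T} :=
      mass_nonneg (fun y => (pairLaw_mem hp n).1 _) _
    split_ifs with h
    · rw [hin]
      have h' : ε * prodLaw (sndMarg p) n x ≤
          mass (fun y => pairLaw p n (y, x)) {y | (y, v) ∉ T} := by
        by_contra hlt
        exact h (not_le.1 hlt).le
      calc _ = ε * prodLaw (sndMarg p) n x * ∏ l, W (x l) (v l) := by ring
        _ ≤ _ := mul_le_mul_of_nonneg_right h' (hWn x v)
    · rw [zero_mul]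
      exact mul_nonneg hm (hWn x v)
  rw [mass, Fintype.sum_prod_type, Fintype.sum_prod_type_right]
  simp only [mass, hout, Finset.sum_mul]
  rw [Finset.sum_comm]
  refine Finset.sum_congr rfl fun v _ => ?_
  rw [Finset.sum_comm]
  refine Finset.sum_congr rfl fun y _ => ?_
  by_cases h : (y, v) ∈ T <;> simp [h]

/-- Codes for the sources with a common marginal `s`: a code book of `M` words, a relation `G` of
admissible encodings, and acceptance regions `T i`. -/
theorem eventually_exists_class_code {s : X → ℝ} (hs : s ∈ stdSimplex ℝ X) {P : ι → Y × X → ℝ}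
    (hP : ∀ i, P i ∈ stdSimplex ℝ (Y × X)) (hPs : ∀ i, sndMarg (P i) = s) {u : ℕ}
    {W : X → Fin u → ℝ} (hW : ∀ x, W x ∈ stdSimplex ℝ (Fin u)) {R : ℝ}
    (hR : mutualInfo (inputLaw s W) ≤ R) {ε δ : ℝ} (hε : 0 < ε) (hδ : 0 < δ)
    {B : (n : ℕ) → Set (Fin n → X)}
    (hB : Tendsto (fun n => mass (prodLaw s n) (B n)ᶜ) atTop (𝓝 0))
    {S : ι → (n : ℕ) → Set (Fin n → Y)}
    (hS : ∀ i, Tendsto (fun n => mass (prodLaw (fstMarg (P i)) n) (S i n)ᶜ) atTop (𝓝 0)) :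
    ∀ᶠ n : ℕ in atTop, ∃ (G : Set ((Fin n → X) × Fin ⌈exp (n * (R + 2 * δ))⌉₊))
      (T : ι → Set ((Fin n → Y) × Fin ⌈exp (n * (R + 2 * δ))⌉₊)),
      (∀ x k, (x, k) ∈ G → x ∈ B n ∧ ∀ i, mass (fun y => pairLaw (P i) n (y, x))
        {y | (y, k) ∉ T i} ≤ ε * prodLaw s n x) ∧
      mass (prodLaw s n) {x | ∀ k, (x, k) ∉ G} ≤ ε ∧
      ∀ i k, (∀ y, (y, k) ∈ T i → y ∈ S i n) ∧ mass (prodLaw (fstMarg (P i)) n)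
        {y | (y, k) ∈ T i} ≤ exp (-(n * (mutualInfo (outputLaw (P i) W) - δ))) := by
  classical
  set pU := sndMarg (inputLaw s W) with hpU
  have hin := inputLaw_mem hs hW
  have hpUs : pU ∈ stdSimplex ℝ (Fin u) := sndMarg_mem hin
  have hfin : fstMarg (inputLaw s W) = s := fstMarg_inputLaw s hW
  have hout := fun i => outputLaw_mem (hP i) hW
  have hfout : ∀ i, fstMarg (outputLaw (P i) W) = fstMarg (P i) := fun i => fstMarg_outputLaw _ hW
  have hsout : ∀ i, sndMarg (outputLaw (P i) W) = pU := fun i => by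
    rw [sndMarg_outputLaw, hPs i]
  set I := mutualInfo (inputLaw s W) with hI
  set J : ι → ℝ := fun i => mutualInfo (outputLaw (P i) W) with hJ
  -- Positivity of the word's probability is included so that it can be cancelled when bounding the
  -- mass accepted for a fixed word.
  set TT : ι → (n : ℕ) → Set ((Fin n → Y) × (Fin n → Fin u)) := fun i n =>
    {z | 0 < prodLaw pU n z.2 ∧ z.1 ∈ S i n ∧ exp (n * (J i - δ)) *
      (prodLaw (fstMarg (P i)) n z.1 * prodLaw pU n z.2) ≤ pairLaw (outputLaw (P i) W) n z} with hTT
  have hTlim : ∀ i, Tendsto (fun n => mass (pairLaw (outputLaw (P i) W) n) (TT i n)ᶜ) atTop (𝓝 0) := by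
    intro i
    have h1 := tendsto_mass_pairLaw_aep (hout i) hδ
    rw [hfout, hsout] at h1
    have h2 := (hS i).add h1
    rw [add_zero] at h2
    have hnn := fun n => (pairLaw_mem (hout i) n).1
    refine squeeze_zero (fun n => mass_nonneg (hnn n) _) (fun n => ?_) h2
    rw [← hfout i, ← mass_pairLaw_fst, hfout]
    refine le_trans (mass_mono (hnn n) fun z hz hzT => ?_) (mass_union_le (hnn n) _ _)
    by_contra hcon
    rw [Set.mem_union, not_or, Set.mem_compl_iff, not_not] at hcon
    obtain ⟨hc1, hc2⟩ := hcon
    refine hzT ⟨?_, not_not.1 hc1, hc2.1⟩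
    refine lt_of_le_of_ne (prodLaw_nonneg hpUs.1 _) fun h0 => hz ?_
    rw [← hsout i, ← sum_pairLaw_left] at h0
    exact (Finset.sum_eq_zero_iff_of_nonneg fun y _ => hnn n _).1 h0.symm z.1 (Finset.mem_univ _)
  -- Admissible encodings: the density bound feeds the covering lemma, and the last condition
  -- ensures acceptance under all sources of the class at once.
  set GG : (n : ℕ) → Set ((Fin n → X) × (Fin n → Fin u)) := fun n =>
    {z | z.1 ∈ B n ∧ pairLaw (inputLaw s W) n z ≤ exp (n * (I + δ)) *
      (prodLaw s n z.1 * prodLaw pU n z.2) ∧ ∀ i, mass (fun y => pairLaw (P i) n (y, z.1))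
        {y | (y, z.2) ∉ TT i n} ≤ ε * prodLaw s n z.1} with hGG
  have hGlim : Tendsto (fun n => mass (pairLaw (inputLaw s W) n) (GG n)ᶜ) atTop (𝓝 0) := by
    have h1 := tendsto_mass_pairLaw_aep hin hδ
    rw [hfin] at h1
    have h2 := tendsto_finsetSum Finset.univ fun i (_ : i ∈ Finset.univ) => (hTlim i).div_const ε
    have h3 := (hB.add h1).add h2
    simp only [zero_div, Finset.sum_const_zero, add_zero] at h3
    have hnn := fun n => (pairLaw_mem hin n).1
    refine squeeze_zero (fun n => mass_nonneg (hnn n) _) (fun n => ?_) h3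
    have h4 : ∀ i, mass (pairLaw (inputLaw s W) n)
        {z | mass (fun y => pairLaw (P i) n (y, z.1)) {y | (y, z.2) ∉ TT i n} ≤
        ε * prodLaw s n z.1}ᶜ ≤ mass (pairLaw (outputLaw (P i) W) n) (TT i n)ᶜ / ε := by
      intro i
      have := mass_conditional_le (hP i) hW (TT i n) hε
      rwa [hPs i] at this
    have h5 : mass (prodLaw s n) (B n)ᶜ = mass (pairLaw (inputLaw s W) n) {z | z.1 ∈ (B n)ᶜ} := by
      rw [mass_pairLaw_fst, hfin]
    rw [h5]
    refine le_trans ?_ (add_le_add le_rfl ((mass_iUnion_le (hnn n) _).trans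
      (Finset.sum_le_sum fun i _ => h4 i)))
    refine le_trans ?_ (add_le_add (mass_union_le (hnn n) _ _) le_rfl)
    refine le_trans (mass_mono (hnn n) fun z _ hzG => ?_) (mass_union_le (hnn n) _ _)
    by_contra hcon
    rw [Set.mem_union, Set.mem_union, not_or, not_or, Set.mem_iUnion, not_exists] at hcon
    obtain ⟨⟨hc1, hc2⟩, hc3⟩ := hcon
    exact hzG ⟨not_not.1 hc1, (not_not.1 hc2).2, fun i => not_not.1 (hc3 i)⟩
  have hexp : Tendsto (fun n : ℕ => exp (-exp (n * δ))) atTop (𝓝 0) :=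
    tendsto_exp_neg_atTop_nhds_zero.comp (tendsto_exp_atTop.comp
      (tendsto_natCast_atTop_atTop.atTop_mul_const hδ))
  have hsumlim := hGlim.add hexp
  rw [add_zero] at hsumlim
  filter_upwards [(tendsto_order.1 hsumlim).2 ε hε] with n hn
  -- With `L = exp (n * (I + δ))` and `I ≤ R` this gives `M / L ≥ exp (n * δ)`, so the covering
  -- failure is doubly exponentially small.
  set M := ⌈exp (n * (R + 2 * δ))⌉₊
  obtain ⟨code, hcode⟩ := exists_code (prodLaw_mem hs n) (prodLaw_mem hpUs n)
    (pairLaw_mem hin n).1 (by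
      funext x
      change ∑ v, pairLaw (inputLaw s W) n (x, v) = _
      rw [sum_pairLaw_right, hfin]) (GG n) (exp_pos (n * (I + δ))) (fun z hz => hz.2.1) M
  refine ⟨{z | (z.1, code z.2) ∈ GG n}, fun i => {z | (z.1, code z.2) ∈ TT i n},
    fun x k h => ⟨h.1, h.2.2⟩, ?_, fun i k => ⟨fun y h => h.2.1, ?_⟩⟩
  · refine hcode.trans (le_trans (add_le_add le_rfl ?_) hn.le)
    refine exp_le_exp.2 (neg_le_neg ?_)
    rw [le_div_iff₀ (exp_pos _), ← exp_add]
    refine le_trans (exp_le_exp.2 ?_) (Nat.le_ceil _)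
    have : (n : ℝ) * I ≤ n * R := mul_le_mul_of_nonneg_left hR (Nat.cast_nonneg n)
    linarith
  · by_cases h0 : 0 < prodLaw pU n (code k)
    · rw [← mul_le_mul_iff_of_pos_right h0]
      calc _ = ∑ y, (if (y, code k) ∈ TT i n then
              prodLaw (fstMarg (P i)) n y * prodLaw pU n (code k) else 0) := by
            rw [mass, Finset.sum_mul]
            refine Finset.sum_congr rfl fun y _ => ?_
            by_cases h : (y, code k) ∈ TT i n
            · rw [if_pos h, if_pos (by exact h)]
            · rw [if_neg h, if_neg (by exact h), zero_mul]
        _ ≤ ∑ y, exp (-(n * (J i - δ))) * pairLaw (outputLaw (P i) W) n (y, code k) := by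
            refine Finset.sum_le_sum fun y _ => ?_
            have hnn := (pairLaw_mem (hout i) n).1 (y, code k)
            split_ifs with h
            · have := mul_le_mul_of_nonneg_left h.2.2 (exp_pos (-(n * (J i - δ)))).le
              rw [← mul_assoc, ← exp_add, neg_add_cancel, exp_zero, one_mul] at this
              exact this
            · exact mul_nonneg (exp_pos _).le hnn
        _ = _ := by rw [← Finset.mul_sum, sum_pairLaw_left, hsout]
    · refine le_trans (le_of_eq ?_) (exp_pos _).le
      refine Finset.sum_eq_zero fun y _ => if_neg ?_
      exact fun h => h0 h.1

end OneClass

/-! ### Assembling the class codes into one test -/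

section Combine

variable {Y X : Type*} [Fintype Y] [Fintype X] {m k r : ℕ} {κ : DecisionKind}
  {P : Fin m → Y × X → ℝ} {QY : Fin k → SourceLaw Y} {QX : Fin r → SourceLaw X}

/-- Codes for the classes of sources with a common marginal combine to a testing scheme. -/
theorem exists_scheme_of_class_codes (hP : ∀ i, P i ∈ stdSimplex ℝ (Y × X)) {n M : ℕ}
    (hQY : ∀ j y, 0 ≤ QY j n y) (hQX : ∀ t x, 0 ≤ QX t n x)
    (G : Fin m → Set ((Fin n → X) × Fin M)) (T : Fin m → Fin m → Set ((Fin n → Y) × Fin M))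
    {ε b : ℝ} (hb : 0 ≤ b)
    (hdisj : ∀ i i' x l l', (x, l) ∈ G i → (x, l') ∈ G i' → sndMarg (P i) = sndMarg (P i'))
    (hGT : ∀ i i', sndMarg (P i') = sndMarg (P i) → ∀ x l, (x, l) ∈ G i →
      mass (fun y => pairLaw (P i') n (y, x)) {y | (y, l) ∉ T i i'} ≤
        ε * prodLaw (sndMarg (P i)) n x)
    (hcov : ∀ i, mass (prodLaw (sndMarg (P i)) n) {x | ∀ l, (x, l) ∉ G i} ≤ ε)
    (hII : ∀ j t i i', sndMarg (P i') = sndMarg (P i) → ∀ x l, (x, l) ∈ G i →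
      QX t n x * mass (QY j n) {y | (y, l) ∈ T i i'} ≤ b * prodLaw (sndMarg (P i)) n x) :
    ∃ A : Scheme κ Y X n, A.M = m * M + 1 ∧ (∀ i, A.typeI (pairLaw (P i) n) ≤ 2 * ε) ∧
      ∀ j t, A.typeII (indepLaw (QY j) (QX t) n) ≤ m * m * b := by
  classical
  set cover : (Fin n → X) → Prop := fun x => ∃ z : Fin m × Fin M, (x, z.2) ∈ G z.1
  -- The extra message `none` reports that no code book covers `x`; it always leads to rejection.
  set e : Option (Fin m × Fin M) ≃ Fin (m * M + 1) :=
    Fintype.equivFinOfCardEq (by simp [Fintype.card_option])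
  set enc : (Fin n → X) → Option (Fin m × Fin M) := fun x =>
    if h : cover x then some h.choose else none with henc
  have henc_some : ∀ x z, enc x = some z → (x, z.2) ∈ G z.1 := by
    intro x z h
    by_cases hc : cover x
    · simp only [henc, dif_pos hc, Option.some.injEq] at h
      rw [← h]
      exact hc.choose_spec
    · simp [henc, dif_neg hc] at h
  have henc_cover : ∀ x i l, (x, l) ∈ G i → ∃ z, enc x = some z := by
    intro x i l h
    have hc : cover x := ⟨(i, l), h⟩
    exact ⟨_, dif_pos hc⟩
  -- The message names a code book but not the true source, so acceptance is by the union over all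
  -- sources of that class.
  set acc : (Fin n → Y) → Option (Fin m × Fin M) → Prop := fun y o =>
    ∃ z, o = some z ∧ ∃ i', sndMarg (P i') = sndMarg (P z.1) ∧ (y, z.2) ∈ T z.1 i'
  set A : Scheme κ Y X n :=
    { M := m * M + 1
      enc := fun x => e (enc x)
      dec := fun y o => if acc y (e.symm o) then 1 else 0
      dec_mem := fun y o => by
        split_ifs
        · exact κ.one_mem
        · exact κ.zero_mem }
  have hdec : ∀ y x, A.dec y (A.enc x) = if acc y (enc x) then 1 else 0 := by
    intro y x
    change (if acc y (e.symm (e (enc x))) then (1 : ℝ) else 0) = _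
    simp only [Equiv.symm_apply_apply]
  have hpn : ∀ i y x, 0 ≤ pairLaw (P i) n (y, x) := fun i y x => (pairLaw_mem (hP i) n).1 _
  have hsn : ∀ i, prodLaw (sndMarg (P i)) n ∈ stdSimplex ℝ (Fin n → X) := fun i =>
    prodLaw_mem (sndMarg_mem (hP i)) n
  refine ⟨A, rfl, fun i => ?_, fun j t => ?_⟩
  · rw [A.typeI_eq, Finset.sum_comm]
    set s := prodLaw (sndMarg (P i)) n with hs
    have hε : 0 ≤ ε := (mass_nonneg (hsn i).1 _).trans (hcov i)
    obtain ⟨U, hU⟩ : ∃ U : Set (Fin n → X), U = {x | ∀ l, (x, l) ∉ G i} := ⟨_, rfl⟩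
    have hterm : ∀ x, ∑ y, pairLaw (P i) n (y, x) * (1 - A.dec y (A.enc x)) ≤
        (if x ∈ U then s x else 0) + ε * s x := by
      intro x
      by_cases hx : ∀ l, (x, l) ∉ G i
      · rw [if_pos (by rw [hU]; exact hx)]
        have : ∑ y, pairLaw (P i) n (y, x) * (1 - A.dec y (A.enc x)) ≤ s x := by
          rw [hs, ← sum_pairLaw_left]
          refine Finset.sum_le_sum fun y _ => mul_le_of_le_one_right (hpn i y x) ?_
          rw [hdec]
          split_ifs <;> simp
        linarith [mul_nonneg hε ((hsn i).1 x)]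
      · rw [if_neg (by rw [hU]; exact hx), zero_add]
        push Not at hx
        obtain ⟨l, hl⟩ := hx
        obtain ⟨z, hz⟩ := henc_cover x i l hl
        have hzG := henc_some x z hz
        -- The encoder may pick the code book of another index, but only one with the same marginal,
        -- whose regions also serve `i`.
        have hmarg : sndMarg (P i) = sndMarg (P z.1) := hdisj _ _ _ _ _ hl hzG
        refine le_trans ?_ ((hGT z.1 i hmarg x z.2 hzG).trans (by rw [hs, hmarg]))
        refine Finset.sum_le_sum fun y _ => ?_
        rw [hdec, hz]
        by_cases hy : (y, z.2) ∈ T z.1 i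
        · rw [if_pos (by exact ⟨z, rfl, i, hmarg, hy⟩)]
          simp [hy]
        · refine le_trans (mul_le_of_le_one_right (hpn i y x) ?_) (if_pos (by exact hy)).ge
          split_ifs <;> simp
    refine (Finset.sum_le_sum fun x _ => hterm x).trans ?_
    rw [Finset.sum_add_distrib, ← Finset.mul_sum, (hsn i).2, mul_one]
    have := hcov i
    rw [← hU, mass] at this
    linarith
  · rw [A.typeII_eq, Finset.sum_comm]
    -- One factor `m` comes from the union of acceptance regions; the other from replacing the
    -- marginal of the selected code book by the sum of all of them.
    have hterm : ∀ x, ∑ y, indepLaw (QY j) (QX t) n (y, x) * A.dec y (A.enc x) ≤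
        ∑ i, m * b * prodLaw (sndMarg (P i)) n x := by
      intro x
      have hnn : ∀ i, 0 ≤ m * b * prodLaw (sndMarg (P i)) n x := fun i =>
        mul_nonneg (by positivity) ((hsn i).1 x)
      cases hx : enc x with
      | none =>
        have : ∀ y, A.dec y (A.enc x) = 0 := fun y => by
          rw [hdec, hx, if_neg]
          rintro ⟨z, hz, -⟩
          simp at hz
        simp only [this, mul_zero, Finset.sum_const_zero]
        exact Finset.sum_nonneg fun i _ => hnn i
      | some z =>
        have hzG := henc_some x z hx
        refine le_trans ?_ (Finset.single_le_sum (fun i _ => hnn i) (Finset.mem_univ z.1))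
        have hy : ∀ y, indepLaw (QY j) (QX t) n (y, x) * A.dec y (A.enc x) ≤
            ∑ i', QX t n x * (if sndMarg (P i') = sndMarg (P z.1) ∧ (y, z.2) ∈ T z.1 i' then
              QY j n y else 0) := by
          intro y
          have hn' : ∀ i', 0 ≤ QX t n x * (if sndMarg (P i') = sndMarg (P z.1) ∧
              (y, z.2) ∈ T z.1 i' then QY j n y else 0) := fun i' =>
            mul_nonneg (hQX t x) (by split_ifs <;> simp [hQY])
          rw [hdec, hx]
          split_ifs with h
          · obtain ⟨z', hz', i', hi', hT⟩ := h
            obtain rfl := Option.some.inj hz'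
            refine le_trans (le_of_eq ?_) (Finset.single_le_sum (fun i _ => hn' i)
              (Finset.mem_univ i'))
            rw [if_pos ⟨hi', hT⟩, indepLaw, mul_one, mul_comm]
          · rw [mul_zero]
            exact Finset.sum_nonneg fun i' _ => hn' i'
        calc _ ≤ ∑ y, ∑ i', QX t n x * (if sndMarg (P i') = sndMarg (P z.1) ∧
                (y, z.2) ∈ T z.1 i' then QY j n y else 0) := Finset.sum_le_sum fun y _ => hy y
          _ = ∑ i', ∑ y, QX t n x * (if sndMarg (P i') = sndMarg (P z.1) ∧
                (y, z.2) ∈ T z.1 i' then QY j n y else 0) := Finset.sum_comm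
          _ ≤ ∑ i' : Fin m, b * prodLaw (sndMarg (P z.1)) n x := by
            refine Finset.sum_le_sum fun i' _ => ?_
            by_cases h : sndMarg (P i') = sndMarg (P z.1)
            · refine le_trans (le_of_eq ?_) (hII j t z.1 i' h x z.2 hzG)
              rw [← Finset.mul_sum, mass]
              congr 1
              refine Finset.sum_congr rfl fun y _ => ?_
              by_cases hT : (y, z.2) ∈ T z.1 i' <;> simp [h, hT]
            · simp only [h, false_and, if_false, mul_zero, Finset.sum_const_zero]
              exact mul_nonneg hb ((hsn _).1 x)
          _ = _ := by simp [mul_assoc]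
    refine (Finset.sum_le_sum fun x _ => hterm x).trans (le_of_eq ?_)
    rw [Finset.sum_comm]
    simp only [← Finset.mul_sum, (hsn _).2, mul_one, Finset.sum_const, Finset.card_univ,
      Fintype.card_fin, nsmul_eq_mul]
    ring

end Combine

/-! ### Typicality, separation of marginals and choice of parameters -/

section Achievability

variable {Y X : Type*} [Fintype Y] [Fintype X] {m k r : ℕ} {c : Category} {κ : DecisionKind}
  {P : Fin m → Y × X → ℝ} {QY : Fin k → SourceLaw Y} {QX : Fin r → SourceLaw X} {R E : ℝ}

theorem mass_le_mul_mass {V : Type*} [Fintype V] {p q : V → ℝ} {A : Set V} {t : ℝ}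
    (h : ∀ a ∈ A, q a ≤ t * p a) : mass q A ≤ t * mass p A := by
  classical
  rw [mass, mass, Finset.mul_sum]
  refine Finset.sum_le_sum fun a _ => ?_
  by_cases ha : a ∈ A
  · rw [if_pos ha, if_pos ha]; exact h a ha
  · rw [if_neg ha, if_neg ha, mul_zero]

/-- With high probability all alternatives are exponentially less likely than the source. -/
theorem tendsto_mass_alternatives {V : Type*} [Fintype V] {p : Fin m → V → ℝ}
    {q : Fin k → SourceLaw V} (h : c.Admissible p q) {i : Fin m} (hp : p i ∈ stdSimplex ℝ V)
    {d δ : ℝ} (hd : c.minDiv (p i) q = d) (hδ : 0 < δ) :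
    Tendsto (fun n : ℕ => mass (prodLaw (p i) n)
      {x | ∀ j, q j n x ≤ exp (-(n * (d - δ))) * prodLaw (p i) n x}ᶜ) atTop (𝓝 0) := by
  have h1 : ∀ j, Tendsto (fun n : ℕ => mass (prodLaw (p i) n)
      {x | q j n x ≤ exp (-(n * (d - δ))) * prodLaw (p i) n x}ᶜ) atTop (𝓝 0) := fun j =>
    Category.tendsto_mass_lt_div hp (h.holds j) (fun hc n => h.absCont hc i j n)
      (lt_of_lt_of_le (EReal.coe_lt_coe_iff.2 (sub_lt_self d hδ)) (hd ▸ iInf_le _ j))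
  have h2 := tendsto_finsetSum Finset.univ fun j (_ : j ∈ Finset.univ) => h1 j
  rw [Finset.sum_const_zero] at h2
  have hnn : ∀ n (x : Fin n → V), 0 ≤ prodLaw (p i) n x := fun n x => prodLaw_nonneg hp.1 x
  refine squeeze_zero (fun n => mass_nonneg (hnn n) _) (fun n => ?_) h2
  refine le_trans (mass_mono (hnn n) fun x _ hx => ?_) (mass_iUnion_le (hnn n) _)
  by_contra hcon
  rw [Set.mem_iUnion, not_exists] at hcon
  exact hx fun j => not_not.1 (hcon j)

open Classical in
/-- Blocks with empirical frequencies within `γ` of the law `s`. -/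
def typicalSet (s : X → ℝ) (γ : ℝ) (n : ℕ) : Set (Fin n → X) :=
  {x | ∀ a, |∑ l, (if x l = a then (1 : ℝ) else 0) - n * s a| < n * γ}

theorem tendsto_mass_typicalSet {s : X → ℝ} (hs : s ∈ stdSimplex ℝ X) {γ : ℝ} (hγ : 0 < γ) :
    Tendsto (fun n : ℕ => mass (prodLaw s n) (typicalSet s γ n)ᶜ) atTop (𝓝 0) := by
  classical
  have h2 := tendsto_finsetSum Finset.univ fun a (_ : a ∈ Finset.univ) =>
    tendsto_mass_empirical hs (fun b => if b = a then (1 : ℝ) else 0) hγ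
  rw [Finset.sum_const_zero] at h2
  have hnn : ∀ n (x : Fin n → X), 0 ≤ prodLaw s n x := fun n x => prodLaw_nonneg hs.1 x
  refine squeeze_zero (fun n => mass_nonneg (hnn n) _) (fun n => ?_) h2
  refine le_trans (mass_mono (hnn n) fun x _ hx => ?_) (mass_iUnion_le (hnn n) _)
  by_contra hcon
  rw [Set.mem_iUnion, not_exists] at hcon
  refine hx fun a => ?_
  simpa using hcon a

/-- There are finitely many laws, and distinct ones differ by a fixed amount in some letter. A
radius below half of every such gap makes their typical sets disjoint. -/
theorem exists_typicalSet_separation (s : Fin m → X → ℝ) :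
    ∃ γ : ℝ, 0 < γ ∧ ∀ n, 0 < n → ∀ i i' x, x ∈ typicalSet (s i) γ n →
      x ∈ typicalSet (s i') γ n → s i = s i' := by
  have hev : ∀ᶠ γ : ℝ in 𝓝[>] 0, ∀ i i', s i ≠ s i' → ∃ a, 2 * γ < |s i a - s i' a| := by
    refine eventually_all.2 fun i => eventually_all.2 fun i' => ?_
    by_cases h : s i = s i'
    · exact Eventually.of_forall fun γ h' => absurd h h'
    · obtain ⟨a, ha⟩ := Function.ne_iff.1 h
      have hpos : 0 < |s i a - s i' a| / 2 := half_pos (abs_pos.2 (sub_ne_zero.2 ha))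
      filter_upwards [Ioo_mem_nhdsGT hpos] with γ hγ _
      exact ⟨a, by linarith [hγ.2]⟩
  obtain ⟨γ, hγ, hγ0⟩ := (hev.and self_mem_nhdsWithin).exists
  refine ⟨γ, hγ0, fun n hn i i' x hx hx' => ?_⟩
  by_contra hne
  obtain ⟨a, ha⟩ := hγ i i' hne
  have hn0 : (0 : ℝ) < n := by exact_mod_cast hn
  have h1 := abs_lt.1 (hx a)
  have h2 := abs_lt.1 (hx' a)
  have h3 : n * |s i a - s i' a| < n * (2 * γ) := by
    rw [← abs_of_pos hn0, ← abs_mul, abs_of_pos hn0, abs_lt]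
    constructor <;> linarith
  exact absurd (lt_of_mul_lt_mul_left h3 hn0.le) (not_lt.2 ha.le)

/-- For a covered `x` the type II mass is a product of three small factors: `QX` against the source
on `B`, `QY` against the source on `S`, and the independent law of `y` on the acceptance region. -/
theorem achievable_of_le_thetaValues (hP : ∀ i, P i ∈ stdSimplex ℝ (Y × X))
    (hQY : c.Admissible (fun i => fstMarg (P i)) QY)
    (hQX : c.Admissible (fun i => sndMarg (P i)) QX) (hR : 0 ≤ R)
    (hE : ∀ i, ∃ v ∈ thetaValues c P QY QX R (sndMarg (P i)), (E : EReal) ≤ v) :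
    Achievable κ (compNull P) (compAlt QY QX) 0 R E := by
  classical
  choose dY _ _ hdY _ _ using fun i => hQY.minDiv_spec (i := i) (fstMarg_mem (hP i))
  choose dX _ _ hdX _ _ using fun i => hQX.minDiv_spec (i := i) (sndMarg_mem (hP i))
  have hker : ∀ i, ∃ (u : ℕ) (W : X → Fin u → ℝ), (∀ x, W x ∈ stdSimplex ℝ (Fin u)) ∧
      mutualInfo (inputLaw (sndMarg (P i)) W) ≤ R ∧ ∀ i', sndMarg (P i') = sndMarg (P i) →
        E ≤ mutualInfo (outputLaw (P i') W) + dY i' + dX i := by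
    intro i
    obtain ⟨v, ⟨u, W, hW, hWR, rfl⟩, hv⟩ := hE i
    refine ⟨u, W, hW, hWR, fun i' hi' => ?_⟩
    have h1 := hv.trans (iInf_le _ ⟨i', hi'⟩)
    have h2 := hdY i'
    have h3 := hdX i
    simp only at h1 h2 h3
    rw [h2, h3, ← EReal.coe_add, ← EReal.coe_add, EReal.coe_le_coe_iff] at h1
    linarith
  choose u W hW hWR hWE using hker
  obtain ⟨γ, hγ, hsep⟩ := exists_typicalSet_separation fun i => sndMarg (P i)
  rw [achievable_iff]
  intro η hη
  -- The three factors of the type II error lose `3 δ`; the code books use rate `R + 2 δ`. What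
  -- remains of `η` absorbs constants depending on `m`, by `hconst`.
  set δ := η / 4 with hδdef
  have hδ : 0 < δ := by positivity
  have hε : 0 < η / 2 := by positivity
  set B : Fin m → (n : ℕ) → Set (Fin n → X) := fun i n => typicalSet (sndMarg (P i)) γ n ∩
    {x | ∀ t, QX t n x ≤ exp (-(n * (dX i - δ))) * prodLaw (sndMarg (P i)) n x} with hBdef
  set S : Fin m → (n : ℕ) → Set (Fin n → Y) := fun i n =>
    {y | ∀ j, QY j n y ≤ exp (-(n * (dY i - δ))) * prodLaw (fstMarg (P i)) n y} with hSdef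
  have hS : ∀ i, Tendsto (fun n => mass (prodLaw (fstMarg (P i)) n) (S i n)ᶜ) atTop (𝓝 0) := fun i =>
    tendsto_mass_alternatives hQY (fstMarg_mem (hP i)) (hdY i) hδ
  have hB : ∀ i, Tendsto (fun n => mass (prodLaw (sndMarg (P i)) n) (B i n)ᶜ) atTop (𝓝 0) := by
    intro i
    have h := (tendsto_mass_typicalSet (sndMarg_mem (hP i)) hγ).add
      (tendsto_mass_alternatives hQX (sndMarg_mem (hP i)) (hdX i) hδ)
    rw [add_zero] at h
    have hnn : ∀ n (x : Fin n → X), 0 ≤ prodLaw (sndMarg (P i)) n x := fun n x =>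
      prodLaw_nonneg (sndMarg_mem (hP i)).1 x
    refine squeeze_zero (fun n => mass_nonneg (hnn n) _) (fun n => ?_) h
    rw [hBdef]
    simp only [Set.compl_inter]
    exact mass_union_le (hnn n) _ _
  have hcodes := eventually_all.2 fun i => eventually_exists_class_code
    (ι := {i' : Fin m // sndMarg (P i') = sndMarg (P i)}) (P := fun i' => P i')
    (sndMarg_mem (hP i)) (fun i' => hP i') (fun i' => i'.2) (hW i) (hWR i) hε hδ (hB i)
    (S := fun i' => S i') (fun i' => hS i')
  have hconst : ∀ᶠ n : ℕ in atTop, (m * m + 2 * m + 1 : ℝ) < exp (n * δ) :=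
    (tendsto_exp_atTop.comp (tendsto_natCast_atTop_atTop.atTop_mul_const hδ)).eventually_gt_atTop _
  filter_upwards [hcodes, hconst, eventually_gt_atTop 0] with n hn hc hn0
  choose G T hGT hcov hT using hn
  set T' : Fin m → Fin m → Set ((Fin n → Y) × Fin ⌈exp (n * (R + 2 * δ))⌉₊) := fun i i' =>
    if h : sndMarg (P i') = sndMarg (P i) then T i ⟨i', h⟩ else ∅ with hT'
  have hn0' : (0 : ℝ) < n := by exact_mod_cast hn0
  have hQYn : ∀ j y, 0 ≤ QY j n y := fun j => ((hQY.holds j).mem n).1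
  have hQXn : ∀ t x, 0 ≤ QX t n x := fun t => ((hQX.holds t).mem n).1
  obtain ⟨A, hAM, hAI, hAII⟩ := exists_scheme_of_class_codes (κ := κ) hP hQYn hQXn G T'
    (ε := η / 2) (b := exp (-(n * (E - 3 * δ)))) (exp_pos _).le
    (fun i i' x l l' h h' => hsep n hn0 i i' x (hGT i x l h).1.1 (hGT i' x l' h').1.1)
    (fun i i' hi x l hx => by
      simp only [hT', dif_pos hi]
      exact (hGT i x l hx).2 ⟨i', hi⟩)
    hcov
    (fun j t i i' hi x l hx => by
      simp only [hT', dif_pos hi]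
      have h1 := (hGT i x l hx).1.2 t
      obtain ⟨h2, h3⟩ := hT i ⟨i', hi⟩ l
      have h4 : mass (QY j n) {y | (y, l) ∈ T i ⟨i', hi⟩} ≤ exp (-(n * (dY i' - δ))) *
          exp (-(n * (mutualInfo (outputLaw (P i') (W i)) - δ))) :=
        (mass_le_mul_mass fun y hy => h2 y hy j).trans
          (mul_le_mul_of_nonneg_left h3 (exp_pos _).le)
      have hsx : 0 ≤ prodLaw (sndMarg (P i)) n x := prodLaw_nonneg (sndMarg_mem (hP i)).1 x
      calc _ ≤ exp (-(n * (dX i - δ))) * prodLaw (sndMarg (P i)) n x *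
            (exp (-(n * (dY i' - δ))) *
              exp (-(n * (mutualInfo (outputLaw (P i') (W i)) - δ)))) :=
            mul_le_mul h1 h4 (mass_nonneg (hQYn j) _) (mul_nonneg (exp_pos _).le hsx)
        _ = exp (-(n * (dX i - δ)) + (-(n * (dY i' - δ)) +
              -(n * (mutualInfo (outputLaw (P i') (W i)) - δ)))) *
              prodLaw (sndMarg (P i)) n x := by rw [exp_add, exp_add]; ring
        _ ≤ _ := by
          refine mul_le_mul_of_nonneg_right (exp_le_exp.2 ?_) hsx
          have := mul_le_mul_of_nonneg_left (hWE i i' hi) hn0'.le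
          linarith)
  refine ⟨A, ?_, ?_, ?_⟩
  · rintro _ ⟨i, rfl⟩
    linarith [hAI i]
  · rintro _ ⟨j, t, rfl⟩
    refine (hAII j t).trans ?_
    have hm0 : (0 : ℝ) ≤ m := Nat.cast_nonneg m
    calc (m : ℝ) * m * exp (-(n * (E - 3 * δ))) ≤ exp (n * δ) * exp (-(n * (E - 3 * δ))) := by
          gcongr
          linarith
      _ = _ := by rw [← exp_add, hδdef]; congr 1; ring
  · rw [hAM]
    have hm0 : (0 : ℝ) ≤ m := Nat.cast_nonneg m
    set x := exp (n * (R + 2 * δ)) with hx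
    have hx1 : 1 ≤ x := one_le_exp (by positivity)
    have h1 : ((m * ⌈x⌉₊ + 1 : ℕ) : ℝ) ≤ exp (n * (R + η)) := by
      have h2 : (⌈x⌉₊ : ℝ) ≤ 2 * x := by
        have := (Nat.ceil_lt_add_one (by positivity : 0 ≤ x)).le
        linarith
      calc ((m * ⌈x⌉₊ + 1 : ℕ) : ℝ) = m * ⌈x⌉₊ + 1 := by push_cast; ring
        _ ≤ m * (2 * x) + x := by gcongr
        _ = (2 * m + 1) * x := by ring
        _ ≤ exp (n * δ) * x := by
          gcongr
          nlinarith
        _ = exp (n * (R + 3 * δ)) := by rw [hx, ← exp_add]; congr 1; ring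
        _ ≤ _ := by
          gcongr
          linarith
    have h0 : (0 : ℝ) < ((m * ⌈x⌉₊ + 1 : ℕ) : ℝ) := by positivity
    calc _ ≤ log (exp (n * (R + η))) := log_le_log h0 h1
      _ = _ := log_exp _

theorem exists_isGreatest_thetaValues_of_admissible [Nonempty X]
    (hP : ∀ i, P i ∈ stdSimplex ℝ (Y × X))
    (hQY : c.Admissible (fun i => fstMarg (P i)) QY)
    (hQX : c.Admissible (fun i => sndMarg (P i)) QX) (hR : 0 ≤ R) (i : Fin m) :
    ∃ v : ℝ, IsGreatest (thetaValues c P QY QX R (sndMarg (P i))) v := by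
  have hch : ∀ i' : {i' : Fin m // sndMarg (P i') = sndMarg (P i)}, ∃ V : X → Y → ℝ,
      (∀ x, V x ∈ stdSimplex ℝ Y) ∧ ∀ y x, P i' (y, x) = sndMarg (P i) x * V x y := by
    rintro ⟨i', hi'⟩
    obtain ⟨V, hV, h⟩ := exists_channel (hP i')
    exact ⟨V, hV, fun y x => (h y x).trans (by rw [hi'])⟩
  choose V _ hPV using hch
  choose dY _ _ hdY _ _ using fun i => hQY.minDiv_spec (i := i) (fstMarg_mem (hP i))
  obtain ⟨dX, _, _, hdX, _, _⟩ := hQX.minDiv_spec (i := i) (sndMarg_mem (hP i))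
  refine exists_isGreatest_thetaValues hP rfl hPV (D := fun i' => dY i' + dX) (fun i' => ?_) hR
  rw [hdX, hdY i', EReal.coe_add]

end Achievability

end GenIndep

theorem theorem3 {Y X : Type*} [Fintype Y] [Fintype X] {m k r : ℕ} (hm : 0 < m)
    (P : Fin m → Y × X → ℝ) (hP : ∀ i, P i ∈ stdSimplex ℝ (Y × X))
    (c : GenIndep.Category)
    (QY : Fin k → GenIndep.SourceLaw Y) (QX : Fin r → GenIndep.SourceLaw X)
    (hQY : c.Admissible (fun i => GenIndep.fstMarg (P i)) QY)
    (hQX : c.Admissible (fun i => GenIndep.sndMarg (P i)) QX)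
    (γp γq : ℝ) (hγp : 0 < γp) (hγp1 : γp < 1) (hγpm : (m : ℝ) * γp ≤ 1)
    (hγq : 0 < γq) (hγq1 : γq < 1)
    (Γq : ℕ → ℝ) (hΓq : ∀ n, 1 ≤ Γq n)
    (hΓq_lim : Filter.Tendsto (fun n : ℕ => Real.log (Γq n) / (n : ℝ)) Filter.atTop (nhds 0))
    (κ : GenIndep.DecisionKind) (Rc : ℝ) (hRc : 0 ≤ Rc) :
    GenIndep.maxExponent κ (GenIndep.mixNull P γp) (GenIndep.mixAlt c P QY QX γq Γq) 0 Rc =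
        GenIndep.maxExponent κ (GenIndep.compNull P) (GenIndep.compAlt QY QX) 0 Rc ∧
      GenIndep.maxExponent κ (GenIndep.compNull P) (GenIndep.compAlt QY QX) 0 Rc =
        (⨅ s ∈ Set.range (fun i => GenIndep.sndMarg (P i)), GenIndep.theta c P QY QX Rc s) ∧
      ∀ s ∈ Set.range (fun i => GenIndep.sndMarg (P i)),
        GenIndep.theta c P QY QX Rc s ∈ GenIndep.thetaValues c P QY QX Rc s := by
  have hX : Nonempty X := by
    by_contra hX
    rw [not_nonempty_iff] at hX
    have := (hP ⟨0, hm⟩).2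
    simp at this
  choose v hv using GenIndep.exists_isGreatest_thetaValues_of_admissible hP hQY hQX hRc
  have htheta : ∀ i, GenIndep.theta c P QY QX Rc (GenIndep.sndMarg (P i)) = v i := fun i => (hv i).isLUB.sSup_eq
  have : Nonempty (Fin m) := ⟨⟨0, hm⟩⟩
  refine ⟨?_, ?_, ?_⟩
  -- Not only the suprema but the sets of achievable exponents coincide.
  · unfold GenIndep.maxExponent
    simp only [GenIndep.achievable_mix_iff (c := c) hm (fun i => (hP i).1)
      (fun j n => ((hQY.holds j).mem n).1) (fun t n => ((hQX.holds t).mem n).1) hγp hγpm hγq1 hΓq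
      hΓq_lim]
  · rw [iInf_range]
    refine le_antisymm (sSup_le ?_) ?_
    · rintro _ ⟨E, hE, rfl⟩
      refine le_iInf fun i => ?_
      obtain ⟨w, hw, hle⟩ := GenIndep.exists_le_thetaValue_of_achievable hP hQY hQX hE (i₀ := i) rfl
      exact hle.trans (le_sSup hw)
    · simp only [htheta]
      rw [GenIndep.iInf_coe_eq]
      -- The minimum of the attained maxima is itself achievable, so no approximation is needed.
      exact le_sSup ⟨_, GenIndep.achievable_of_le_thetaValues hP hQY hQX hRc fun i => ⟨v i, (hv i).1,
        EReal.coe_le_coe_iff.2 (Finset.inf'_le v (Finset.mem_univ i))⟩, rfl⟩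
  · rintro _ ⟨i, rfl⟩
    change GenIndep.theta c P QY QX Rc (GenIndep.sndMarg (P i)) ∈ _
    rw [htheta]
    exact (hv i).1
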